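/- Let $0<\alpha<1$, $\theta>0$ with $0<\alpha\theta<1$, $0<p<1$, $q=1-p$ and $c=(p/q)^{1/\alpha}$. Products of random variables below are products of independent ones; $G_a$ and $B_{a,b}$ denote Gamma$(a)$ (scale $1$) and Beta$(a,b)$ variables. Let $X_\alpha$ have the density $$\varrho_\alpha(y)=\frac{\sin(\pi\alpha)}{\pi}\,\frac{y^{\alpha-1}}{y^{2\alpha}+2y^\alpha\cos(\pi\alpha)+1},\qquad y>0,$$ and let $\Lambda_{\alpha,p}$ be Lamperti's law, with density $$\frac{p\,q\,\sin(\alpha\pi)\,x^{\alpha-1}(1-x)^{\alpha-1}}{\pi\,[q^2x^{2\alpha}+p^2(1-x)^{2\alpha}+2pq\,x^\alpha(1-x)^\alpha\cos(\alpha\pi)]},\qquad 0<x<1.$$ For a probability law $H$ and $0<r<1$ put $H^{(r)}=rH+(1-r)\delta_0$. Let $M_t(H)=\int x\,P_{0,t}(dx)$ be the mean of the Dirichlet process $P_{0,t}$ with shape parameter $tH$. Let $P_{\alpha,\alpha\theta}=\sum_k P_k\delta_{Z_k}$ be the two-parameter Poisson–Dirichlet random probability measure, where $(P_k)$ has the PD$(\alpha,\alpha\theta)$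 law and is independent of the i.i.d. sequence $(Z_k)$ with a common non-atomic law, and let $C$ be a measurable set with $\mathbb E[P_{\alpha,\alpha\theta}(C)]=p$. Let $C_\alpha(x)=\cot^{-1}\!\big(\cot(\pi\alpha)+x^\alpha/\sin(\pi\alpha)\big)$, with $\cot^{-1}$ valued in $(0,\pi)$, and for $0<y<1$ let $$f_{\alpha,\theta}(y)=\frac{q^\theta}{\pi}\,\frac{y^{\alpha\theta-1}(1-y)^{-1}\sin\!\Big(\theta\, C_\alpha\big(\tfrac{q^{1/\alpha}y}{p^{1/\alpha}(1-y)}\big)\Big)}{[y^{2\alpha}q^2+2qp\,y^\alpha(1-y)^\alpha\cos(\alpha\pi)+(1-y)^{2\alpha}p^2]^{\theta/2}}.$$ (1) Suppose in addition $0<\theta<1$, and let $\xi^*_\theta\overset{d}{=}pB_{\theta,1-\theta}/(q+pB_{\theta,1-\theta})$. Then $\xi^*_\theta\overset{d}{=}pG_\theta/(G_\theta+G_{1-\theta}q)$ with $G_\theta,G_{1-\theta}$ independent. If $B_{\xi^*_\theta}$ is a $\xi^*_\theta$-randomly skewed Bessel process of dimension $2-2\alpha$ started at $0$, that is, conditionally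 on $\xi^*_\theta=r$ it is an $r$-skew Bessel process, then its time spent positive up to time $1$, $A_{\alpha,\xi^*_\theta}=\int_0^1\mathbf 1\{B_{\xi^*_\theta}(s)>0\}\,ds$, satisfies $$A_{\alpha,\xi^*_\theta}\overset{d}{=}\frac{cB_{\theta,1-\theta}^{1/\alpha}X_\alpha}{cB_{\theta,1-\theta}^{1/\alpha}X_\alpha+1}\overset{d}{=}\frac{cM_1(\varrho_\alpha^{(\alpha\theta)})}{cM_1(\varrho_\alpha^{(\alpha\theta)})+1},$$ and it has density $f_{\alpha,\theta}$ on $(0,1)$. (2) For all $\theta>0$ with $0<\alpha\theta<1$, the variable $cM_1(\varrho_\alpha^{(\alpha\theta)})/(cM_1(\varrho_\alpha^{(\alpha\theta)})+1)$ has density $f_{\alpha,\theta}$ on $(0,1)$. Moreover $$B_{\alpha\theta,1-\alpha\theta}\,P_{\alpha,\alpha\theta}(C)\overset{d}{=}B_{\alpha\theta,1-\alpha\theta}\,M_{\alpha\theta}(\Lambda_{\alpha,p})\overset{d}{=}M_1(\Lambda_{\alpha,p}^{(\alpha\theta)}),$$ and these have on $(0,1)$ the density $$\frac{1-y}{(1-p)^\theta}f_{\alpha,\theta}(y)=\frac1\pi\,\frac{y^{\alpha\theta-1}\sin\!\Big(\theta\,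 C_\alpha\big(\tfrac{q^{1/\alpha}y}{p^{1/\alpha}(1-y)}\big)\Big)}{[y^{2\alpha}q^2+2qp\,y^\alpha(1-y)^\alpha\cos(\alpha\pi)+(1-y)^{2\alpha}p^2]^{\theta/2}}.$$ -/

import Mathlib

open MeasureTheory ProbabilityTheory Set
open scoped NNReal ENNReal

namespace RandomSkew

noncomputable section

/-! ### The positive random variable `X_α`, Lamperti's law and the explicit densities -/

/-- The inverse cotangent with values in `(0, π)`. -/
def arccot (u : ℝ) : ℝ := Real.pi / 2 - Real.arctan u

/-- `C_α(x) = arccot (cot (π α) + x ^ α / sin (π α))`. -/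
def angle (α x : ℝ) : ℝ := arccot (Real.cot (Real.pi * α) + x ^ α / Real.sin (Real.pi * α))

/-- The density `ϱ_α` of `X_α`, the ratio of two independent positive `α`-stable variables. -/
def ratioDensity (α y : ℝ) : ℝ :=
  Real.sin (Real.pi * α) / Real.pi * y ^ (α - 1) /
    (y ^ (2 * α) + 2 * y ^ α * Real.cos (Real.pi * α) + 1)

/-- The law of `X_α` on `(0, ∞)`. -/
def ratioLaw (α : ℝ) : Measure ℝ :=
  (volume.restrict (Ioi 0)).withDensity fun y => ENNReal.ofReal (ratioDensity α y)

/-- The denominator `q² y^{2α} + 2 p q y^α (1-y)^α cos(απ) + p² (1-y)^{2α}`, where `q = 1 - p`. -/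
def denom (α p y : ℝ) : ℝ :=
  y ^ (2 * α) * (1 - p) ^ 2 +
    2 * (1 - p) * p * y ^ α * (1 - y) ^ α * Real.cos (α * Real.pi) +
    (1 - y) ^ (2 * α) * p ^ 2

/-- Lamperti's law `Λ_{α,p}` on `(0, 1)`. -/
def lampertiLaw (α p : ℝ) : Measure ℝ :=
  (volume.restrict (Ioo 0 1)).withDensity fun x => ENNReal.ofReal
    (p * (1 - p) * Real.sin (α * Real.pi) * x ^ (α - 1) * (1 - x) ^ (α - 1) /
      (Real.pi * denom α p x))

/-- `sin (θ C_α (q^{1/α} y / (p^{1/α} (1 - y))))`, where `q = 1 - p`. -/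
def sineFactor (α θ p y : ℝ) : ℝ :=
  Real.sin (θ * angle α ((1 - p) ^ (1 / α) * y / (p ^ (1 / α) * (1 - y))))

/-- The density `f_{α,θ}` on `(0, 1)`. -/
def occDensity (α θ p y : ℝ) : ℝ :=
  (1 - p) ^ θ / Real.pi *
    (y ^ (α * θ - 1) * (1 - y)⁻¹ * sineFactor α θ p y) / denom α p y ^ (θ / 2)

/-- The scale `c = (p / q)^{1/α}`, where `q = 1 - p`. -/
def scale (α p : ℝ) : ℝ := (p / (1 - p)) ^ (1 / α)

/-! ### Laws built from independent variables -/

/-- The law of `X * Y` for independent `X` and `Y` with laws `μ` and `ν`. -/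
def productLaw (μ ν : Measure ℝ) : Measure ℝ := (μ.prod ν).map fun w => w.1 * w.2

/-- The law of `c X / (c X + 1)` when `X` has law `μ`. -/
def squash (c : ℝ) (μ : Measure ℝ) : Measure ℝ := μ.map fun x => c * x / (c * x + 1)

/-- The law of `p B / (q + p B)`, `q = 1 - p`, where `B` is a `Beta(θ, 1 - θ)` variable: the law
of the random skewness `ξ*_θ`. -/
def skewnessLaw (θ p : ℝ) : Measure ℝ :=
  (betaMeasure θ (1 - θ)).map fun b => p * b / ((1 - p) + p * b)

/-- The law of `B^{1/α} X_α` for independent `B` and `X_α`, with `B` a `Beta(θ, 1 - θ)`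
variable. -/
def betaRatioLaw (α θ : ℝ) : Measure ℝ :=
  ((betaMeasure θ (1 - θ)).prod (ratioLaw α)).map fun w => w.1 ^ (1 / α) * w.2

/-- The law `H^{(r)} = r H + (1 - r) δ_0`. -/
def zeroMixture (r : ℝ) (H : Measure ℝ) : Measure ℝ :=
  ENNReal.ofReal r • H + ENNReal.ofReal (1 - r) • Measure.dirac 0

/-! ### Two-parameter Poisson-Dirichlet random probability measures and Dirichlet means

The ranked sequence of the weights below has the Poisson-Dirichlet law `PD(a, t)`. As the atoms are
i.i.d. and independent of the weights, the law of the random measure does not depend on the order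
in which the weights are listed. -/

/-- The weights `v_k (1 - v_0) ⋯ (1 - v_{k-1})`. -/
def stickWeight (v : ℕ → ℝ) (k : ℕ) : ℝ := v k * ∏ j ∈ Finset.range k, (1 - v j)

/-- The law of a sequence of independent variables `v_0, v_1, …` where `v_k` is
`Beta(1 - a, t + (k + 1) a)`. -/
def stickLaw (a t : ℝ) : Measure (ℕ → ℝ) :=
  Measure.infinitePi fun k : ℕ => betaMeasure (1 - a) (t + ((k : ℝ) + 1) * a)

/-- The discrete measure `P = ∑ k, P_k δ_{z k}` with weights `P_k = stickWeight v k`. -/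
def discreteMeasure {E : Type*} [MeasurableSpace E] (v : ℕ → ℝ) (z : ℕ → E) : Measure E :=
  Measure.sum fun k => ENNReal.ofReal (stickWeight v k) • Measure.dirac (z k)

/-- The law of `P_{a,t}(C)`, where `P_{a,t}` is the `PD(a, t)` random probability measure whose
atoms are i.i.d. with law `ν`. -/
def pdSetLaw {E : Type*} [MeasurableSpace E] (a t : ℝ) (ν : Measure E) (C : Set E) : Measure ℝ :=
  ((stickLaw a t).prod (Measure.infinitePi fun _ : ℕ => ν)).map
    fun w => (discreteMeasure w.1 w.2).real C

/-- The law of the Dirichlet mean `M_t(H) = ∫ x P_{0,t}(dx)`, where `P_{0,t}` is the Dirichlet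
process with shape parameter `t H`. -/
def dirichletMeanLaw (t : ℝ) (H : Measure ℝ) : Measure ℝ :=
  ((stickLaw 0 t).prod (Measure.infinitePi fun _ : ℕ => H)).map
    fun w => ∫ x, x ∂(discreteMeasure w.1 w.2)

/-! ### Skew Bessel processes of dimension `2 - 2α` -/

/-- The modified Bessel function of the first kind `I_ν(z)`, for `z > 0`. -/
def besselI (ν z : ℝ) : ℝ :=
  ∑' k : ℕ, (z / 2) ^ (2 * (k : ℝ) + ν) / ((k.factorial : ℝ) * Real.Gamma ((k : ℝ) + ν + 1))

/-- The density at `r > 0` of the law at time `t` of a Bessel process of dimension `2 - 2α` started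
at `0`. -/
def entranceDensity (α t r : ℝ) : ℝ :=
  2 * r ^ (1 - 2 * α) * Real.exp (-r ^ 2 / (2 * t)) / ((2 * t) ^ (1 - α) * Real.Gamma (1 - α))

/-- The density at time `s > 0` of the first hitting time of `0` by a Bessel process of dimension
`2 - 2α` started at `r > 0`. -/
def hittingDensity (α r s : ℝ) : ℝ :=
  r ^ (2 * α) / (2 ^ α * Real.Gamma α) * s ^ (-α - 1) * Real.exp (-r ^ 2 / (2 * s))

/-- The transition density, from `x > 0` to `r > 0` in time `t`, of a Bessel process of dimension
`2 - 2α` killed when it first hits `0`. -/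
def killedDensity (α t x r : ℝ) : ℝ :=
  r / t * (x / r) ^ α * Real.exp (-(x ^ 2 + r ^ 2) / (2 * t)) * besselI α (x * r / t)

/-- The density at `y` of the law at time `t` of the `p`-skew Bessel process started at `0`: the
sign is positive with probability `p`, independently of the absolute value. -/
def skewEntranceDensity (α p t y : ℝ) : ℝ :=
  if 0 < y then p * entranceDensity α t y
  else if y < 0 then (1 - p) * entranceDensity α t |y|
  else 0

/-- The transition density of the `p`-skew Bessel process of dimension `2 - 2α`. From `x ≠ 0` the
process keeps its sign and its absolute value moves as a Bessel process until that first hits `0`;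
from then on it moves as the process started at `0`. -/
def skewTransitionDensity (α p t x y : ℝ) : ℝ≥0∞ :=
  if x = 0 then ENNReal.ofReal (skewEntranceDensity α p t y)
  else
    (if 0 < x * y then ENNReal.ofReal (killedDensity α t |x| |y|) else 0) +
      ∫⁻ s in Ioo 0 t,
        ENNReal.ofReal (hittingDensity α |x| s * skewEntranceDensity α p (t - s) y)

/-- The transition probability `K_t(x, ·)` of the `p`-skew Bessel process of dimension `2 - 2α`. -/
def skewTransition (α p t x : ℝ) : Measure ℝ :=
  volume.withDensity (skewTransitionDensity α p t x)

/-- `B` is, under `μ`, a `p`-skew Bessel process of dimension `2 - 2α` started at `0`: a continuous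
process which is Markov, with respect to its own filtration, with the above transition
probabilities. -/
structure IsSkewBessel {Ω : Type*} [MeasurableSpace Ω] (α p : ℝ) (B : ℝ≥0 → Ω → ℝ)
    (μ : Measure Ω) : Prop where
  measurable : ∀ t, Measurable (B t)
  continuous : ∀ ω, Continuous fun t => B t ω
  start : ∀ᵐ ω ∂μ, B 0 ω = 0
  markov : ∀ s t : ℝ≥0, 0 < t → ∀ G : Set Ω,
    MeasurableSet[⨆ r : Iic s, MeasurableSpace.comap (B r) inferInstance] G →
    ∀ D : Set ℝ, MeasurableSet D →
      μ (G ∩ B (s + t) ⁻¹' D) = ∫⁻ ω in G, skewTransition α p t (B s ω) D ∂μ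

/-- `B` is a `ξ`-randomly skewed Bessel process of dimension `2 - 2α`: conditionally on `ξ = r`, it
is an `r`-skew Bessel process. Here `κ` is a regular conditional probability given `ξ`. -/
structure IsRandomlySkewedBessel {Ω : Type*} [MeasurableSpace Ω] (α : ℝ) (ξ : Ω → ℝ)
    (B : ℝ≥0 → Ω → ℝ) (μ : Measure Ω) : Prop where
  measurable_skewness : Measurable ξ
  conditional : ∃ κ : Kernel ℝ Ω, IsMarkovKernel κ ∧
    (∀ D : Set ℝ, MeasurableSet D → ∀ G : Set Ω, MeasurableSet G →
      μ (ξ ⁻¹' D ∩ G) = ∫⁻ r in D, κ r G ∂(μ.map ξ)) ∧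
    ∀ᵐ r ∂(μ.map ξ), IsSkewBessel α r B (κ r)

/-- The time spent positive up to time `1`. -/
def timePositive {Ω : Type*} (B : ℝ≥0 → Ω → ℝ) (ω : Ω) : ℝ :=
  ∫ s in (0 : ℝ)..1, if 0 < B s.toNNReal ω then 1 else 0

end

end RandomSkew

open RandomSkew

namespace SkewProof

open Filter Topology

/-! ### Uniqueness theorems for measures on the half-line -/

/-! Write `q = 1 - p`. All laws involved live on `[0, ∞)`, where a finite measure is determined by
its Stieltjes transform `∫ 1 / (1 + s x)` (`ext_of_stieltjes`), so the identities in law reduce to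
computing transforms, usually generalized ones `∫ (1 + s x) ^ (-t)`. The engine is the beta integral
`lintegral_beta_mix`: it handles independent beta factors as well as the first break of a stick.

Explicit densities. A contour integral in the strip `|Im w| ≤ π`, `w = log z`, inverts the transform
`(1 + s ^ α) ^ (-θ)` and produces `tiltedDensity`. For `θ = 1` this is the density of `X_α`, and the
image under `x ↦ c x / (c x + 1)` is `f_{α,θ}`. Conditioning on the beta variable gives `B ^ (1 / α)
X_α` the same transform.

Random means. Breaking off the first stick relates the transform of order `t + 1` for parameters
`(a, t)` to that of order `t + a` for `(a, t + a)` (`stieltjes_stickMeanLaw`). Combined with the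
derivative in `s`, this is a linear differential equation if `a = 0`, and a system coupling `t, t +
α, t + 2 α, …` if `a = α`. The equation is solved by `(1 + s ^ α) ^ (-θ)` for the zero mixture of
`X_α` with `t = 1`, and by `(p (1 + s) ^ α + q) ^ (-θ)` both for Lamperti's law with `t = α θ` and
for its zero mixture with `t = 1`. The system gives this last function for the mass of `C` as well.
A factor `Beta(α θ, 1 - α θ)` turns order `α θ` into order `1`, hence the equalities. The density
follows because `f_{α,θ}` weighted by `(1 - y) / q ^ θ` has this same transform.

Occupation times. If `A_u` is the time spent positive in `(u, 1)`, then `A_s ^ (n + 1) = (n + 1) ∫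
1{B_u > 0} A_u ^ n du` over `(s, 1)`, so the Markov property determines all moments by recursion on
`n`. The candidate moments (`posMoment`) describe a path which is positive up to its first zero and
then spends a Lamperti proportion of the remaining time positive. They satisfy the recursion
(`posMoment_step`): away from the origin by the Markov property of hitting times, and at the origin
by an identity for Lamperti moments which is checked by replacing the fixed horizon by an
exponential time (`occLaw_eq`). So a fixed skewness `r` yields Lamperti's law, the image of `X_α`
with scale `(r / (1 - r)) ^ (1 / α)`. When `r` is the random skewness, `r / (1 - r) = (p / q) B`, so
mixing over `r` multiplies the scale by `B ^ (1 / α)`. -/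

theorem ext_of_moments {μ ν : Measure ℝ} [IsFiniteMeasure μ] [IsFiniteMeasure ν]
    (hμ : ∀ᵐ x ∂μ, x ∈ Icc (0 : ℝ) 1) (hν : ∀ᵐ x ∂ν, x ∈ Icc (0 : ℝ) 1)
    (h : ∀ n : ℕ, ∫ x, x ^ n ∂μ = ∫ x, x ^ n ∂ν) : μ = ν := by
  have key : ∀ (ρ : Measure ℝ) [IsFiniteMeasure ρ], (∀ᵐ x ∂ρ, x ∈ Icc (0 : ℝ) 1) →
      ∀ n : ℕ, Integrable (fun x : ℝ => x ^ n) ρ := by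
    intro ρ _ hρ n
    refine Integrable.of_bound (by fun_prop) 1 ?_
    filter_upwards [hρ] with x hx
    rw [norm_pow, Real.norm_of_nonneg hx.1]
    exact pow_le_one₀ hx.1 hx.2
  have keyp : ∀ (ρ : Measure ℝ) [IsFiniteMeasure ρ], (∀ᵐ x ∂ρ, x ∈ Icc (0 : ℝ) 1) →
      ∀ q : Polynomial ℝ, Integrable (fun x : ℝ => q.eval x) ρ := by
    intro ρ _ hρ q
    simp only [Polynomial.eval_eq_sum_range]
    exact integrable_finsetSum _ fun i _ => (key ρ hρ i).const_mul _
  have hpoly : ∀ q : Polynomial ℝ, ∫ x, q.eval x ∂μ = ∫ x, q.eval x ∂ν := by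
    intro q
    simp only [Polynomial.eval_eq_sum_range]
    rw [integral_finsetSum _ fun i _ => (key μ hμ i).const_mul _,
      integral_finsetSum _ fun i _ => (key ν hν i).const_mul _]
    simp only [integral_const_mul, h]
  have hmass : ∀ (ρ : Measure ℝ) [IsFiniteMeasure ρ], (∀ᵐ x ∂ρ, x ∈ Icc (0 : ℝ) 1) →
      ∀ (f : BoundedContinuousFunction ℝ ℝ) (q : Polynomial ℝ) (ε : ℝ),
      (∀ x ∈ Icc (0 : ℝ) 1, |q.eval x - f x| < ε) →
      |∫ x, q.eval x ∂ρ - ∫ x, f x ∂ρ| ≤ ε * ρ.real univ := by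
    intro ρ _ hρ f q ε hq
    rw [← integral_sub (keyp ρ hρ q) (f.integrable ρ)]
    refine norm_integral_le_of_norm_le_const (μ := ρ) (f := fun x => q.eval x - f x) ?_
    filter_upwards [hρ] with x hx using (hq x hx).le
  refine ext_of_forall_integral_eq_of_IsFiniteMeasure fun f => ?_
  refine eq_of_forall_dist_le fun ε hε => ?_
  -- The approximation error `ε / M` is paid once for each measure. The extra `1` keeps `M` positive
  -- when both measures vanish.
  set M := μ.real univ + ν.real univ + 1 with hM
  have hMpos : 0 < M := by positivity
  obtain ⟨q, hq⟩ := exists_polynomial_near_of_continuousOn 0 1 f f.continuous.continuousOn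
    (ε / M) (by positivity)
  have h1 := hmass μ hμ f q _ hq
  have h2 := hmass ν hν f q _ hq
  rw [hpoly q] at h1
  rw [Real.dist_eq]
  have : ε / M * μ.real univ + ε / M * ν.real univ ≤ ε := by
    rw [← mul_add, div_mul_eq_mul_div, div_le_iff₀ hMpos]
    gcongr
    rw [hM]; linarith
  have h1' := abs_le.1 h1
  have h2' := abs_le.1 h2
  rw [abs_le]
  constructor <;> linarith [h1'.1, h1'.2, h2'.1, h2'.2]

/-- The moments are peeled off one at a time: `x ^ (n + 1) / (1 - ε x)` is `ε⁻¹ (x ^ n / (1 - ε x) -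
x ^ n)`, so once the transforms weighted by `x ^ n` agree, letting `ε → 0` equates the `n`-th
moments, and then the transforms weighted by `x ^ (n + 1)` agree too. -/
theorem moments_of_geometric {μ ν : Measure ℝ} [IsFiniteMeasure μ] [IsFiniteMeasure ν]
    (hμ : ∀ᵐ x ∂μ, x ∈ Icc (0 : ℝ) 1) (hν : ∀ᵐ x ∂ν, x ∈ Icc (0 : ℝ) 1)
    (h : ∀ ε ∈ Ioo (0 : ℝ) 1, ∫ x, 1 / (1 - ε * x) ∂μ = ∫ x, 1 / (1 - ε * x) ∂ν) :
    μ = ν := by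
  have bnd : ∀ x ∈ Icc (0 : ℝ) 1, ∀ ε ∈ Ioo (0 : ℝ) 1, 1 - ε ≤ 1 - ε * x := by
    intro x hx ε hε
    nlinarith [hx.1, hx.2, hε.1, hε.2]
  have hint : ∀ (ρ : Measure ℝ) [IsFiniteMeasure ρ], (∀ᵐ x ∂ρ, x ∈ Icc (0 : ℝ) 1) →
      ∀ n : ℕ, ∀ ε ∈ Ioo (0 : ℝ) 1, Integrable (fun x => x ^ n / (1 - ε * x)) ρ := by
    intro ρ _ hρ n ε hε
    refine Integrable.of_bound (Measurable.aestronglyMeasurable (by fun_prop)) (1 / (1 - ε)) ?_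
    filter_upwards [hρ] with x hx
    have h1 := bnd x hx ε hε
    have h2 : 0 < 1 - ε := by linarith [hε.2]
    rw [norm_div, norm_pow, Real.norm_of_nonneg hx.1, Real.norm_of_nonneg (h2.le.trans h1)]
    exact div_le_div₀ zero_le_one (pow_le_one₀ hx.1 hx.2) h2 h1
  have hintp : ∀ (ρ : Measure ℝ) [IsFiniteMeasure ρ], (∀ᵐ x ∂ρ, x ∈ Icc (0 : ℝ) 1) →
      ∀ n : ℕ, Integrable (fun x : ℝ => x ^ n) ρ := by
    intro ρ _ hρ n
    refine Integrable.of_bound (by fun_prop) 1 ?_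
    filter_upwards [hρ] with x hx
    rw [norm_pow, Real.norm_of_nonneg hx.1]
    exact pow_le_one₀ hx.1 hx.2
  have hlim : ∀ (ρ : Measure ℝ) [IsFiniteMeasure ρ], (∀ᵐ x ∂ρ, x ∈ Icc (0 : ℝ) 1) →
      ∀ n : ℕ, Tendsto (fun ε : ℝ => ∫ x, x ^ n / (1 - ε * x) ∂ρ) (𝓝[>] 0)
        (𝓝 (∫ x, x ^ n ∂ρ)) := by
    intro ρ _ hρ n
    refine tendsto_integral_filter_of_dominated_convergence (fun _ => 2) ?_ ?_
      (integrable_const _) ?_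
    · exact Eventually.of_forall fun ε => Measurable.aestronglyMeasurable (by fun_prop)
    · have : Ioo (0 : ℝ) (1 / 2) ∈ 𝓝[>] (0 : ℝ) := Ioo_mem_nhdsGT (by norm_num)
      filter_upwards [this] with ε hε
      filter_upwards [hρ] with x hx
      have h1 := bnd x hx ε ⟨hε.1, by linarith [hε.2]⟩
      have h2 : 1 / 2 ≤ 1 - ε * x := by linarith [hε.2]
      rw [norm_div, norm_pow, Real.norm_of_nonneg hx.1, Real.norm_of_nonneg (by linarith)]
      refine (div_le_div₀ zero_le_one (pow_le_one₀ hx.1 hx.2) (by norm_num) h2).trans ?_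
      norm_num
    · filter_upwards [hρ] with x hx
      have : Tendsto (fun ε : ℝ => x ^ n / (1 - ε * x)) (𝓝 0) (𝓝 (x ^ n / (1 - 0 * x))) := by
        refine Tendsto.div tendsto_const_nhds ?_ (by norm_num)
        exact (continuous_const.sub (continuous_id.mul continuous_const)).tendsto _
      simpa using this.mono_left nhdsWithin_le_nhds
  have hP : ∀ n : ℕ, ∀ ε ∈ Ioo (0 : ℝ) 1,
      ∫ x, x ^ n / (1 - ε * x) ∂μ = ∫ x, x ^ n / (1 - ε * x) ∂ν := by
    intro n
    induction n with
    | zero => simpa using h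
    | succ n ih =>
      have hm : ∫ x, x ^ n ∂μ = ∫ x, x ^ n ∂ν := by
        refine tendsto_nhds_unique (hlim μ hμ n) ((hlim ν hν n).congr' ?_)
        have : Ioo (0 : ℝ) 1 ∈ 𝓝[>] (0 : ℝ) := Ioo_mem_nhdsGT one_pos
        filter_upwards [this] with ε hε using (ih ε hε).symm
      intro ε hε
      have hstep : ∀ (ρ : Measure ℝ) [IsFiniteMeasure ρ], (∀ᵐ x ∂ρ, x ∈ Icc (0 : ℝ) 1) →
          ∫ x, x ^ (n + 1) / (1 - ε * x) ∂ρ =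
            ε⁻¹ * (∫ x, x ^ n / (1 - ε * x) ∂ρ - ∫ x, x ^ n ∂ρ) := by
        intro ρ _ hρ
        rw [← integral_sub (hint ρ hρ n ε hε) (hintp ρ hρ n), ← integral_const_mul]
        refine integral_congr_ae ?_
        filter_upwards [hρ] with x hx
        have h1 := bnd x hx ε hε
        have h2 : 1 - ε * x ≠ 0 := by linarith [hε.2]
        have h3 : ε ≠ 0 := hε.1.ne'
        field_simp
        ring
      rw [hstep μ hμ, hstep ν hν, ih ε hε, hm]
  refine ext_of_moments hμ hν fun n => ?_
  refine tendsto_nhds_unique (hlim μ hμ n) ((hlim ν hν n).congr' ?_)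
  have : Ioo (0 : ℝ) 1 ∈ 𝓝[>] (0 : ℝ) := Ioo_mem_nhdsGT one_pos
  filter_upwards [this] with ε hε using (hP n ε hε).symm

/-- A finite measure on `[0, ∞)` is determined by its Stieltjes transform. -/
theorem ext_of_stieltjes {μ ν : Measure ℝ} [IsFiniteMeasure μ] [IsFiniteMeasure ν]
    (hμ : ∀ᵐ x ∂μ, 0 ≤ x) (hν : ∀ᵐ x ∂ν, 0 ≤ x)
    (h : ∀ s : ℝ, 0 < s → ∫ x, 1 / (1 + s * x) ∂μ = ∫ x, 1 / (1 + s * x) ∂ν) : μ = ν := by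
  -- The half-line is compressed to `[0, 1]` by `T`. The weight `w` is chosen so that `w(x) / (1 - ε
  -- T(x)) = 1 / (1 + (1 - ε) x)`, a Stieltjes kernel with `s = 1 - ε`.
  let w : ℝ → ℝ≥0∞ := fun x => ENNReal.ofReal (1 / (1 + x))
  let T : ℝ → ℝ := fun x => x / (1 + x)
  have hwm : Measurable w := by fun_prop
  have hTm : Measurable T := by fun_prop
  have fin : ∀ (ρ : Measure ℝ) [IsFiniteMeasure ρ], (∀ᵐ x ∂ρ, 0 ≤ x) →
      IsFiniteMeasure (ρ.withDensity w) := by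
    intro ρ _ hρ
    refine isFiniteMeasure_withDensity_ofReal (Integrable.hasFiniteIntegral ?_)
    refine Integrable.of_bound (Measurable.aestronglyMeasurable (by fun_prop)) 1 ?_
    filter_upwards [hρ] with x hx
    rw [Real.norm_of_nonneg (by positivity), div_le_one (by linarith)]
    linarith
  have supp : ∀ (ρ : Measure ℝ) [IsFiniteMeasure ρ], (∀ᵐ x ∂ρ, 0 ≤ x) →
      ∀ᵐ x ∂((ρ.withDensity w).map T), x ∈ Icc (0 : ℝ) 1 := by
    intro ρ _ hρ
    rw [ae_map_iff hTm.aemeasurable (p := fun x => x ∈ Icc (0 : ℝ) 1) measurableSet_Icc]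
    refine (withDensity_absolutelyContinuous ρ w).ae_le ?_
    filter_upwards [hρ] with x hx
    refine ⟨by positivity, ?_⟩
    rw [div_le_one (by linarith)]; linarith
  have val : ∀ (ρ : Measure ℝ) [IsFiniteMeasure ρ], (∀ᵐ x ∂ρ, 0 ≤ x) → ∀ ε ∈ Ioo (0 : ℝ) 1,
      ∫ y, 1 / (1 - ε * y) ∂((ρ.withDensity w).map T) = ∫ x, 1 / (1 + (1 - ε) * x) ∂ρ := by
    intro ρ _ hρ ε hε
    rw [integral_map hTm.aemeasurable (Measurable.aestronglyMeasurable (by fun_prop))]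
    rw [integral_withDensity_eq_integral_toReal_smul hwm (by simp [w])]
    refine integral_congr_ae ?_
    filter_upwards [hρ] with x hx
    have h1 : 0 < 1 + x := by linarith
    have h2 : 0 < 1 + (1 - ε) * x := by nlinarith [hε.2]
    simp only [w, T, smul_eq_mul]
    rw [ENNReal.toReal_ofReal (by positivity)]
    have h3 : 1 - ε * (x / (1 + x)) = (1 + (1 - ε) * x) / (1 + x) := by
      field_simp; ring
    rw [h3]
    field_simp
  have back : ∀ (ρ : Measure ℝ) [IsFiniteMeasure ρ], (∀ᵐ x ∂ρ, 0 ≤ x) →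
      (((ρ.withDensity w).map T).map fun y => y / (1 - y)).withDensity
        (fun x => ENNReal.ofReal (1 + x)) = ρ := by
    intro ρ _ hρ
    rw [Measure.map_map (by fun_prop) hTm]
    have h1 : (ρ.withDensity w).map ((fun y => y / (1 - y)) ∘ T) = (ρ.withDensity w).map id := by
      refine Measure.map_congr ?_
      refine (withDensity_absolutelyContinuous ρ w).ae_le ?_
      filter_upwards [hρ] with x hx
      have h1 : 0 < 1 + x := by linarith
      simp only [T, Function.comp, id]
      have h3 : 1 - x / (1 + x) = 1 / (1 + x) := by field_simp; ring
      rw [h3]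
      field_simp
    rw [h1, Measure.map_id, ← withDensity_mul _ hwm (by fun_prop)]
    rw [withDensity_congr_ae (g := 1), withDensity_one]
    filter_upwards [hρ] with x hx
    simp only [w, Pi.mul_apply, Pi.one_apply]
    rw [← ENNReal.ofReal_mul (by positivity)]
    have h1 : 0 < 1 + x := by linarith
    rw [one_div_mul_cancel h1.ne', ENNReal.ofReal_one]
  have := fin μ hμ
  have := fin ν hν
  have hEq : (μ.withDensity w).map T = (ν.withDensity w).map T := by
    refine moments_of_geometric (supp μ hμ) (supp ν hν) fun ε hε => ?_
    rw [val μ hμ ε hε, val ν hν ε hε, h _ (by linarith [hε.2])]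
  rw [← back μ hμ, hEq, back ν hν]

/-! ### Substitutions and beta integrals -/

theorem lintegral_Ioi_comp_mul (f : ℝ → ℝ≥0∞) {c : ℝ} (hc : 0 < c) :
    ∫⁻ y in Ioi 0, f y = ENNReal.ofReal c * ∫⁻ y in Ioi 0, f (c * y) := by
  have himg : (fun y : ℝ => c * y) '' Ioi 0 = Ioi 0 := by
    rw [image_mul_left_Ioi hc, mul_zero]
  conv_lhs => rw [← himg]
  rw [lintegral_image_eq_lintegral_abs_deriv_mul measurableSet_Ioi
    (f := fun y => c * y) (f' := fun _ => c)
    (fun x _ => by simpa using ((hasDerivAt_id x).const_mul c).hasDerivWithinAt)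
    (fun x _ y _ hxy => mul_left_cancel₀ hc.ne' hxy)]
  rw [abs_of_pos hc, lintegral_const_mul' _ _ ENNReal.ofReal_ne_top]

/-- The substitution `x = c y / (c y + 1)` from `(0, ∞)` to `(0, 1)`. -/
theorem lintegral_Ioo_comp_squash (f : ℝ → ℝ≥0∞) {c : ℝ} (hc : 0 < c) :
    ∫⁻ x in Ioo 0 1, f x =
      ∫⁻ y in Ioi 0, ENNReal.ofReal (c / (c * y + 1) ^ 2) * f (c * y / (c * y + 1)) := by
  have himg : (fun y : ℝ => c * y / (c * y + 1)) '' Ioi 0 = Ioo 0 1 := by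
    ext x
    simp only [mem_image, mem_Ioi, mem_Ioo]
    constructor
    · rintro ⟨y, hy, rfl⟩
      refine ⟨by positivity, ?_⟩
      rw [div_lt_one (by positivity)]
      linarith
    · rintro ⟨h0, h1⟩
      have h2 : 0 < 1 - x := by linarith
      refine ⟨x / (1 - x) / c, by positivity, ?_⟩
      field_simp
      ring
  rw [← himg, lintegral_image_eq_lintegral_abs_deriv_mul measurableSet_Ioi
    (f' := fun y => c / (c * y + 1) ^ 2)]
  · refine setLIntegral_congr_fun measurableSet_Ioi fun y hy => ?_
    rw [mem_Ioi] at hy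
    rw [abs_of_pos (by positivity)]
  · intro y hy
    rw [mem_Ioi] at hy
    have h1 : HasDerivAt (fun y : ℝ => c * y) c y := by
      simpa using (hasDerivAt_id y).const_mul c
    have h2 : c * y + 1 ≠ 0 := by positivity
    convert! (h1.div (h1.add_const 1) h2).hasDerivWithinAt using 1
    ring
  · intro x hx y hy hxy
    rw [mem_Ioi] at hx hy
    have hx' : 0 < c * x + 1 := by positivity
    have hy' : 0 < c * y + 1 := by positivity
    simp only [] at hxy
    rw [div_eq_div_iff hx'.ne' hy'.ne'] at hxy
    have : c * (x - y) = 0 := by linarith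
    rcases mul_eq_zero.1 this with h | h
    · exact absurd h hc.ne'
    · linarith

theorem lintegral_betaMeasure_Ioo (h : ℝ → ℝ≥0∞) (a b : ℝ) :
    ∫⁻ v, h v ∂(betaMeasure a b) =
      ∫⁻ v in Ioo 0 1, ENNReal.ofReal (1 / beta a b * v ^ (a - 1) * (1 - v) ^ (b - 1)) * h v := by
  have hm : Measurable (betaPDF a b) := by unfold betaPDF; fun_prop
  rw [betaMeasure, lintegral_withDensity_eq_lintegral_mul_non_measurable _ hm
    (Eventually.of_forall fun _ => ENNReal.ofReal_lt_top), ← lintegral_indicator measurableSet_Ioo]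
  refine lintegral_congr fun v => ?_
  by_cases hv : v ∈ Ioo (0 : ℝ) 1
  · rw [indicator_of_mem hv, Pi.mul_apply, betaPDF_of_pos_lt_one hv.1 hv.2]
  · rw [indicator_of_notMem hv, Pi.mul_apply, betaPDF_eq,
      if_neg (show ¬(0 < v ∧ v < 1) from hv)]
    simp

theorem ae_betaMeasure (a b : ℝ) : ∀ᵐ v ∂(betaMeasure a b), v ∈ Ioo (0 : ℝ) 1 := by
  rw [ae_iff]
  have := lintegral_betaMeasure_Ioo ((Ioo (0 : ℝ) 1)ᶜ.indicator 1) a b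
  rw [lintegral_indicator_one measurableSet_Ioo.compl] at this
  change betaMeasure a b ((Ioo (0 : ℝ) 1)ᶜ) = 0
  rw [this]
  refine setLIntegral_eq_zero measurableSet_Ioo fun v hv => ?_
  simp [hv.1, hv.2]

/-- A beta variable as `Y / (1 + Y)` with `Y` a beta prime variable. -/
theorem lintegral_betaMeasure (h : ℝ → ℝ≥0∞) {a b : ℝ} (ha : 0 < a) (hb : 0 < b) :
    ∫⁻ v, h v ∂(betaMeasure a b) =
      ∫⁻ y in Ioi 0, ENNReal.ofReal (1 / beta a b * y ^ (a - 1) * (1 + y) ^ (-(a + b))) *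
        h (y / (1 + y)) := by
  rw [lintegral_betaMeasure_Ioo, lintegral_Ioo_comp_squash _ one_pos]
  refine setLIntegral_congr_fun measurableSet_Ioi fun y hy => ?_
  rw [mem_Ioi] at hy
  have hB := beta_pos ha hb
  have h1 : 0 < 1 + y := by positivity
  simp only [one_mul]
  rw [add_comm y 1, ← mul_assoc, ← ENNReal.ofReal_mul (by positivity)]
  congr 2
  have h2 : 1 - y / (1 + y) = (1 + y)⁻¹ := by field_simp; ring
  rw [h2, Real.div_rpow hy.le h1.le, Real.inv_rpow h1.le, Real.rpow_neg h1.le]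
  have h3 : (1 + y) ^ (a + b) = (1 + y) ^ (a - 1) * (1 + y) ^ (b - 1) * (1 + y) ^ 2 := by
    rw [← Real.rpow_natCast, ← Real.rpow_add h1, ← Real.rpow_add h1]
    congr 1; push_cast; ring
  rw [h3]
  field_simp

theorem lintegral_betaPrime {a b : ℝ} (ha : 0 < a) (hb : 0 < b) :
    ∫⁻ y in Ioi 0, ENNReal.ofReal (1 / beta a b * y ^ (a - 1) * (1 + y) ^ (-(a + b))) = 1 := by
  have := lintegral_betaMeasure 1 ha hb
  have hp := isProbabilityMeasureBeta ha hb
  simpa using this.symm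

/-- Feynman's parameter formula. With `v = y / (1 + y)` and then `y = (b / a) z`, the mixture
becomes `b (1 + z) / (1 + (b / a) z)`, the powers of `1 + (b / a) z` cancel, and a normalized beta
prime density remains. -/
theorem lintegral_beta_mix {x y a b : ℝ} (hx : 0 < x) (hy : 0 < y) (ha : 0 < a) (hb : 0 < b) :
    ∫⁻ v, ENNReal.ofReal ((v * a + (1 - v) * b) ^ (-(x + y))) ∂(betaMeasure x y) =
      ENNReal.ofReal (a ^ (-x) * b ^ (-y)) := by
  have hB := beta_pos hx hy
  rw [lintegral_betaMeasure _ hx hy, lintegral_Ioi_comp_mul _ (div_pos hb ha)]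
  have : ∀ z ∈ Ioi (0 : ℝ),
      ENNReal.ofReal (1 / beta x y * (b / a * z) ^ (x - 1) * (1 + b / a * z) ^ (-(x + y))) *
        ENNReal.ofReal ((b / a * z / (1 + b / a * z) * a + (1 - b / a * z / (1 + b / a * z)) * b) ^
          (-(x + y))) = ENNReal.ofReal ((b / a) ^ (x - 1) * b ^ (-(x + y))) *
        ENNReal.ofReal (1 / beta x y * z ^ (x - 1) * (1 + z) ^ (-(x + y))) := by
    intro z hz
    rw [mem_Ioi] at hz
    have hr : 0 < b / a := by positivity
    rw [← ENNReal.ofReal_mul (by positivity), ← ENNReal.ofReal_mul (by positivity)]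
    congr 1
    have h1 : b / a * z / (1 + b / a * z) * a + (1 - b / a * z / (1 + b / a * z)) * b =
        b * (1 + z) / (1 + b / a * z) := by
      field_simp; ring
    rw [h1, Real.div_rpow (by positivity) (by positivity), Real.mul_rpow hr.le hz.le,
      Real.mul_rpow hb.le (by positivity)]
    have h2 : (1 + b / a * z) ^ (-(x + y)) ≠ 0 := by positivity
    field_simp
  rw [setLIntegral_congr_fun measurableSet_Ioi this, lintegral_const_mul' _ _ ENNReal.ofReal_ne_top,
    lintegral_betaPrime hx hy, mul_one, ← ENNReal.ofReal_mul (by positivity)]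
  congr 1
  rw [Real.div_rpow hb.le ha.le, neg_add, Real.rpow_add hb, Real.rpow_sub hb, Real.rpow_sub ha,
    Real.rpow_neg ha.le, Real.rpow_one, Real.rpow_one, Real.rpow_neg hb.le x]
  field_simp

theorem beta_one_sub (a : ℝ) :
    1 / beta a (1 - a) = Real.sin (Real.pi * a) / Real.pi := by
  rw [beta, add_sub_cancel, Real.Gamma_one, div_one, Real.Gamma_mul_Gamma_one_sub, one_div_div]

/-- Euler's integral `∫ y ^ (a - 1) / (1 + y) dy = π / sin (π a)`. -/
theorem lintegral_rpow_div_add {a c : ℝ} (ha : 0 < a) (ha1 : a < 1) (hc : 0 < c) :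
    ∫⁻ y in Ioi 0, ENNReal.ofReal (Real.sin (Real.pi * a) / Real.pi * y ^ (a - 1) / (c + y)) =
      ENNReal.ofReal (c ^ (a - 1)) := by
  rw [lintegral_Ioi_comp_mul _ hc]
  have h0 : 0 ≤ Real.sin (Real.pi * a) / Real.pi :=
    div_nonneg (Real.sin_nonneg_of_nonneg_of_le_pi (by positivity)
      (by nlinarith [Real.pi_pos])) Real.pi_pos.le
  have : ∀ z ∈ Ioi (0 : ℝ), ENNReal.ofReal
      (Real.sin (Real.pi * a) / Real.pi * (c * z) ^ (a - 1) / (c + c * z)) =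
      ENNReal.ofReal (c ^ (a - 1) / c) *
        ENNReal.ofReal (1 / beta a (1 - a) * z ^ (a - 1) * (1 + z) ^ (-(a + (1 - a)))) := by
    intro z hz
    rw [mem_Ioi] at hz
    rw [← ENNReal.ofReal_mul (by positivity), beta_one_sub, add_sub_cancel,
      Real.rpow_neg_one, Real.mul_rpow hc.le hz.le]
    congr 1
    field_simp
  rw [setLIntegral_congr_fun measurableSet_Ioi this, lintegral_const_mul' _ _ ENNReal.ofReal_ne_top,
    lintegral_betaPrime ha (by linarith), mul_one, ← ENNReal.ofReal_mul hc.le]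
  congr 1
  field_simp

theorem lintegral_gammaMeasure (h : ℝ → ℝ≥0∞) (a : ℝ) :
    ∫⁻ x, h x ∂(gammaMeasure a 1) =
      ∫⁻ x in Ioi 0, ENNReal.ofReal (1 / Real.Gamma a * x ^ (a - 1) * Real.exp (-x)) * h x := by
  have hm : Measurable (gammaPDF a 1) := by unfold gammaPDF; fun_prop
  rw [gammaMeasure, lintegral_withDensity_eq_lintegral_mul_non_measurable _ hm
    (Eventually.of_forall fun _ => ENNReal.ofReal_lt_top), setLIntegral_congr Ioi_ae_eq_Ici,
    ← lintegral_indicator measurableSet_Ici]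
  refine lintegral_congr fun v => ?_
  by_cases hv : v ∈ Ici (0 : ℝ)
  · rw [indicator_of_mem hv, Pi.mul_apply, gammaPDF_of_nonneg hv]
    simp
  · rw [indicator_of_notMem hv, Pi.mul_apply, gammaPDF_of_neg (by simpa using hv)]
    simp

theorem lintegral_rpow_mul_exp {a b : ℝ} (ha : 0 < a) (hb : 0 < b) :
    ∫⁻ x in Ioi 0, ENNReal.ofReal (x ^ (a - 1) * Real.exp (-(b * x))) =
      ENNReal.ofReal (b ^ (-a) * Real.Gamma a) := by
  have h1 := Real.integral_rpow_mul_exp_neg_mul_Ioi ha hb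
  have h2 : IntegrableOn (fun x : ℝ => x ^ (a - 1) * Real.exp (-(b * x))) (Ioi 0) := by
    refine Integrable.of_integral_ne_zero ?_
    rw [h1]
    have := Real.Gamma_pos_of_pos ha
    positivity
  rw [← ofReal_integral_eq_lintegral_ofReal h2, h1, one_div, Real.inv_rpow hb.le,
    Real.rpow_neg hb.le]
  exact ae_restrict_of_forall_mem measurableSet_Ioi fun x hx => by
    rw [mem_Ioi] at hx; positivity

/-- The ratio `G₁ / (G₁ + G₂)` of independent gamma variables is a beta variable. -/
theorem lintegral_gamma_ratio (h : ℝ → ℝ≥0∞) (hh : Measurable h) {a b : ℝ} (ha : 0 < a)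
    (hb : 0 < b) :
    ∫⁻ w, h (w.1 / (w.1 + w.2)) ∂((gammaMeasure a 1).prod (gammaMeasure b 1)) =
      ∫⁻ v, h v ∂(betaMeasure a b) := by
  have := isProbabilityMeasure_gammaMeasure ha one_pos
  have := isProbabilityMeasure_gammaMeasure hb one_pos
  have hG := Real.Gamma_pos_of_pos ha
  have hG' := Real.Gamma_pos_of_pos hb
  rw [lintegral_prod_symm _ (by fun_prop), lintegral_gammaMeasure, lintegral_betaMeasure _ ha hb]
  have h1 : ∀ y ∈ Ioi (0 : ℝ), ENNReal.ofReal (1 / Real.Gamma b * y ^ (b - 1) * Real.exp (-y)) *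
      ∫⁻ x, h (x / (x + y)) ∂(gammaMeasure a 1) =
      ∫⁻ x in Ioi 0, ENNReal.ofReal (1 / Real.Gamma a * (1 / Real.Gamma b) * x ^ (a - 1)) *
        h (x / (1 + x)) * ENNReal.ofReal (y ^ (a + b - 1) * Real.exp (-((1 + x) * y))) := by
    intro y hy
    rw [mem_Ioi] at hy
    rw [lintegral_gammaMeasure, lintegral_Ioi_comp_mul _ hy, ← mul_assoc,
      ← ENNReal.ofReal_mul (by positivity), ← lintegral_const_mul' _ _ ENNReal.ofReal_ne_top]
    refine setLIntegral_congr_fun measurableSet_Ioi fun x hx => ?_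
    rw [mem_Ioi] at hx
    have h2 : y * x / (y * x + y) = x / (1 + x) := by field_simp; ring
    rw [h2, ← mul_assoc, mul_right_comm _ (h (x / (1 + x))), ← ENNReal.ofReal_mul (by positivity),
      ← ENNReal.ofReal_mul (by positivity)]
    congr 2
    have h3 : Real.exp (-((1 + x) * y)) = Real.exp (-y) * Real.exp (-(y * x)) := by
      rw [← Real.exp_add]; ring_nf
    have h4 : y ^ (a + b - 1) = y ^ (b - 1) * y * y ^ (a - 1) := by
      rw [← Real.rpow_add_one hy.ne', ← Real.rpow_add hy]; ring_nf
    rw [h3, h4, Real.mul_rpow hy.le hx.le]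
    ring
  rw [setLIntegral_congr_fun measurableSet_Ioi h1, lintegral_lintegral_swap]
  · refine setLIntegral_congr_fun measurableSet_Ioi fun x hx => ?_
    rw [mem_Ioi] at hx
    rw [lintegral_const_mul _ (by fun_prop), lintegral_rpow_mul_exp (by positivity) (by positivity),
      mul_right_comm, ← ENNReal.ofReal_mul (by positivity)]
    congr 2
    have := Real.Gamma_pos_of_pos (add_pos ha hb)
    rw [beta]
    field_simp
  · exact Measurable.aemeasurable (by fun_prop)

theorem map_gamma_ratio {a b : ℝ} (ha : 0 < a) (hb : 0 < b) :
    ((gammaMeasure a 1).prod (gammaMeasure b 1)).map (fun w => w.1 / (w.1 + w.2)) =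
      betaMeasure a b := by
  ext s hs
  have := lintegral_gamma_ratio (s.indicator 1) (measurable_one.indicator hs) ha hb
  rw [lintegral_indicator_one hs] at this
  rw [← this, ← lintegral_indicator_one hs, lintegral_map (measurable_one.indicator hs)
    (by fun_prop)]

/-! ### A Stieltjes inversion formula by contour integration in a strip -/

theorem lintegral_Ioi_comp_exp (f : ℝ → ℝ≥0∞) :
    ∫⁻ y in Ioi 0, f y = ∫⁻ x, ENNReal.ofReal (Real.exp x) * f (Real.exp x) := by
  have himg : Real.exp '' univ = Ioi 0 := by rw [image_univ, Real.range_exp]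
  rw [← himg, lintegral_image_eq_lintegral_abs_deriv_mul MeasurableSet.univ
    (fun x _ => (Real.hasDerivAt_exp x).hasDerivWithinAt) Real.exp_injective.injOn,
    setLIntegral_univ]
  simp only [Real.abs_exp]

/-- Euler's integral in the coordinate `x = log y`. It supplies both the integrable majorant for the
contour argument and the value for the comparison function `exp ((γ - 1) w)`. -/
theorem integrable_strip_kernel {γ : ℝ} (h0 : 0 < γ) (h1 : γ < 1) (x₀ : ℝ) :
    Integrable (fun x => Real.exp ((γ - 1) * x) * (Real.exp x / (Real.exp x + Real.exp x₀))) ∧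
    ∫ x, Real.exp ((γ - 1) * x) * (Real.exp x / (Real.exp x + Real.exp x₀)) =
      Real.pi / Real.sin (Real.pi * γ) * Real.exp ((γ - 1) * x₀) := by
  have hs : 0 < Real.sin (Real.pi * γ) :=
    Real.sin_pos_of_pos_of_lt_pi (by positivity) (by nlinarith [Real.pi_pos])
  have hl := lintegral_rpow_div_add h0 h1 (Real.exp_pos x₀)
  rw [lintegral_Ioi_comp_exp] at hl
  have hlin : ∫⁻ x, ENNReal.ofReal
      (Real.exp ((γ - 1) * x) * (Real.exp x / (Real.exp x + Real.exp x₀))) =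
      ENNReal.ofReal (Real.pi / Real.sin (Real.pi * γ) * Real.exp ((γ - 1) * x₀)) := by
    have : ∀ x : ℝ, ENNReal.ofReal
        (Real.exp ((γ - 1) * x) * (Real.exp x / (Real.exp x + Real.exp x₀))) =
        ENNReal.ofReal (Real.pi / Real.sin (Real.pi * γ)) * (ENNReal.ofReal (Real.exp x) *
        ENNReal.ofReal (Real.sin (Real.pi * γ) / Real.pi * Real.exp x ^ (γ - 1) /
          (Real.exp x₀ + Real.exp x))) := by
      intro x
      have hp := Real.pi_pos
      rw [← ENNReal.ofReal_mul (by positivity), ← ENNReal.ofReal_mul (by positivity)]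
      congr 1
      rw [← Real.exp_mul, mul_comm x, add_comm (Real.exp x)]
      generalize Real.sin (Real.pi * γ) = S at hs
      field_simp
    have hp := Real.pi_pos
    rw [lintegral_congr this, lintegral_const_mul' _ _ ENNReal.ofReal_ne_top, hl,
      ← ENNReal.ofReal_mul (by positivity), ← Real.exp_mul, mul_comm x₀]
  have hpos : 0 ≤ᵐ[volume] fun x : ℝ =>
      Real.exp ((γ - 1) * x) * (Real.exp x / (Real.exp x + Real.exp x₀)) :=
    Eventually.of_forall fun x => by positivity
  have hm : AEStronglyMeasurable (fun x : ℝ =>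
      Real.exp ((γ - 1) * x) * (Real.exp x / (Real.exp x + Real.exp x₀))) :=
    Measurable.aestronglyMeasurable (by fun_prop)
  refine ⟨⟨hm, ?_⟩, ?_⟩
  · rw [hasFiniteIntegral_iff_ofReal hpos, hlin]
    exact ENNReal.ofReal_lt_top
  · have hp := Real.pi_pos
    rw [integral_eq_lintegral_of_nonneg_ae hpos hm, hlin, ENNReal.toReal_ofReal (by positivity)]

/-- The other preimages of `exp x₀` are the translates of `x₀` by nonzero multiples of `2 π i`,
which lie outside the strip. -/
theorem exp_ne_exp_of_strip {x₀ : ℝ} {w : ℂ} (hw : |w.im| ≤ Real.pi) (hne : w ≠ x₀) :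
    Complex.exp w ≠ Complex.exp x₀ := by
  intro h
  obtain ⟨n, hn⟩ := Complex.exp_eq_exp_iff_exists_int.1 h
  have him : w.im = n * (2 * Real.pi) := by
    rw [hn]; simp
  have hn0 : n = 0 := by
    by_contra h0
    have h1 : (1 : ℝ) ≤ |(n : ℝ)| := by exact_mod_cast Int.one_le_abs h0
    rw [him, abs_mul, abs_of_pos (by positivity : 0 < 2 * Real.pi)] at hw
    nlinarith [Real.pi_pos]
  apply hne
  rw [hn, hn0]; simp

/-- Cauchy's theorem for `N(w) e ^ w / (e ^ w - e ^ x₀)` on the rectangles `|Re w| ≤ R`, `|Im w| ≤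
π`. The zero of `N` cancels the only pole, both horizontal edges map to the negative axis under
`exp`, and the growth bound with `0 < γ < 1` makes the vertical sides vanish as `R → ∞`. -/
theorem strip_integral_eq_zero {N : ℂ → ℂ} {γ C x₀ : ℝ} (h0 : 0 < γ) (h1 : γ < 1)
    (hd : ∀ w : ℂ, |w.im| ≤ Real.pi → DifferentiableAt ℂ N w)
    (hb : ∀ w : ℂ, |w.im| ≤ Real.pi → ‖N w‖ ≤ C * Real.exp ((γ - 1) * w.re))
    (hN : N x₀ = 0) :
    ∫ x : ℝ, (N (x - Real.pi * Complex.I) - N (x + Real.pi * Complex.I)) *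
      ((Real.exp x / (Real.exp x + Real.exp x₀) : ℝ) : ℂ) = 0 := by
  set S : Set ℂ := {w | |w.im| ≤ Real.pi} with hS
  -- Writing the quotient with `dslope` removes the singularity at `x₀`: the denominator there is
  -- the derivative `exp x₀ ≠ 0`.
  set H : ℂ → ℂ := fun w => dslope N x₀ w * Complex.exp w / dslope Complex.exp x₀ w with hH
  have hC : 0 ≤ C := by
    have := (norm_nonneg _).trans (hb 0 (by simp [Real.pi_pos.le]))
    simpa using this
  have hSn : S ∈ 𝓝 (x₀ : ℂ) := by
    have : {w : ℂ | |w.im| < Real.pi} ∈ 𝓝 (x₀ : ℂ) :=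
      (isOpen_lt (by fun_prop) continuous_const).mem_nhds (by simp [Real.pi_pos])
    exact mem_of_superset this fun w hw => le_of_lt (a := |w.im|) hw
  have hne : ∀ w ∈ S, dslope Complex.exp x₀ w ≠ 0 := by
    intro w hw
    by_cases h : w = x₀
    · rw [h, dslope_same]; simp
    · rw [dslope_of_ne _ h, slope_def_field]
      exact div_ne_zero (sub_ne_zero.2 (exp_ne_exp_of_strip hw h)) (sub_ne_zero.2 h)
  have hHd : DifferentiableOn ℂ H S := by
    refine DifferentiableOn.div (DifferentiableOn.mul ?_ ?_) ?_ hne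
    · rw [Complex.differentiableOn_dslope hSn]
      exact fun w hw => (hd w hw).differentiableWithinAt
    · exact Complex.differentiable_exp.differentiableOn
    · rw [Complex.differentiableOn_dslope hSn]
      exact Complex.differentiable_exp.differentiableOn
  have hHval : ∀ w ∈ S, w ≠ x₀ →
      H w = N w * (Complex.exp w / (Complex.exp w - Complex.exp x₀)) := by
    intro w hw h
    have h2 := sub_ne_zero.2 (exp_ne_exp_of_strip hw h)
    have h3 := sub_ne_zero.2 h
    simp only [hH]
    rw [dslope_of_ne _ h, dslope_of_ne _ h, slope_def_field, slope_def_field, hN]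
    field_simp
    simp
  -- On both edges, `σ = ±1`, one has `e ^ w = -e ^ x`, so the kernel becomes the positive function
  -- `e ^ x / (e ^ x + e ^ x₀)`.
  have hedge : ∀ (σ : ℝ), |σ| = 1 → ∀ x : ℝ, H (x + (σ * Real.pi : ℝ) * Complex.I) =
      N (x + (σ * Real.pi : ℝ) * Complex.I) *
        ((Real.exp x / (Real.exp x + Real.exp x₀) : ℝ) : ℂ) := by
    intro σ hσ x
    have him : ((x : ℂ) + (σ * Real.pi : ℝ) * Complex.I).im = σ * Real.pi := by simp
    have hσ0 : σ ≠ 0 := by rintro rfl; simp at hσ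
    rw [hHval]
    · have hexp : Complex.exp (x + (σ * Real.pi : ℝ) * Complex.I) = -Real.exp x := by
        rw [Complex.exp_add]
        have : Complex.exp ((σ * Real.pi : ℝ) * Complex.I) = -1 := by
          rcases (abs_eq zero_le_one).1 hσ with h | h
          · rw [h]; simp
          · rw [h]; simp [Complex.exp_neg]
        rw [this]; push_cast; ring
      rw [hexp]
      congr 1
      push_cast
      rw [show -Complex.exp x - Complex.exp x₀ = -(Complex.exp x + Complex.exp x₀) by ring,
        neg_div_neg_eq]
    · simp only [hS, Set.mem_ofPred_eq, him, abs_mul, hσ, one_mul, abs_of_pos Real.pi_pos, le_refl]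
    · intro h
      have := congrArg Complex.im h
      rw [him] at this
      simp [hσ0, Real.pi_ne_zero] at this
  have hmem : ∀ (σ : ℝ), |σ| = 1 → ∀ x : ℝ, ((x : ℂ) + (σ * Real.pi : ℝ) * Complex.I) ∈ S := by
    intro σ hσ x
    simp [hS, abs_mul, hσ, abs_of_pos Real.pi_pos]
  have hintH : ∀ (σ : ℝ), |σ| = 1 → Integrable fun x : ℝ =>
      H (x + (σ * Real.pi : ℝ) * Complex.I) := by
    intro σ hσ
    have hk := ((integrable_strip_kernel h0 h1 x₀).1.const_mul C)
    refine hk.mono' ?_ (Eventually.of_forall fun x => ?_)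
    · refine Continuous.aestronglyMeasurable ?_
      exact hHd.continuousOn.comp_continuous (by fun_prop) (hmem σ hσ)
    · rw [hedge σ hσ, norm_mul, Complex.norm_real, Real.norm_of_nonneg (by positivity), ← mul_assoc]
      gcongr
      simpa using hb _ (hmem σ hσ x)
  have hrect : ∀ R : ℝ,
      ‖(∫ x : ℝ in -R..R, (H (x + ((-1) * Real.pi : ℝ) * Complex.I))) -
        ∫ x : ℝ in -R..R, H (x + (1 * Real.pi : ℝ) * Complex.I)‖ ≤
      ‖∫ y : ℝ in ((-1) * Real.pi)..(1 * Real.pi), H (R + y * Complex.I)‖ +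
      ‖∫ y : ℝ in ((-1) * Real.pi)..(1 * Real.pi), H (-R + y * Complex.I)‖ := by
    intro R
    have := Complex.integral_boundary_rect_eq_zero_of_differentiableOn H
      (⟨-R, (-1) * Real.pi⟩ : ℂ) (⟨R, 1 * Real.pi⟩ : ℂ) (hHd.mono ?_)
    · simp only [smul_eq_mul, Complex.ofReal_neg] at this
      have h2 : (∫ x : ℝ in -R..R, (H (x + ((-1) * Real.pi : ℝ) * Complex.I))) -
        ∫ x : ℝ in -R..R, H (x + (1 * Real.pi : ℝ) * Complex.I) =
        -(Complex.I * ∫ y : ℝ in ((-1) * Real.pi)..(1 * Real.pi), H (R + y * Complex.I)) +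
        (Complex.I * ∫ y : ℝ in ((-1) * Real.pi)..(1 * Real.pi), H (-R + y * Complex.I)) := by
        linear_combination this
      rw [h2]
      refine (norm_add_le _ _).trans ?_
      simp
    · intro w hw
      have := hw.2
      simp only [mem_preimage, one_mul, neg_mul] at this
      rw [uIcc_of_le (by linarith [Real.pi_pos])] at this
      exact abs_le.2 this
  have hvert : ∀ (σ : ℝ), |σ| = 1 → Tendsto (fun R : ℝ =>
      ‖∫ y : ℝ in ((-1) * Real.pi)..(1 * Real.pi), H ((σ * R : ℝ) + y * Complex.I)‖) atTop
      (𝓝 0) := by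
    intro σ hσ
    have hbd : ∀ᶠ R : ℝ in atTop,
        ‖∫ y : ℝ in ((-1) * Real.pi)..(1 * Real.pi), H ((σ * R : ℝ) + y * Complex.I)‖ ≤
        C * (Real.exp (γ * (σ * R)) / |Real.exp (σ * R) - Real.exp x₀|) *
          |1 * Real.pi - (-1) * Real.pi| := by
      filter_upwards [eventually_gt_atTop |x₀|] with R hR
      refine intervalIntegral.norm_integral_le_of_norm_le_const fun y hy => ?_
      rw [uIoc_of_le (by linarith [Real.pi_pos])] at hy
      have hRe : σ * R ≠ x₀ := by
        intro h
        have : |σ * R| = |x₀| := by rw [h]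
        rw [abs_mul, hσ, one_mul, abs_of_pos ((abs_nonneg _).trans_lt hR)] at this
        linarith
      have hwS : ((σ * R : ℝ) + y * Complex.I) ∈ S := by
        simp only [hS, Set.mem_ofPred_eq]
        simp only [Complex.add_im, Complex.ofReal_im, Complex.mul_im, Complex.ofReal_re,
          Complex.I_im, mul_one, Complex.I_re, mul_zero, zero_add, add_zero]
        rw [abs_le]
        constructor <;> linarith [hy.1, hy.2]
      have hre : ((σ * R : ℝ) + y * Complex.I : ℂ).re = σ * R := by simp
      rw [hHval _ hwS]
      · rw [norm_mul, norm_div, Complex.norm_exp, hre]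
        have hbw := hb _ hwS
        rw [hre] at hbw
        have hlow : |Real.exp (σ * R) - Real.exp x₀| ≤
            ‖Complex.exp ((σ * R : ℝ) + y * Complex.I) - Complex.exp x₀‖ := by
          have := abs_norm_sub_norm_le (Complex.exp ((σ * R : ℝ) + y * Complex.I))
            (Complex.exp x₀)
          rw [Complex.norm_exp, Complex.norm_exp, hre, Complex.ofReal_re] at this
          exact this
        have hpos : 0 < |Real.exp (σ * R) - Real.exp x₀| := by
          rw [abs_pos, sub_ne_zero]
          exact fun h => hRe (Real.exp_injective h)
        calc _ ≤ (C * Real.exp ((γ - 1) * (σ * R))) *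
              (Real.exp (σ * R) / |Real.exp (σ * R) - Real.exp x₀|) := by gcongr
          _ = _ := by
              rw [show γ * (σ * R) = (γ - 1) * (σ * R) + σ * R by ring, Real.exp_add]
              ring
      · intro h
        have := congrArg Complex.re h
        rw [hre] at this
        exact hRe (by simpa using this)
    refine squeeze_zero' (Eventually.of_forall fun R => norm_nonneg _) hbd ?_
    -- On the right side the quotient is of order `exp ((γ - 1) R)`, which needs `γ < 1`; on the
    -- left side it is of order `exp (-γ R)`, which needs `γ > 0`.
    have hmain : Tendsto (fun R : ℝ => Real.exp (γ * (σ * R)) /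
        |Real.exp (σ * R) - Real.exp x₀|) atTop (𝓝 0) := by
      rcases (abs_eq zero_le_one).1 hσ with h | h
      · subst h
        have e1 : (fun R : ℝ => Real.exp (γ * (1 * R)) / |Real.exp (1 * R) - Real.exp x₀|) =
            fun R => Real.exp (-((1 - γ) * R)) / |1 - Real.exp x₀ * Real.exp (-R)| := by
          funext R
          have h3 : |Real.exp (1 * R) - Real.exp x₀| =
              Real.exp R * |1 - Real.exp x₀ * Real.exp (-R)| := by
            rw [show Real.exp (1 * R) - Real.exp x₀ =
              Real.exp R * (1 - Real.exp x₀ * Real.exp (-R)) by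
                rw [mul_sub, mul_left_comm, ← Real.exp_add]; simp, abs_mul,
              abs_of_pos (Real.exp_pos R)]
          have h4 : Real.exp (γ * (1 * R)) = Real.exp R * Real.exp (-((1 - γ) * R)) := by
            rw [← Real.exp_add]; ring_nf
          rw [h3, h4, mul_div_mul_left _ _ (Real.exp_pos R).ne']
        rw [e1]
        have h5 : Tendsto (fun R : ℝ => Real.exp (-((1 - γ) * R))) atTop (𝓝 0) :=
          Real.tendsto_exp_neg_atTop_nhds_zero.comp
            (tendsto_id.const_mul_atTop (by linarith : 0 < 1 - γ))
        have h6 : Tendsto (fun R : ℝ => |1 - Real.exp x₀ * Real.exp (-R)|) atTop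
            (𝓝 |1 - Real.exp x₀ * 0|) :=
          (tendsto_const_nhds.sub (Real.tendsto_exp_neg_atTop_nhds_zero.const_mul _)).abs
        have h7 := h5.div h6 (by simp)
        rw [zero_div] at h7
        exact h7
      · subst h
        have h5 : Tendsto (fun R : ℝ => Real.exp (γ * (-1 * R))) atTop (𝓝 0) := by
          have := Real.tendsto_exp_neg_atTop_nhds_zero.comp (tendsto_id.const_mul_atTop h0)
          refine this.congr fun R => ?_
          simp
        have h6 : Tendsto (fun R : ℝ => |Real.exp (-1 * R) - Real.exp x₀|) atTop
            (𝓝 |0 - Real.exp x₀|) := by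
          refine ((Real.tendsto_exp_neg_atTop_nhds_zero.congr fun R => ?_).sub
            tendsto_const_nhds).abs
          simp
        have h7 := h5.div h6 (by simp)
        rw [zero_div] at h7
        exact h7
    simpa using (hmain.const_mul C).mul_const |1 * Real.pi - (-1) * Real.pi|
  have hlim : Tendsto (fun R : ℝ => (∫ x : ℝ in -R..R, (H (x + ((-1) * Real.pi : ℝ) * Complex.I))) -
        ∫ x : ℝ in -R..R, H (x + (1 * Real.pi : ℝ) * Complex.I)) atTop (𝓝 0) := by
    rw [tendsto_zero_iff_norm_tendsto_zero]
    refine squeeze_zero (fun R => norm_nonneg _) hrect ?_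
    have e1 := hvert 1 (by simp)
    have e2 := hvert (-1) (by simp)
    have := e1.add e2
    simpa using this
  have hlim2 : Tendsto (fun R : ℝ =>
      (∫ x : ℝ in -R..R, (H (x + ((-1) * Real.pi : ℝ) * Complex.I))) -
        ∫ x : ℝ in -R..R, H (x + (1 * Real.pi : ℝ) * Complex.I)) atTop
      (𝓝 ((∫ x : ℝ, (H (x + ((-1) * Real.pi : ℝ) * Complex.I))) -
        ∫ x : ℝ, H (x + (1 * Real.pi : ℝ) * Complex.I))) :=
    (intervalIntegral_tendsto_integral (hintH (-1) (by simp)) tendsto_neg_atTop_atBot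
      tendsto_id).sub
    (intervalIntegral_tendsto_integral (hintH 1 (by simp)) tendsto_neg_atTop_atBot tendsto_id)
  have hfin := tendsto_nhds_unique hlim2 hlim
  rw [← integral_sub (hintH (-1) (by simp)) (hintH 1 (by simp))] at hfin
  rw [← hfin]
  refine integral_congr_ae (Eventually.of_forall fun x => ?_)
  beta_reduce
  rw [hedge _ (by simp), hedge _ (by simp), ← sub_mul]
  simp [sub_eq_add_neg]

/-- Residue formula at `x₀`, obtained by subtraction: `F - F(x₀) G` vanishes at `x₀` for `G(w) = exp
((γ - 1) (w - x₀))`, which has the growth allowed in the strip, and the integral for `G` is Euler's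
integral. -/
theorem strip_integral {F : ℂ → ℂ} {γ C : ℝ} (h0 : 0 < γ) (h1 : γ < 1)
    (hd : ∀ w : ℂ, |w.im| ≤ Real.pi → DifferentiableAt ℂ F w)
    (hb : ∀ w : ℂ, |w.im| ≤ Real.pi → ‖F w‖ ≤ C * Real.exp ((γ - 1) * w.re)) (x₀ : ℝ) :
    ∫ x : ℝ, (F (x - Real.pi * Complex.I) - F (x + Real.pi * Complex.I)) *
      ((Real.exp x / (Real.exp x + Real.exp x₀) : ℝ) : ℂ) = 2 * Real.pi * Complex.I * F x₀ := by
  have hs : 0 < Real.sin (Real.pi * γ) :=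
    Real.sin_pos_of_pos_of_lt_pi (by positivity) (by nlinarith [Real.pi_pos])
  set G : ℂ → ℂ := fun w => Complex.exp ((γ - 1) * (w - x₀)) with hG
  have hGn : ∀ w, ‖G w‖ = Real.exp (-((γ - 1) * x₀)) * Real.exp ((γ - 1) * w.re) := by
    intro w
    rw [hG, Complex.norm_exp, ← Real.exp_add]
    congr 1
    simp; ring
  have hz := strip_integral_eq_zero (N := fun w => F w - F x₀ * G w)
    (C := C + ‖F x₀‖ * Real.exp (-((γ - 1) * x₀))) (x₀ := x₀) h0 h1
    (fun w hw => (hd w hw).sub (by simp only [hG]; fun_prop))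
    (fun w hw => by
      refine (norm_sub_le _ _).trans ?_
      rw [norm_mul, hGn, add_mul, mul_assoc]
      gcongr
      exact hb w hw)
    (by simp [hG])
  obtain ⟨hk, hkv⟩ := integrable_strip_kernel h0 h1 x₀
  set k : ℝ → ℂ := fun x => ((Real.exp x / (Real.exp x + Real.exp x₀) : ℝ) : ℂ) with hkd
  have hGdiff : ∀ x : ℝ, (G (x - Real.pi * Complex.I) - G (x + Real.pi * Complex.I)) * k x =
      2 * Complex.I * (Real.sin (Real.pi * γ) * Real.exp (-((γ - 1) * x₀)) : ℝ) *
      ((Real.exp ((γ - 1) * x) * (Real.exp x / (Real.exp x + Real.exp x₀)) : ℝ) : ℂ) := by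
    intro x
    have e1 : ∀ σ : ℂ, G (x + σ * Real.pi * Complex.I) = ((Real.exp (-((γ - 1) * x₀)) : ℝ) : ℂ) *
        ((Real.exp ((γ - 1) * x) : ℝ) : ℂ) *
        Complex.exp (((γ - 1) * Real.pi : ℝ) * σ * Complex.I) := by
      intro σ
      simp only [hG]
      push_cast
      rw [← Complex.exp_add, ← Complex.exp_add]
      congr 1
      ring
    have e2 := e1 1
    have e3 := e1 (-1)
    rw [one_mul, mul_one, Complex.exp_mul_I, ← Complex.ofReal_cos, ← Complex.ofReal_sin] at e2
    rw [neg_one_mul, neg_mul, ← sub_eq_add_neg, mul_neg_one, ← Complex.ofReal_neg,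
      Complex.exp_mul_I, ← Complex.ofReal_cos, ← Complex.ofReal_sin, Real.cos_neg, Real.sin_neg]
      at e3
    have e4 : Real.sin ((γ - 1) * Real.pi) = -Real.sin (Real.pi * γ) := by
      rw [show (γ - 1) * Real.pi = Real.pi * γ - Real.pi by ring, Real.sin_sub_pi]
    rw [e2, e3, e4, hkd]
    push_cast
    ring
  have hGint : Integrable fun x : ℝ =>
      (G (x - Real.pi * Complex.I) - G (x + Real.pi * Complex.I)) * k x := by
    simp_rw [hGdiff]
    exact hk.ofReal.const_mul _
  have hGval : ∫ x : ℝ, (G (x - Real.pi * Complex.I) - G (x + Real.pi * Complex.I)) * k x =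
      2 * Real.pi * Complex.I := by
    simp_rw [hGdiff]
    rw [integral_const_mul, integral_complex_ofReal, hkv, mul_assoc, ← Complex.ofReal_mul]
    have : Real.sin (Real.pi * γ) * Real.exp (-((γ - 1) * x₀)) *
        (Real.pi / Real.sin (Real.pi * γ) * Real.exp ((γ - 1) * x₀)) = Real.pi := by
      rw [Real.exp_neg]
      field_simp
    rw [this]
    ring
  have hFdiff : ∀ x : ℝ, (F (x - Real.pi * Complex.I) - F (x + Real.pi * Complex.I)) * k x =
      (F (x - Real.pi * Complex.I) - F x₀ * G (x - Real.pi * Complex.I) -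
        (F (x + Real.pi * Complex.I) - F x₀ * G (x + Real.pi * Complex.I))) * k x +
      F x₀ * ((G (x - Real.pi * Complex.I) - G (x + Real.pi * Complex.I)) * k x) := by
    intro x; ring
  have hFb : ∀ σ : ℝ, |σ| = 1 → Integrable fun x : ℝ =>
      F (x + (σ * Real.pi : ℝ) * Complex.I) * k x := by
    intro σ hσ
    have hmem : ∀ x : ℝ, |((x : ℂ) + (σ * Real.pi : ℝ) * Complex.I).im| ≤ Real.pi := by
      intro x
      simp [abs_mul, hσ, abs_of_pos Real.pi_pos]
    refine (hk.const_mul C).mono' ?_ (Eventually.of_forall fun x => ?_)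
    · refine Continuous.aestronglyMeasurable (Continuous.mul ?_ ?_)
      · refine continuous_iff_continuousAt.2 fun x => ?_
        exact ContinuousAt.comp (hd _ (hmem x)).continuousAt (by fun_prop)
      · simp only [hkd]
        refine Complex.continuous_ofReal.comp (Real.continuous_exp.div (by fun_prop) fun x => ?_)
        positivity
    · rw [norm_mul, hkd, Complex.norm_real, Real.norm_of_nonneg (by positivity), ← mul_assoc]
      gcongr
      simpa using hb _ (hmem x)
  have hFint : Integrable fun x : ℝ =>
      (F (x - Real.pi * Complex.I) - F (x + Real.pi * Complex.I)) * k x := by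
    have := (hFb (-1) (by simp)).sub (hFb 1 (by simp))
    refine this.congr (Eventually.of_forall fun x => ?_)
    simp [sub_eq_add_neg, add_mul]
  have hNint : Integrable fun x : ℝ =>
      (F (x - Real.pi * Complex.I) - F x₀ * G (x - Real.pi * Complex.I) -
        (F (x + Real.pi * Complex.I) - F x₀ * G (x + Real.pi * Complex.I))) * k x := by
    refine (hFint.sub (hGint.const_mul (F x₀))).congr (Eventually.of_forall fun x => ?_)
    simp only [Pi.sub_apply]
    ring
  rw [integral_congr_ae (Eventually.of_forall hFdiff), integral_add hNint (hGint.const_mul _), hz,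
    integral_const_mul, hGval]
  ring

/-! ### The laws with Stieltjes transform `(1 + s ^ α) ^ (-θ)` -/

/-- The quadratic `y ^ (2 α) + 2 y ^ α cos (π α) + 1`. -/
noncomputable def ratioDenom (α y : ℝ) : ℝ :=
  y ^ (2 * α) + 2 * y ^ α * Real.cos (Real.pi * α) + 1

/-- The density on `(0, ∞)` of the law with Stieltjes transform `(1 + s ^ α) ^ (-θ)`. -/
noncomputable def tiltedDensity (α θ y : ℝ) : ℝ :=
  1 / Real.pi * y ^ (α * θ - 1) * Real.sin (θ * angle α y) / ratioDenom α y ^ (θ / 2)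

/-- The law on `(0, ∞)` with Stieltjes transform `(1 + s ^ α) ^ (-θ)`. -/
noncomputable def tiltedLaw (α θ : ℝ) : Measure ℝ :=
  (volume.restrict (Ioi 0)).withDensity fun y => ENNReal.ofReal (tiltedDensity α θ y)

theorem sin_pi_mul_pos {α : ℝ} (h0 : 0 < α) (h1 : α < 1) : 0 < Real.sin (Real.pi * α) :=
  Real.sin_pos_of_pos_of_lt_pi (by have := Real.pi_pos; positivity) (by nlinarith [Real.pi_pos])

theorem ratioDenom_eq {α y : ℝ} (hy : 0 ≤ y) : ratioDenom α y =
    (y ^ α + Real.cos (Real.pi * α)) ^ 2 + Real.sin (Real.pi * α) ^ 2 := by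
  have := Real.sin_sq_add_cos_sq (Real.pi * α)
  have h2 : y ^ (2 * α) = (y ^ α) ^ 2 := by
    rw [mul_comm, Real.rpow_mul hy]; norm_cast
  rw [ratioDenom, h2]
  linear_combination -this

theorem ratioDenom_pos {α y : ℝ} (h0 : 0 < α) (h1 : α < 1) (hy : 0 ≤ y) : 0 < ratioDenom α y := by
  have := sin_pi_mul_pos h0 h1
  rw [ratioDenom_eq hy]
  positivity

theorem arccot_cot {x : ℝ} (h0 : 0 < x) (h1 : x < Real.pi) : arccot (Real.cot x) = x := by
  have : Real.cot x = Real.tan (Real.pi / 2 - x) := by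
    rw [Real.tan_pi_div_two_sub, Real.tan_eq_sin_div_cos, inv_div, Real.cot_eq_cos_div_sin]
  rw [arccot, this, Real.arctan_tan (by linarith) (by linarith)]
  ring

theorem arccot_pos (u : ℝ) : 0 < arccot u := by
  have := Real.arctan_lt_pi_div_two u
  rw [arccot]; linarith

/-- The angle decreases in `y ^ α` and equals `π α` when this is zero. With `α θ < 1` this keeps `θ
* angle α y` in `(0, π)`, which is what makes the densities nonnegative. -/
theorem angle_le {α y : ℝ} (h0 : 0 < α) (h1 : α < 1) (hy : 0 ≤ y) : angle α y ≤ Real.pi * α := by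
  have hs := sin_pi_mul_pos h0 h1
  have hp := Real.pi_pos
  rw [← arccot_cot (x := Real.pi * α) (by positivity) (by nlinarith)]
  have : Real.arctan (Real.cot (Real.pi * α)) ≤
      Real.arctan (Real.cot (Real.pi * α) + y ^ α / Real.sin (Real.pi * α)) := by
    refine Real.arctan_strictMono.monotone ?_
    have : 0 ≤ y ^ α / Real.sin (Real.pi * α) := by positivity
    linarith
  rw [arccot_cot (x := Real.pi * α) (by positivity) (by nlinarith)]
  calc angle α y ≤ arccot (Real.cot (Real.pi * α)) := by
        rw [angle, arccot, arccot]; linarith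
    _ = _ := arccot_cot (by positivity) (by nlinarith)

theorem sin_angle_nonneg {α θ y : ℝ} (h0 : 0 < α) (h1 : α < 1) (hθ : 0 < θ) (hαθ : α * θ < 1)
    (hy : 0 ≤ y) : 0 ≤ Real.sin (θ * angle α y) := by
  have h2 := angle_le h0 h1 hy
  have h3 : 0 < angle α y := arccot_pos _
  refine Real.sin_nonneg_of_nonneg_of_le_pi (by positivity) ?_
  have : θ * angle α y ≤ θ * (Real.pi * α) := by gcongr
  nlinarith [Real.pi_pos]

/-- Polar form of `y ^ α + exp (i π α)`: its modulus is the square root of `ratioDenom α y` and its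
argument is `angle α y`. -/
theorem sin_cos_angle {α y : ℝ} (h0 : 0 < α) (h1 : α < 1) (hy : 0 ≤ y) :
    Real.sqrt (ratioDenom α y) * Real.sin (angle α y) = Real.sin (Real.pi * α) ∧
    Real.sqrt (ratioDenom α y) * Real.cos (angle α y) = y ^ α + Real.cos (Real.pi * α) := by
  have hs := sin_pi_mul_pos h0 h1
  set u := Real.cot (Real.pi * α) + y ^ α / Real.sin (Real.pi * α) with hu
  have hu' : u = (y ^ α + Real.cos (Real.pi * α)) / Real.sin (Real.pi * α) := by
    rw [hu, Real.cot_eq_cos_div_sin, ← add_div, add_comm]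
  have hsq : Real.sqrt (1 + u ^ 2) = Real.sqrt (ratioDenom α y) / Real.sin (Real.pi * α) := by
    rw [hu', ratioDenom_eq hy]
    rw [show 1 + ((y ^ α + Real.cos (Real.pi * α)) / Real.sin (Real.pi * α)) ^ 2 =
      ((y ^ α + Real.cos (Real.pi * α)) ^ 2 + Real.sin (Real.pi * α) ^ 2) /
        Real.sin (Real.pi * α) ^ 2 by field_simp; ring]
    rw [Real.sqrt_div (by positivity), Real.sqrt_sq hs.le]
  have hD : 0 < Real.sqrt (ratioDenom α y) := Real.sqrt_pos.2 (ratioDenom_pos h0 h1 hy)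
  have e1 : angle α y = Real.pi / 2 - Real.arctan u := rfl
  rw [e1, Real.sin_pi_div_two_sub, Real.cos_pi_div_two_sub, Real.cos_arctan, Real.sin_arctan, hsq]
  constructor
  · field_simp
  · rw [hu']; field_simp

theorem tiltedDensity_nonneg {α θ y : ℝ} (h0 : 0 < α) (h1 : α < 1) (hθ : 0 < θ) (hαθ : α * θ < 1)
    (hy : 0 ≤ y) : 0 ≤ tiltedDensity α θ y := by
  have h2 := sin_angle_nonneg h0 h1 hθ hαθ hy
  have h3 := ratioDenom_pos h0 h1 hy
  have hp := Real.pi_pos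
  unfold tiltedDensity
  positivity

@[fun_prop]
theorem measurable_angle (α : ℝ) : Measurable (angle α) := by
  unfold angle arccot
  exact measurable_const.sub (Real.measurable_arctan.comp (by fun_prop))

theorem measurable_tiltedDensity (α θ : ℝ) : Measurable (tiltedDensity α θ) := by
  unfold tiltedDensity ratioDenom
  have := measurable_angle α
  fun_prop

theorem tiltedDensity_one {α y : ℝ} (h0 : 0 < α) (h1 : α < 1) (hy : 0 ≤ y) :
    tiltedDensity α 1 y = ratioDensity α y := by
  have hD := ratioDenom_pos h0 h1 hy
  have h2 := (sin_cos_angle h0 h1 hy).1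
  have hq : 0 < Real.sqrt (ratioDenom α y) := Real.sqrt_pos.2 hD
  have h3 : Real.sqrt (ratioDenom α y) ^ 2 = ratioDenom α y := Real.sq_sqrt hD.le
  rw [tiltedDensity, ratioDensity, ← ratioDenom, ← h2, one_mul, mul_one, ← Real.sqrt_eq_rpow]
  nth_rewrite 3 [← h3]
  field_simp

/-- The holomorphic extension of `(1 + z ^ (-α)) ^ (-θ) / z`, in the coordinate `log z`. -/
noncomputable def stripFun (α θ : ℝ) (w : ℂ) : ℂ :=
  Complex.exp (((α * θ - 1 : ℝ) : ℂ) * w) * (1 + Complex.exp (α * w)) ^ ((-θ : ℝ) : ℂ)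

/-- In the strip the argument of `exp (α w)` is at most `π α < π` in absolute value, so `1 + exp (α
w)` avoids the cut of the principal power. Its modulus is at least the distance `sin (π α)` from
`-1` to the line of direction `exp (i π α)`. -/
theorem one_add_exp_bounds {α : ℝ} (h0 : 0 < α) (h1 : α < 1) {w : ℂ} (hw : |w.im| ≤ Real.pi) :
    1 + Complex.exp (α * w) ∈ Complex.slitPlane ∧
    Real.sin (Real.pi * α) ≤ ‖1 + Complex.exp (α * w)‖ := by
  have hp := Real.pi_pos
  have hs := sin_pi_mul_pos h0 h1
  have hre : (Complex.exp (α * w)).re = Real.exp (α * w.re) * Real.cos (α * w.im) := by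
    simp [Complex.exp_re]
  have him : (Complex.exp (α * w)).im = Real.exp (α * w.re) * Real.sin (α * w.im) := by
    simp [Complex.exp_im]
  set ρ := Real.exp (α * w.re) with hρ
  have hρ0 : 0 < ρ := Real.exp_pos _
  have hcos : Real.cos (Real.pi * α) ≤ Real.cos (α * w.im) := by
    rw [← Real.cos_abs (α * w.im)]
    refine Real.cos_le_cos_of_nonneg_of_le_pi (abs_nonneg _) (by nlinarith) ?_
    rw [abs_mul, abs_of_pos h0, mul_comm]
    gcongr
  have hsq : ‖1 + Complex.exp (α * w)‖ ^ 2 = 1 + 2 * ρ * Real.cos (α * w.im) + ρ ^ 2 := by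
    rw [← Complex.normSq_eq_norm_sq, Complex.normSq_apply]
    simp only [Complex.add_re, Complex.one_re, Complex.add_im, Complex.one_im, hre, him]
    linear_combination ρ ^ 2 * Real.sin_sq_add_cos_sq (α * w.im)
  have hnorm : Real.sin (Real.pi * α) ≤ ‖1 + Complex.exp (α * w)‖ := by
    refine le_of_sq_le_sq ?_ (norm_nonneg _)
    rw [hsq]
    have := Real.sin_sq_add_cos_sq (Real.pi * α)
    nlinarith [sq_nonneg (ρ + Real.cos (Real.pi * α)), mul_le_mul_of_nonneg_left hcos hρ0.le]
  refine ⟨?_, hnorm⟩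
  rw [Complex.mem_slitPlane_iff]
  by_cases hz : Real.sin (α * w.im) = 0
  · left
    have hlt : |α * w.im| < Real.pi := by
      rw [abs_mul, abs_of_pos h0]
      nlinarith [abs_nonneg w.im]
    have := abs_lt.1 hlt
    rw [Real.sin_eq_zero_iff_of_lt_of_lt this.1 this.2] at hz
    simp only [Complex.add_re, Complex.one_re, hre, hz, Real.cos_zero]
    positivity
  · right
    simp only [Complex.add_im, Complex.one_im, him, zero_add]
    positivity

theorem stripFun_differentiableAt {α : ℝ} (θ : ℝ) (h0 : 0 < α) (h1 : α < 1) {w : ℂ}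
    (hw : |w.im| ≤ Real.pi) : DifferentiableAt ℂ (stripFun α θ) w := by
  unfold stripFun
  refine DifferentiableAt.mul (by fun_prop) ?_
  exact DifferentiableAt.cpow (by fun_prop) (by fun_prop) (one_add_exp_bounds h0 h1 hw).1

theorem stripFun_bound {α θ : ℝ} (h0 : 0 < α) (h1 : α < 1) (hθ : 0 < θ) {w : ℂ}
    (hw : |w.im| ≤ Real.pi) :
    ‖stripFun α θ w‖ ≤ Real.sin (Real.pi * α) ^ (-θ) * Real.exp ((α * θ - 1) * w.re) := by
  have hs := sin_pi_mul_pos h0 h1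
  rw [stripFun, norm_mul, Complex.norm_cpow_real, Complex.norm_exp, mul_comm]
  have : (((α * θ - 1 : ℝ) : ℂ) * w).re = (α * θ - 1) * w.re := by
    rw [Complex.re_ofReal_mul]
  rw [this]
  refine mul_le_mul_of_nonneg_right ?_ (Real.exp_pos _).le
  exact Real.rpow_le_rpow_of_nonpos hs (one_add_exp_bounds h0 h1 hw).2 (by linarith)

/-- With `y = e ^ x`, `A` the angle and `D` the quadratic, the base on the edge is `1 + y ^ α exp (i
σ π α) = √D exp (i σ (π α - A))`. The phase `α θ σ π` of the exponential factor cancels the `π α`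
part and leaves `exp (i σ θ A)`; the minus sign is `exp (-i σ π)`. -/
theorem stripFun_edge {α θ : ℝ} (h0 : 0 < α) (h1 : α < 1) {σ : ℝ} (hσ : σ = 1 ∨ σ = -1) (x : ℝ) :
    stripFun α θ (x + (σ * Real.pi : ℝ) * Complex.I) =
      -(Real.exp ((α * θ - 1) * x) * ratioDenom α (Real.exp x) ^ (-(θ / 2)) : ℝ) *
        Complex.exp ((σ * (θ * angle α (Real.exp x)) : ℝ) * Complex.I) := by
  have hp := Real.pi_pos
  set y := Real.exp x with hy
  have hy0 : 0 < y := Real.exp_pos x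
  set A := angle α y with hA
  obtain ⟨hsin, hcos⟩ := sin_cos_angle h0 h1 hy0.le
  rw [← hA] at hsin hcos
  have hD := ratioDenom_pos h0 h1 hy0.le
  set D := ratioDenom α y with hDd
  have hR : 0 < Real.sqrt D := Real.sqrt_pos.2 hD
  have hA0 : 0 < A := arccot_pos _
  have hA1 : A ≤ Real.pi * α := angle_le h0 h1 hy0.le
  have hσ2 : σ ^ 2 = 1 := by rcases hσ with h | h <;> rw [h] <;> norm_num
  have hyα : Real.exp (α * x) = y ^ α := by rw [hy, ← Real.exp_mul, mul_comm]
  have hσs : ∀ t : ℝ, Real.sin (σ * t) = σ * Real.sin t := by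
    intro t; rcases hσ with h | h <;> simp [h]
  have hσc : ∀ t : ℝ, Real.cos (σ * t) = Real.cos t := by
    intro t; rcases hσ with h | h <;> simp [h]
  have hbase : 1 + Complex.exp (α * (x + (σ * Real.pi : ℝ) * Complex.I)) =
      Complex.exp ((Real.log (Real.sqrt D) : ℝ) + (σ * (Real.pi * α - A) : ℝ) * Complex.I) := by
    rw [Complex.exp_add, ← Complex.ofReal_exp, Real.exp_log hR, mul_add, Complex.exp_add,
      ← Complex.ofReal_mul, ← Complex.ofReal_exp, hyα, ← mul_assoc, ← Complex.ofReal_mul,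
      show α * (σ * Real.pi) = σ * (Real.pi * α) by ring, Complex.exp_mul_I, Complex.exp_mul_I,
      ← Complex.ofReal_cos, ← Complex.ofReal_sin, ← Complex.ofReal_cos, ← Complex.ofReal_sin,
      hσs, hσs, hσc, hσc, Real.cos_sub, Real.sin_sub]
    have hsc := Real.sin_sq_add_cos_sq (Real.pi * α)
    apply Complex.ext
    · simp only [Complex.add_re, Complex.one_re, Complex.mul_re, Complex.ofReal_re,
        Complex.ofReal_im, Complex.I_re, Complex.I_im, Complex.add_im, Complex.mul_im]
      linear_combination -Real.cos (Real.pi * α) * hcos - Real.sin (Real.pi * α) * hsin - hsc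
    · simp only [Complex.add_im, Complex.one_im, Complex.mul_re, Complex.ofReal_re,
        Complex.ofReal_im, Complex.I_re, Complex.I_im, Complex.add_re, Complex.mul_im]
      linear_combination -σ * Real.sin (Real.pi * α) * hcos + σ * Real.cos (Real.pi * α) * hsin
  -- The exponent is the principal logarithm because `0 ≤ π α - A < π`.
  have hlog : Complex.log (1 + Complex.exp (α * (x + (σ * Real.pi : ℝ) * Complex.I))) =
      (Real.log (Real.sqrt D) : ℝ) + (σ * (Real.pi * α - A) : ℝ) * Complex.I := by
    have him : ((Real.log (Real.sqrt D) : ℝ) + (σ * (Real.pi * α - A) : ℝ) * Complex.I : ℂ).im =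
        σ * (Real.pi * α - A) := by simp
    rw [hbase, Complex.log_exp]
    · rw [him]
      rcases hσ with h | h <;> rw [h] <;> nlinarith
    · rw [him]
      rcases hσ with h | h <;> rw [h] <;> nlinarith
  have hne : 1 + Complex.exp (α * (x + (σ * Real.pi : ℝ) * Complex.I)) ≠ 0 := by
    rw [hbase]; exact Complex.exp_ne_zero _
  rw [stripFun, Complex.cpow_def_of_ne_zero hne, hlog, ← Complex.exp_add]
  have hDp : D ^ (-(θ / 2)) = Real.exp (-θ * Real.log (Real.sqrt D)) := by
    rw [Real.rpow_def_of_pos hD, Real.log_sqrt hD.le]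
    ring_nf
  rw [hDp, ← Real.exp_add]
  have hneg : Complex.exp (-((σ * Real.pi : ℝ) * Complex.I)) = -1 := by
    rw [← neg_mul, ← Complex.ofReal_neg, Complex.exp_mul_I, ← Complex.ofReal_cos,
      ← Complex.ofReal_sin, Real.cos_neg, Real.sin_neg, hσs, hσc]
    simp
  have hneg' : ∀ z : ℂ, -z = Complex.exp (-((σ * Real.pi : ℝ) * Complex.I)) * z := by
    intro z; rw [hneg]; ring
  rw [Complex.ofReal_exp, neg_mul, hneg', ← Complex.exp_add, ← Complex.exp_add]
  congr 1
  push_cast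
  ring

/-- The jump of `stripFun α θ` from the upper edge to the lower one at abscissa `x` is `2 π i` times
`tiltedDensity α θ (exp x)`, so the strip formula with `γ = α θ` returns the value of `stripFun` at
`x₀`. -/
theorem tilted_integral_real {α θ : ℝ} (h0 : 0 < α) (h1 : α < 1) (hθ : 0 < θ) (hαθ : α * θ < 1)
    (x₀ : ℝ) :
    ∫ x : ℝ, tiltedDensity α θ (Real.exp x) * (Real.exp x / (Real.exp x + Real.exp x₀)) =
      Real.exp ((α * θ - 1) * x₀) * (1 + Real.exp (α * x₀)) ^ (-θ) := by
  have hp := Real.pi_pos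
  have key := strip_integral (F := stripFun α θ) (γ := α * θ) (by positivity) hαθ
    (fun w hw => stripFun_differentiableAt θ h0 h1 hw)
    (fun w hw => stripFun_bound h0 h1 hθ hw) x₀
  have hF : stripFun α θ x₀ =
      ((Real.exp ((α * θ - 1) * x₀) * (1 + Real.exp (α * x₀)) ^ (-θ) : ℝ) : ℂ) := by
    rw [stripFun, Complex.ofReal_mul, Complex.ofReal_cpow (by positivity)]
    push_cast
    rfl
  have hI : ∀ x : ℝ, (stripFun α θ (x - Real.pi * Complex.I) -
      stripFun α θ (x + Real.pi * Complex.I)) *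
        ((Real.exp x / (Real.exp x + Real.exp x₀) : ℝ) : ℂ) = 2 * Real.pi * Complex.I *
      ((tiltedDensity α θ (Real.exp x) * (Real.exp x / (Real.exp x + Real.exp x₀)) : ℝ) : ℂ) := by
    intro x
    have hD := ratioDenom_pos h0 h1 (Real.exp_pos x).le
    have e1 := stripFun_edge (θ := θ) h0 h1 (Or.inl rfl) x
    have e2 := stripFun_edge (θ := θ) h0 h1 (Or.inr rfl) x
    rw [one_mul, one_mul, Complex.exp_mul_I, ← Complex.ofReal_cos, ← Complex.ofReal_sin] at e1
    rw [Complex.exp_mul_I, ← Complex.ofReal_cos, ← Complex.ofReal_sin, neg_one_mul, neg_one_mul,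
      Real.cos_neg, Real.sin_neg, Complex.ofReal_neg Real.pi, neg_mul, ← sub_eq_add_neg] at e2
    rw [e1, e2, tiltedDensity, Real.rpow_neg hD.le, ← Real.exp_mul, mul_comm x]
    have hDp : ratioDenom α (Real.exp x) ^ (θ / 2) ≠ 0 := by positivity
    push_cast
    have hpc : (Real.pi : ℂ) ≠ 0 := by exact_mod_cast hp.ne'
    field_simp
    ring
  rw [hF, integral_congr_ae (Eventually.of_forall hI), integral_const_mul,
    integral_complex_ofReal] at key
  have h2 : (2 * Real.pi * Complex.I : ℂ) ≠ 0 := by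
    simp [hp.ne']
  exact_mod_cast mul_left_cancel₀ h2 key

theorem lintegral_tiltedDensity {α θ : ℝ} (h0 : 0 < α) (h1 : α < 1) (hθ : 0 < θ)
    (hαθ : α * θ < 1) {s : ℝ} (hs : 0 < s) :
    ∫⁻ y in Ioi 0, ENNReal.ofReal (tiltedDensity α θ y) * ENNReal.ofReal (1 / (1 + s * y)) =
      ENNReal.ofReal ((1 + s ^ α) ^ (-θ)) := by
  -- With `x₀ = -log s` the kernel `e ^ x / (e ^ x + e ^ x₀)` is `s e ^ x / (1 + s e ^ x)`.
  have key := tilted_integral_real h0 h1 hθ hαθ (-Real.log s)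
  have hpos : ∀ x : ℝ, 0 ≤ tiltedDensity α θ (Real.exp x) *
      (Real.exp x / (Real.exp x + Real.exp (-Real.log s))) := fun x =>
    mul_nonneg (tiltedDensity_nonneg h0 h1 hθ hαθ (Real.exp_pos x).le) (by positivity)
  have hint : Integrable fun x : ℝ => tiltedDensity α θ (Real.exp x) *
      (Real.exp x / (Real.exp x + Real.exp (-Real.log s))) := by
    refine Integrable.of_integral_ne_zero ?_
    rw [key]; positivity
  have hexp : Real.exp (-Real.log s) = s⁻¹ := by rw [Real.exp_neg, Real.exp_log hs]
  rw [lintegral_Ioi_comp_exp]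
  have hcongr : ∀ x : ℝ, ENNReal.ofReal (Real.exp x) *
      (ENNReal.ofReal (tiltedDensity α θ (Real.exp x)) *
        ENNReal.ofReal (1 / (1 + s * Real.exp x))) = ENNReal.ofReal s⁻¹ *
      ENNReal.ofReal (tiltedDensity α θ (Real.exp x) *
      (Real.exp x / (Real.exp x + Real.exp (-Real.log s)))) := by
    intro x
    have hd := tiltedDensity_nonneg h0 h1 hθ hαθ (Real.exp_pos x).le
    rw [← ENNReal.ofReal_mul hd, ← ENNReal.ofReal_mul (by positivity),
      ← ENNReal.ofReal_mul (by positivity), hexp]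
    congr 1
    field_simp
    ring
  rw [lintegral_congr hcongr, lintegral_const_mul' _ _ ENNReal.ofReal_ne_top,
    ← ofReal_integral_eq_lintegral_ofReal hint (Eventually.of_forall hpos), key,
    ← ENNReal.ofReal_mul (by positivity)]
  congr 1
  have e1 : Real.exp ((α * θ - 1) * -Real.log s) = s ^ (1 - α * θ) := by
    rw [Real.rpow_def_of_pos hs]; ring_nf
  have e2 : 1 + Real.exp (α * -Real.log s) = (1 + s ^ α) * s ^ (-α) := by
    rw [Real.rpow_def_of_pos hs, Real.rpow_def_of_pos hs, add_mul, ← Real.exp_add]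
    ring_nf
    simp
    ring
  rw [e1, e2, Real.mul_rpow (by positivity) (by positivity), ← Real.rpow_mul hs.le,
    ← Real.rpow_neg_one s,
    show ∀ a b c d : ℝ, a * (b * (c * d)) = c * (a * b * d) by intros; ring, ← Real.rpow_add hs,
    ← Real.rpow_add hs, show -1 + (1 - α * θ) + -α * -θ = 0 by ring, Real.rpow_zero, mul_one]

/-! ### Generalized Stieltjes transforms of laws on the half-line -/

/-- The generalized Stieltjes transform `∫ (1 + s x) ^ (-t) μ(dx)`. -/
noncomputable def stieltjes (μ : Measure ℝ) (t s : ℝ) : ℝ≥0∞ :=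
  ∫⁻ x, ENNReal.ofReal ((1 + s * x) ^ (-t)) ∂μ

theorem stieltjes_bound {s t x : ℝ} (hs : 0 ≤ s) (ht : 0 ≤ t) (hx : 0 ≤ x) :
    0 ≤ (1 + s * x) ^ (-t) ∧ (1 + s * x) ^ (-t) ≤ 1 := by
  refine ⟨by positivity, Real.rpow_le_one_of_one_le_of_nonpos ?_ (by linarith)⟩
  nlinarith [mul_nonneg hs hx]

theorem integrable_stieltjes {μ : Measure ℝ} [IsFiniteMeasure μ] (hμ : ∀ᵐ x ∂μ, 0 ≤ x) {s t : ℝ}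
    (hs : 0 ≤ s) (ht : 0 ≤ t) : Integrable (fun x => (1 + s * x) ^ (-t)) μ := by
  refine Integrable.of_bound (Measurable.aestronglyMeasurable (by fun_prop)) 1 ?_
  filter_upwards [hμ] with x hx
  obtain ⟨h1, h2⟩ := stieltjes_bound hs ht hx
  rwa [Real.norm_of_nonneg h1]

theorem stieltjes_eq_ofReal {μ : Measure ℝ} [IsFiniteMeasure μ] (hμ : ∀ᵐ x ∂μ, 0 ≤ x) {s t : ℝ}
    (hs : 0 ≤ s) (ht : 0 ≤ t) :
    stieltjes μ t s = ENNReal.ofReal (∫ x, (1 + s * x) ^ (-t) ∂μ) := by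
  rw [stieltjes, ofReal_integral_eq_lintegral_ofReal (integrable_stieltjes hμ hs ht)]
  filter_upwards [hμ] with x hx using (stieltjes_bound hs ht hx).1

theorem eq_of_stieltjes_one {μ ν : Measure ℝ} [IsFiniteMeasure μ] [IsFiniteMeasure ν]
    (hμ : ∀ᵐ x ∂μ, 0 ≤ x) (hν : ∀ᵐ x ∂ν, 0 ≤ x)
    (h : ∀ s : ℝ, 0 < s → stieltjes μ 1 s = stieltjes ν 1 s) : μ = ν := by
  refine ext_of_stieltjes hμ hν fun s hs => ?_
  have := h s hs
  rw [stieltjes_eq_ofReal hμ hs.le zero_le_one, stieltjes_eq_ofReal hν hs.le zero_le_one] at this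
  simp only [Real.rpow_neg_one] at this
  simp only [one_div]
  refine (ENNReal.ofReal_eq_ofReal_iff (integral_nonneg_of_ae ?_)
    (integral_nonneg_of_ae ?_)).1 this
  · filter_upwards [hμ] with x hx
    rw [Pi.zero_apply]; positivity
  · filter_upwards [hν] with x hx
    rw [Pi.zero_apply]; positivity

/-- Total mass is recovered by monotone convergence along `s = 1 / (n + 1)`, so finiteness of `μ`
need not be known beforehand. -/
theorem isProbabilityMeasure_of_stieltjes {μ : Measure ℝ} (hμ : ∀ᵐ x ∂μ, 0 ≤ x) {f : ℝ → ℝ}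
    (hf : Tendsto f (𝓝[>] 0) (𝓝 1))
    (h : ∀ s : ℝ, 0 < s → stieltjes μ 1 s = ENNReal.ofReal (f s)) : IsProbabilityMeasure μ := by
  have hs : Tendsto (fun n : ℕ => (1 : ℝ) / ((n : ℝ) + 1)) atTop (𝓝[>] 0) := by
    refine tendsto_nhdsWithin_iff.2 ⟨tendsto_one_div_add_atTop_nhds_zero_nat, ?_⟩
    exact Eventually.of_forall fun n => by rw [mem_Ioi]; positivity
  have hlim : Tendsto (fun n : ℕ => stieltjes μ 1 (1 / ((n : ℝ) + 1))) atTop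
      (𝓝 (∫⁻ _, 1 ∂μ)) := by
    refine lintegral_tendsto_of_tendsto_of_monotone (fun n => ?_) ?_ ?_
    · exact Measurable.aemeasurable (by fun_prop)
    · filter_upwards [hμ] with x hx m n hmn
      refine ENNReal.ofReal_le_ofReal ?_
      rw [Real.rpow_neg_one, Real.rpow_neg_one]
      gcongr
    · filter_upwards [hμ] with x hx
      rw [← ENNReal.ofReal_one]
      refine ENNReal.tendsto_ofReal ?_
      have h1 : Tendsto (fun n : ℕ => 1 + (1 : ℝ) / ((n : ℝ) + 1) * x) atTop (𝓝 (1 + 0 * x)) :=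
        (tendsto_one_div_add_atTop_nhds_zero_nat.mul_const x).const_add 1
      have h2 := h1.rpow_const (p := -1) (Or.inl (by simp))
      simpa using h2
  refine ⟨?_⟩
  rw [← lintegral_one]
  refine tendsto_nhds_unique hlim ?_
  rw [← ENNReal.ofReal_one]
  refine ((ENNReal.tendsto_ofReal (hf.comp hs))).congr fun n => ?_
  rw [h _ (by positivity)]
  rfl

theorem lintegral_tiltedLaw (α θ : ℝ) (h : ℝ → ℝ≥0∞) :
    ∫⁻ x, h x ∂(tiltedLaw α θ) = ∫⁻ y in Ioi 0, ENNReal.ofReal (tiltedDensity α θ y) * h y := by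
  rw [tiltedLaw, lintegral_withDensity_eq_lintegral_mul_non_measurable _
    (measurable_tiltedDensity α θ).ennreal_ofReal
    (Eventually.of_forall fun _ => ENNReal.ofReal_lt_top)]
  rfl

theorem ae_tiltedLaw_pos (α θ : ℝ) : ∀ᵐ x ∂(tiltedLaw α θ), 0 < x :=
  (withDensity_absolutelyContinuous _ _).ae_le (ae_restrict_mem measurableSet_Ioi)

theorem ae_tiltedLaw (α θ : ℝ) : ∀ᵐ x ∂(tiltedLaw α θ), 0 ≤ x := by
  filter_upwards [ae_tiltedLaw_pos α θ] with x hx using hx.le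

theorem stieltjes_tiltedLaw {α θ : ℝ} (h0 : 0 < α) (h1 : α < 1) (hθ : 0 < θ) (hαθ : α * θ < 1)
    {s : ℝ} (hs : 0 < s) : stieltjes (tiltedLaw α θ) 1 s = ENNReal.ofReal ((1 + s ^ α) ^ (-θ)) := by
  rw [stieltjes, lintegral_tiltedLaw, ← lintegral_tiltedDensity h0 h1 hθ hαθ hs]
  simp only [Real.rpow_neg_one, one_div]

theorem tendsto_one_add_rpow {α : ℝ} (θ : ℝ) (h0 : 0 < α) :
    Tendsto (fun s : ℝ => (1 + s ^ α) ^ (-θ)) (𝓝[>] 0) (𝓝 1) := by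
  have h2 : Tendsto (fun s : ℝ => (1 + s ^ α) ^ (-θ)) (𝓝 0) (𝓝 ((1 + 0 ^ α) ^ (-θ))) := by
    refine Tendsto.rpow_const ?_ (Or.inl (by rw [Real.zero_rpow h0.ne']; norm_num))
    exact ((Real.continuousAt_rpow_const 0 α (Or.inr h0.le)).tendsto).const_add 1
  rw [Real.zero_rpow h0.ne', add_zero, Real.one_rpow] at h2
  exact h2.mono_left nhdsWithin_le_nhds

theorem isProbabilityMeasure_tiltedLaw {α θ : ℝ} (h0 : 0 < α) (h1 : α < 1) (hθ : 0 < θ)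
    (hαθ : α * θ < 1) : IsProbabilityMeasure (tiltedLaw α θ) :=
  isProbabilityMeasure_of_stieltjes (ae_tiltedLaw α θ) (tendsto_one_add_rpow θ h0)
    fun _ hs => stieltjes_tiltedLaw h0 h1 hθ hαθ hs

theorem ratioLaw_eq {α : ℝ} (h0 : 0 < α) (h1 : α < 1) : ratioLaw α = tiltedLaw α 1 := by
  refine withDensity_congr_ae (ae_restrict_of_forall_mem measurableSet_Ioi fun y hy => ?_)
  rw [mem_Ioi] at hy
  simp only [tiltedDensity_one h0 h1 hy.le]

theorem stieltjes_ratioLaw {α : ℝ} (h0 : 0 < α) (h1 : α < 1) {s : ℝ} (hs : 0 < s) :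
    stieltjes (ratioLaw α) 1 s = ENNReal.ofReal (1 / (1 + s ^ α)) := by
  rw [ratioLaw_eq h0 h1, stieltjes_tiltedLaw h0 h1 one_pos (by linarith) hs, Real.rpow_neg_one,
    one_div]

theorem isProbabilityMeasure_ratioLaw {α : ℝ} (h0 : 0 < α) (h1 : α < 1) :
    IsProbabilityMeasure (ratioLaw α) := by
  rw [ratioLaw_eq h0 h1]
  exact isProbabilityMeasure_tiltedLaw h0 h1 one_pos (by linarith)

theorem ae_ratioLaw {α : ℝ} (h0 : 0 < α) (h1 : α < 1) : ∀ᵐ x ∂(ratioLaw α), 0 < x := by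
  rw [ratioLaw_eq h0 h1]
  exact ae_tiltedLaw_pos α 1

/-- Given `B = b`, the transform of `b ^ (1 / α) X_α` at `s` is `1 / (1 + b s ^ α)`. The base is the
mixture `b (1 + s ^ α) + (1 - b)`, and averaging its inverse over `Beta(θ, 1 - θ)` gives `(1 + s ^
α) ^ (-θ)`. -/
theorem betaRatioLaw_eq {α θ : ℝ} (h0 : 0 < α) (h1 : α < 1) (hθ : 0 < θ) (hθ1 : θ < 1) :
    betaRatioLaw α θ = tiltedLaw α θ := by
  have hαθ : α * θ < 1 := by nlinarith
  have := isProbabilityMeasure_tiltedLaw h0 h1 hθ hαθ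
  have := isProbabilityMeasure_ratioLaw h0 h1
  have := isProbabilityMeasureBeta hθ (by linarith : 0 < 1 - θ)
  have hm : Measurable fun w : ℝ × ℝ => w.1 ^ (1 / α) * w.2 := by fun_prop
  have hprob : IsProbabilityMeasure (betaRatioLaw α θ) :=
    Measure.isProbabilityMeasure_map hm.aemeasurable
  refine eq_of_stieltjes_one ?_ (ae_tiltedLaw α θ) fun s hs => ?_
  · rw [betaRatioLaw, ae_map_iff hm.aemeasurable (p := fun x => 0 ≤ x) measurableSet_Ici]
    have e1 := Measure.quasiMeasurePreserving_fst
      (μ := betaMeasure θ (1 - θ)) (ν := ratioLaw α) |>.ae (ae_betaMeasure θ (1 - θ))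
    have e2 := Measure.quasiMeasurePreserving_snd
      (μ := betaMeasure θ (1 - θ)) (ν := ratioLaw α) |>.ae (ae_ratioLaw h0 h1)
    filter_upwards [e1, e2] with w hw1 hw2
    have := hw1.1
    positivity
  · rw [stieltjes_tiltedLaw h0 h1 hθ hαθ hs, stieltjes, betaRatioLaw,
      lintegral_map (by fun_prop) hm,
      lintegral_prod _ (by fun_prop)]
    have hin : ∀ᵐ b ∂(betaMeasure θ (1 - θ)),
        ∫⁻ x, ENNReal.ofReal ((1 + s * (b ^ (1 / α) * x)) ^ (-1 : ℝ)) ∂(ratioLaw α) =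
        ENNReal.ofReal ((b * (1 + s ^ α) + (1 - b) * 1) ^ (-(θ + (1 - θ)))) := by
      filter_upwards [ae_betaMeasure θ (1 - θ)] with b hb
      have hb0 := hb.1
      have := stieltjes_ratioLaw h0 h1 (s := s * b ^ (1 / α)) (by positivity)
      rw [stieltjes] at this
      simp only [← mul_assoc]
      rw [this, Real.mul_rpow hs.le (by positivity), ← Real.rpow_mul hb0.le,
        one_div_mul_cancel h0.ne', Real.rpow_one, add_sub_cancel, Real.rpow_neg_one, one_div]
      congr 2
      ring
    rw [lintegral_congr_ae hin, lintegral_beta_mix hθ (by linarith) (by positivity) one_pos]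
    simp

/-! ### Stick breaking -/

/-- The sequence `x, f 0, f 1, …`. -/
def consSeq {X : Type*} (x : X) (f : ℕ → X) : ℕ → X
  | 0 => x
  | n + 1 => f n

@[fun_prop]
theorem measurable_consSeq {X : Type*} [MeasurableSpace X] :
    Measurable fun w : X × (ℕ → X) => consSeq w.1 w.2 := by
  refine measurable_pi_lambda _ fun n => ?_
  cases n with
  | zero => exact measurable_fst
  | succ n => exact (measurable_pi_apply n).comp measurable_snd

/-- Allows one to condition on the first coordinate of an independent sequence; it suffices to
compare the measures of finite-dimensional boxes. -/
theorem map_consSeq {X : Type*} [MeasurableSpace X] (μ : ℕ → Measure X)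
    [∀ n, IsProbabilityMeasure (μ n)] :
    ((μ 0).prod (Measure.infinitePi fun n => μ (n + 1))).map (fun w => consSeq w.1 w.2) =
      Measure.infinitePi μ := by
  classical
  refine Measure.eq_infinitePi _ fun s t ht => ?_
  obtain ⟨N, hN⟩ := s.exists_nat_subset_range
  -- Pads the box with trivial sides, so that its index set is an initial segment containing `0` and
  -- the first side splits off.
  set u : ℕ → Set X := fun i => if i ∈ s then t i else univ with hu
  have hum : ∀ i, MeasurableSet (u i) := by
    intro i
    simp only [hu]
    split_ifs
    exacts [ht i, MeasurableSet.univ]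
  have h1 : Set.pi (s : Set ℕ) t = Set.pi (Finset.range (N + 1) : Set ℕ) u := by
    ext x
    simp only [Set.mem_pi, hu]
    constructor
    · intro h i _
      split_ifs with his
      exacts [h i his, mem_univ _]
    · intro h i his
      have his' : i ∈ s := his
      have := h i (Finset.mem_coe.2 (Finset.range_mono (Nat.le_succ N) (hN his')))
      rwa [if_pos his'] at this
  have h2 : ∏ i ∈ s, μ i (t i) = ∏ i ∈ Finset.range (N + 1), μ i (u i) := by
    rw [← Finset.prod_subset (hN.trans (Finset.range_mono (Nat.le_succ N)))]
    · exact Finset.prod_congr rfl fun i hi => by simp [hu, hi]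
    · intro i _ hi
      simp [hu, hi]
  have h3 : (fun w : X × (ℕ → X) => consSeq w.1 w.2) ⁻¹'
      (Set.pi (Finset.range (N + 1) : Set ℕ) u) =
      u 0 ×ˢ Set.pi (Finset.range N : Set ℕ) fun n => u (n + 1) := by
    ext w
    simp only [mem_preimage, Set.mem_pi, Set.mem_prod, Finset.coe_range, mem_Iio]
    constructor
    · intro h
      exact ⟨h 0 (Nat.succ_pos N), fun i hi => h (i + 1) (by omega)⟩
    · rintro ⟨h0, h⟩ i hi
      cases i with
      | zero => exact h0
      | succ i => exact h i (by omega)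
  have h4 : MeasurableSet (Set.pi (Finset.range (N + 1) : Set ℕ) u) :=
    MeasurableSet.pi (Finset.countable_toSet _) fun i _ => hum i
  rw [h1, h2, Measure.map_apply measurable_consSeq h4, h3, Measure.prod_prod,
    Measure.infinitePi_pi _ (fun i _ => hum (i + 1)), Finset.prod_range_succ', mul_comm]

theorem isProbabilityMeasure_beta_stick {a t : ℝ} (ha : 0 ≤ a) (ha1 : a < 1) (ht : 0 < t)
    (k : ℕ) : IsProbabilityMeasure (betaMeasure (1 - a) (t + ((k : ℝ) + 1) * a)) :=
  isProbabilityMeasureBeta (by linarith) (by positivity)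

theorem isProbabilityMeasure_stickLaw {a t : ℝ} (ha : 0 ≤ a) (ha1 : a < 1) (ht : 0 < t) :
    IsProbabilityMeasure (stickLaw a t) := by
  have := isProbabilityMeasure_beta_stick ha ha1 ht
  unfold stickLaw
  infer_instance

/-- Dropping the first proportion shifts `t + (k + 1) a` to `(t + a) + (k + 1) a`: the rest of the
sequence is again a stick-breaking sequence, with `t + a` in place of `t`. -/
theorem lintegral_stickLaw {a t : ℝ} (ha : 0 ≤ a) (ha1 : a < 1) (ht : 0 < t)
    {φ : (ℕ → ℝ) → ℝ≥0∞} (hφ : Measurable φ) :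
    ∫⁻ v, φ v ∂(stickLaw a t) =
      ∫⁻ x, ∫⁻ v, φ (consSeq x v) ∂(stickLaw a (t + a)) ∂(betaMeasure (1 - a) (t + a)) := by
  have h1 := isProbabilityMeasure_beta_stick ha ha1 ht
  have h2 := isProbabilityMeasure_stickLaw ha ha1 (by linarith : 0 < t + a)
  have h3 := map_consSeq fun k : ℕ => betaMeasure (1 - a) (t + ((k : ℝ) + 1) * a)
  have h4 : (Measure.infinitePi fun k : ℕ =>
      betaMeasure (1 - a) (t + (((k + 1 : ℕ) : ℝ) + 1) * a)) = stickLaw a (t + a) := by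
    unfold stickLaw
    congr 1
    funext k
    congr 1
    push_cast
    ring
  rw [h4] at h3
  have h5 : betaMeasure (1 - a) (t + (((0 : ℕ) : ℝ) + 1) * a) = betaMeasure (1 - a) (t + a) := by
    congr 1; simp
  rw [h5] at h3
  have h6 : SFinite (betaMeasure (1 - a) (t + a)) := by
    rw [← h5]; infer_instance
  rw [stickLaw, ← h3, lintegral_map hφ measurable_consSeq]
  exact lintegral_prod _ (hφ.comp measurable_consSeq).aemeasurable

theorem lintegral_infinitePi_const {E : Type*} [MeasurableSpace E] (H : Measure E)
    [IsProbabilityMeasure H] {φ : (ℕ → E) → ℝ≥0∞} (hφ : Measurable φ) :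
    ∫⁻ z, φ z ∂(Measure.infinitePi fun _ : ℕ => H) =
      ∫⁻ x, ∫⁻ z, φ (consSeq x z) ∂(Measure.infinitePi fun _ : ℕ => H) ∂H := by
  have h3 := map_consSeq fun _ : ℕ => H
  conv_lhs => rw [← h3]
  rw [lintegral_map hφ measurable_consSeq]
  exact lintegral_prod _ (hφ.comp measurable_consSeq).aemeasurable

theorem ae_stickLaw {a t : ℝ} (ha : 0 ≤ a) (ha1 : a < 1) (ht : 0 < t) :
    ∀ᵐ v ∂(stickLaw a t), ∀ k, v k ∈ Ioo (0 : ℝ) 1 := by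
  have h1 := isProbabilityMeasure_beta_stick ha ha1 ht
  rw [ae_all_iff]
  intro k
  have := (measurePreserving_eval_infinitePi
    (fun k : ℕ => betaMeasure (1 - a) (t + ((k : ℝ) + 1) * a)) k).quasiMeasurePreserving.ae
      (ae_betaMeasure _ _)
  exact this

theorem ae_infinitePi_const {E : Type*} [MeasurableSpace E] (H : Measure E)
    [IsProbabilityMeasure H] {p : E → Prop} (hp : ∀ᵐ x ∂H, p x) :
    ∀ᵐ z ∂(Measure.infinitePi fun _ : ℕ => H), ∀ k, p (z k) := by
  rw [ae_all_iff]
  exact fun k => (measurePreserving_eval_infinitePi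
    (fun _ : ℕ => H) k).quasiMeasurePreserving.ae hp

/-- The joint law of the stick-breaking proportions and the atoms. -/
noncomputable def jointLaw {E : Type*} [MeasurableSpace E] (a t : ℝ) (H : Measure E) :
    Measure ((ℕ → ℝ) × (ℕ → E)) :=
  (stickLaw a t).prod (Measure.infinitePi fun _ : ℕ => H)

theorem isProbabilityMeasure_jointLaw {E : Type*} [MeasurableSpace E] {a t : ℝ} (ha : 0 ≤ a)
    (ha1 : a < 1) (ht : 0 < t) (H : Measure E) [IsProbabilityMeasure H] :
    IsProbabilityMeasure (jointLaw a t H) := by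
  have := isProbabilityMeasure_stickLaw ha ha1 ht
  unfold jointLaw
  infer_instance

theorem lintegral_jointLaw {E : Type*} [MeasurableSpace E] {a t : ℝ} (ha : 0 ≤ a)
    (ha1 : a < 1) (ht : 0 < t) (H : Measure E) [IsProbabilityMeasure H]
    {φ : (ℕ → ℝ) × (ℕ → E) → ℝ≥0∞} (hφ : Measurable φ) :
    ∫⁻ w, φ w ∂(jointLaw a t H) =
      ∫⁻ x, ∫⁻ y, ∫⁻ w, φ (consSeq x w.1, consSeq y w.2) ∂(jointLaw a (t + a) H) ∂H
        ∂(betaMeasure (1 - a) (t + a)) := by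
  have h1 := isProbabilityMeasure_stickLaw ha ha1 ht
  have h2 := isProbabilityMeasure_stickLaw ha ha1 (by linarith : 0 < t + a)
  have hc1 : Measurable fun q : ℝ × (ℕ → ℝ) => consSeq q.1 q.2 := measurable_consSeq
  have hc2 : Measurable fun q : E × (ℕ → E) => consSeq q.1 q.2 := measurable_consSeq
  rw [jointLaw, lintegral_prod _ hφ.aemeasurable,
    lintegral_stickLaw ha ha1 ht hφ.lintegral_prod_right']
  refine lintegral_congr fun x => ?_
  have h3 : ∀ v : ℕ → ℝ, ∫⁻ z, φ (consSeq x v, z) ∂(Measure.infinitePi fun _ : ℕ => H) =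
      ∫⁻ y, ∫⁻ z, φ (consSeq x v, consSeq y z) ∂(Measure.infinitePi fun _ : ℕ => H) ∂H :=
    fun v => lintegral_infinitePi_const H (hφ.comp measurable_prodMk_left)
  rw [lintegral_congr h3, lintegral_lintegral_swap]
  · refine lintegral_congr fun y => ?_
    rw [jointLaw, lintegral_prod]
    exact (hφ.comp ((hc1.comp (measurable_const.prodMk measurable_fst)).prodMk
      (hc2.comp (measurable_const.prodMk measurable_snd)))).aemeasurable
  · refine Measurable.aemeasurable ?_
    refine Measurable.lintegral_prod_right'
      (f := fun q : ((ℕ → ℝ) × E) × (ℕ → E) => φ (consSeq x q.1.1, consSeq q.1.2 q.2)) ?_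
    exact hφ.comp ((hc1.comp (measurable_const.prodMk (measurable_fst.comp measurable_fst))).prodMk
      (hc2.comp ((measurable_snd.comp measurable_fst).prodMk measurable_snd)))

theorem measurable_stickWeight (k : ℕ) : Measurable fun v : ℕ → ℝ => stickWeight v k := by
  unfold stickWeight
  fun_prop

theorem stickWeight_succ (x : ℝ) (v : ℕ → ℝ) (k : ℕ) :
    stickWeight (consSeq x v) (k + 1) = (1 - x) * stickWeight v k := by
  simp only [stickWeight, Finset.prod_range_succ', consSeq]
  ring

theorem stickWeight_zero (x : ℝ) (v : ℕ → ℝ) : stickWeight (consSeq x v) 0 = x := by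
  simp [stickWeight, consSeq]

theorem stickWeight_nonneg {v : ℕ → ℝ} (hv : ∀ k, v k ∈ Ioo (0 : ℝ) 1) (k : ℕ) :
    0 ≤ stickWeight v k :=
  mul_nonneg (hv k).1.le (Finset.prod_nonneg fun j _ => by linarith [(hv j).2])

theorem sum_stickWeight (v : ℕ → ℝ) (n : ℕ) :
    ∑ k ∈ Finset.range n, stickWeight v k = 1 - ∏ k ∈ Finset.range n, (1 - v k) := by
  induction n with
  | zero => simp
  | succ n ih => rw [Finset.sum_range_succ, ih, Finset.prod_range_succ, stickWeight]; ring

theorem tsum_stickWeight_le {v : ℕ → ℝ} (hv : ∀ k, v k ∈ Ioo (0 : ℝ) 1) :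
    ∑' k, ENNReal.ofReal (stickWeight v k) ≤ 1 := by
  refine ENNReal.tsum_le_of_sum_range_le fun n => ?_
  rw [← ENNReal.ofReal_sum_of_nonneg fun k _ => stickWeight_nonneg hv k, sum_stickWeight,
    ENNReal.ofReal_le_one]
  have : 0 ≤ ∏ k ∈ Finset.range n, (1 - v k) :=
    Finset.prod_nonneg fun j _ => by linarith [(hv j).2]
  linarith

theorem lintegral_discreteMeasure {E : Type*} [MeasurableSpace E] (v : ℕ → ℝ) (z : ℕ → E)
    {f : E → ℝ≥0∞} (hf : Measurable f) :
    ∫⁻ x, f x ∂(discreteMeasure v z) = ∑' k, ENNReal.ofReal (stickWeight v k) * f (z k) := by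
  rw [discreteMeasure, lintegral_sum_measure]
  refine tsum_congr fun k => ?_
  rw [lintegral_smul_measure, lintegral_dirac' _ hf, smul_eq_mul]

theorem measurable_lintegral_discreteMeasure {E : Type*} [MeasurableSpace E] {f : E → ℝ≥0∞}
    (hf : Measurable f) : Measurable fun w : (ℕ → ℝ) × (ℕ → E) =>
      ∫⁻ x, f x ∂(discreteMeasure w.1 w.2) := by
  simp only [lintegral_discreteMeasure _ _ hf]
  refine Measurable.tsum fun k => ?_
  exact (((measurable_stickWeight k).comp measurable_fst).ennreal_ofReal).mul
    (hf.comp ((measurable_pi_apply k).comp measurable_snd))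

/-- Self-similarity of stick breaking: after the first break, the remaining length `1 - x` is broken
by the same rule. -/
theorem lintegral_discreteMeasure_cons {E : Type*} [MeasurableSpace E] {x : ℝ}
    (hx : x ∈ Ioo (0 : ℝ) 1) (y : E) (v : ℕ → ℝ) (z : ℕ → E) {f : E → ℝ≥0∞} (hf : Measurable f) :
    ∫⁻ u, f u ∂(discreteMeasure (consSeq x v) (consSeq y z)) =
      ENNReal.ofReal x * f y +
        ENNReal.ofReal (1 - x) * ∫⁻ u, f u ∂(discreteMeasure v z) := by
  rw [lintegral_discreteMeasure _ _ hf, lintegral_discreteMeasure _ _ hf, tsum_eq_zero_add' (by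
    exact ENNReal.summable), ← ENNReal.tsum_mul_left]
  congr 1
  · rw [stickWeight_zero]; rfl
  · refine tsum_congr fun k => ?_
    rw [stickWeight_succ, ENNReal.ofReal_mul (by linarith [hx.2]), mul_assoc]
    rfl

/-- The mean `∑ k, P_k g (z k)` of a nonnegative function. -/
noncomputable def stickMean {E : Type*} [MeasurableSpace E] (g : E → ℝ)
    (w : (ℕ → ℝ) × (ℕ → E)) : ℝ :=
  (∫⁻ x, ENNReal.ofReal (g x) ∂(discreteMeasure w.1 w.2)).toReal

theorem measurable_stickMean {E : Type*} [MeasurableSpace E] {g : E → ℝ} (hg : Measurable g) :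
    Measurable (stickMean g) :=
  (measurable_lintegral_discreteMeasure hg.ennreal_ofReal).ennreal_toReal

theorem stickMean_nonneg {E : Type*} [MeasurableSpace E] (g : E → ℝ) (w : (ℕ → ℝ) × (ℕ → E)) :
    0 ≤ stickMean g w := ENNReal.toReal_nonneg

theorem stickMean_cons {E : Type*} [MeasurableSpace E] {x : ℝ}
    (hx : x ∈ Ioo (0 : ℝ) 1) {y : E} {w : (ℕ → ℝ) × (ℕ → E)} {g : E → ℝ} (hg : Measurable g)
    (hy : 0 ≤ g y) (hw : ∫⁻ u, ENNReal.ofReal (g u) ∂(discreteMeasure w.1 w.2) ≠ ∞) :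
    stickMean g (consSeq x w.1, consSeq y w.2) = x * g y + (1 - x) * stickMean g w := by
  have h1 : 0 ≤ 1 - x := by linarith [hx.2]
  rw [stickMean, lintegral_discreteMeasure_cons hx y w.1 w.2 hg.ennreal_ofReal,
    ENNReal.toReal_add (ENNReal.mul_ne_top ENNReal.ofReal_ne_top ENNReal.ofReal_ne_top)
      (ENNReal.mul_ne_top ENNReal.ofReal_ne_top hw), ENNReal.toReal_mul, ENNReal.toReal_mul,
    ENNReal.toReal_ofReal hx.1.le, ENNReal.toReal_ofReal hy, ENNReal.toReal_ofReal h1]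
  rfl

/-- The law of `∑ k, P_k g (z k)`. -/
noncomputable def stickMeanLaw {E : Type*} [MeasurableSpace E] (a t : ℝ) (H : Measure E)
    (g : E → ℝ) : Measure ℝ := (jointLaw a t H).map (stickMean g)

theorem isProbabilityMeasure_stickMeanLaw {E : Type*} [MeasurableSpace E] {a t : ℝ} (ha : 0 ≤ a)
    (ha1 : a < 1) (ht : 0 < t) (H : Measure E) [IsProbabilityMeasure H] {g : E → ℝ}
    (hg : Measurable g) : IsProbabilityMeasure (stickMeanLaw a t H g) := by
  have := isProbabilityMeasure_jointLaw ha ha1 ht H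
  exact Measure.isProbabilityMeasure_map (measurable_stickMean hg).aemeasurable

theorem ae_stickMeanLaw {E : Type*} [MeasurableSpace E] (a t : ℝ) (H : Measure E) {g : E → ℝ}
    (hg : Measurable g) : ∀ᵐ x ∂(stickMeanLaw a t H g), 0 ≤ x := by
  rw [stickMeanLaw, ae_map_iff (measurable_stickMean hg).aemeasurable (p := fun x => 0 ≤ x)
    measurableSet_Ici]
  exact Eventually.of_forall (stickMean_nonneg g)

/-- If `M = x g(y) + (1 - x) M'` then `1 + s M` is the mixture of `1 + s g(y)` and `1 + s M'` with
weight `x` of law `Beta(1 - a, t + a)`. The order `t + 1` is the sum of the two beta parameters, so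
the beta integral factorizes the expectation. -/
theorem stieltjes_stickMeanLaw {E : Type*} [MeasurableSpace E] {a t : ℝ} (ha : 0 ≤ a)
    (ha1 : a < 1) (ht : 0 < t) (H : Measure E) [IsProbabilityMeasure H] {g : E → ℝ}
    (hg : Measurable g) (hg0 : ∀ᵐ y ∂H, 0 ≤ g y)
    (hfin : ∀ᵐ w ∂(jointLaw a (t + a) H),
      ∫⁻ u, ENNReal.ofReal (g u) ∂(discreteMeasure w.1 w.2) ≠ ∞) {s : ℝ} (hs : 0 < s) :
    stieltjes (stickMeanLaw a t H g) (t + 1) s =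
      (∫⁻ y, ENNReal.ofReal ((1 + s * g y) ^ (-(1 - a))) ∂H) *
        stieltjes (stickMeanLaw a (t + a) H g) (t + a) s := by
  have hm := measurable_stickMean hg
  have hta : 0 < t + a := by linarith
  have hJ := isProbabilityMeasure_jointLaw ha ha1 hta H
  have hb := isProbabilityMeasureBeta (by linarith : 0 < 1 - a) hta
  have hc1 : Measurable fun q : ℝ × (ℕ → ℝ) => consSeq q.1 q.2 := measurable_consSeq
  have hc2 : Measurable fun q : E × (ℕ → E) => consSeq q.1 q.2 := measurable_consSeq
  rw [stieltjes, stickMeanLaw, lintegral_map (by fun_prop) hm,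
    lintegral_jointLaw ha ha1 ht H (by fun_prop)]
  have h1 : ∀ᵐ x ∂(betaMeasure (1 - a) (t + a)),
      ∫⁻ y, ∫⁻ w, ENNReal.ofReal
        ((1 + s * stickMean g (consSeq x w.1, consSeq y w.2)) ^ (-(t + 1)))
        ∂(jointLaw a (t + a) H) ∂H =
      ∫⁻ y, ∫⁻ w, ENNReal.ofReal
        ((x * (1 + s * g y) + (1 - x) * (1 + s * stickMean g w)) ^ (-(1 - a + (t + a))))
        ∂(jointLaw a (t + a) H) ∂H := by
    filter_upwards [ae_betaMeasure (1 - a) (t + a)] with x hx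
    refine lintegral_congr_ae ?_
    filter_upwards [hg0] with y hy
    refine lintegral_congr_ae ?_
    filter_upwards [hfin] with w hw
    rw [stickMean_cons hx hg hy hw]
    congr 2
    · ring
    · ring
  rw [lintegral_congr_ae h1, lintegral_lintegral_swap]
  · have h2 : ∀ᵐ y ∂H, ∫⁻ x, ∫⁻ w, ENNReal.ofReal
        ((x * (1 + s * g y) + (1 - x) * (1 + s * stickMean g w)) ^ (-(1 - a + (t + a))))
        ∂(jointLaw a (t + a) H) ∂(betaMeasure (1 - a) (t + a)) =
        ENNReal.ofReal ((1 + s * g y) ^ (-(1 - a))) *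
          stieltjes (stickMeanLaw a (t + a) H g) (t + a) s := by
      filter_upwards [hg0] with y hy
      rw [lintegral_lintegral_swap]
      · rw [stieltjes, stickMeanLaw, lintegral_map (by fun_prop) hm,
          ← lintegral_const_mul' _ _ ENNReal.ofReal_ne_top]
        refine lintegral_congr fun w => ?_
        have hw := stickMean_nonneg g w
        rw [lintegral_beta_mix (by linarith) hta (by positivity) (by positivity),
          ENNReal.ofReal_mul (by positivity)]
      · exact Measurable.aemeasurable (by fun_prop)
    rw [lintegral_congr_ae h2, lintegral_mul_const]
    fun_prop
  · refine Measurable.aemeasurable ?_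
    refine Measurable.lintegral_prod_right' (f := fun q : (ℝ × E) × ((ℕ → ℝ) × (ℕ → E)) =>
      ENNReal.ofReal ((q.1.1 * (1 + s * g q.1.2) + (1 - q.1.1) * (1 + s * stickMean g q.2)) ^
        (-(1 - a + (t + a))))) ?_
    fun_prop

/-! ### Differential equations for generalized Stieltjes transforms -/

/-- Since `s x = (1 + s x) - 1`, differentiating the kernel of order `t` only produces the kernels
of orders `t` and `t + 1`; the latter is what the stick-breaking recursion evaluates. -/
theorem hasDerivAt_stieltjes {μ : Measure ℝ} [IsFiniteMeasure μ] (hμ : ∀ᵐ x ∂μ, 0 ≤ x) {s t : ℝ}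
    (hs : 0 < s) (ht : 0 < t) :
    HasDerivAt (fun s => ∫ x, (1 + s * x) ^ (-t) ∂μ)
      (-(t / s) * (∫ x, (1 + s * x) ^ (-t) ∂μ - ∫ x, (1 + s * x) ^ (-(t + 1)) ∂μ)) s := by
  have key := hasDerivAt_integral_of_dominated_loc_of_deriv_le (μ := μ) (𝕜 := ℝ)
    (F := fun s x => (1 + s * x) ^ (-t)) (x₀ := s) (s := Ioi (s / 2))
    (F' := fun s x => -(t / s) * ((1 + s * x) ^ (-t) - (1 + s * x) ^ (-(t + 1))))
    (bound := fun _ => 2 * t / s) (Ioi_mem_nhds (by linarith))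
    (Eventually.of_forall fun u => Measurable.aestronglyMeasurable (by fun_prop))
    (integrable_stieltjes hμ hs.le ht.le) (Measurable.aestronglyMeasurable (by fun_prop)) ?_
    (integrable_const _) ?_
  · have h2 := key.2
    rwa [integral_const_mul, integral_sub (integrable_stieltjes hμ hs.le ht.le)
      (integrable_stieltjes hμ hs.le (by linarith))] at h2
  · filter_upwards [hμ] with x hx u hu
    have hu' : s / 2 < u := hu
    have hu0 : 0 < u := by linarith
    obtain ⟨h1, h2⟩ := stieltjes_bound hu0.le ht.le hx
    obtain ⟨h3, h4⟩ := stieltjes_bound (t := t + 1) hu0.le (by linarith) hx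
    rw [norm_mul, norm_neg, Real.norm_of_nonneg (by positivity), Real.norm_eq_abs]
    -- Both kernels lie in `[0, 1]`, so the derivative is bounded independently of `x`, without any
    -- moment assumption.
    have h5 : |(1 + u * x) ^ (-t) - (1 + u * x) ^ (-(t + 1))| ≤ 1 := by
      rw [abs_le]; constructor <;> linarith
    have h6 : t / u ≤ 2 * t / s := by
      rw [div_le_div_iff₀ hu0 hs]; nlinarith
    calc t / u * |(1 + u * x) ^ (-t) - (1 + u * x) ^ (-(t + 1))| ≤ t / u * 1 := by gcongr
      _ ≤ _ := by rwa [mul_one]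
  · filter_upwards [hμ] with x hx u hu
    have hu' : s / 2 < u := hu
    have hu0 : 0 < u := by linarith
    have hb : 0 < 1 + u * x := by positivity
    have h1 : HasDerivAt (fun u => 1 + u * x) x u := by
      simpa using ((hasDerivAt_id u).mul_const x).const_add 1
    convert! h1.rpow_const (p := -t) (Or.inl hb.ne') using 1
    have h2 : (1 + u * x) ^ (-t) = (1 + u * x) ^ (-(t + 1)) * (1 + u * x) := by
      rw [← Real.rpow_add_one hb.ne']; congr 1; ring
    rw [show -t - 1 = -(t + 1) by ring, h2]
    field_simp
    ring

theorem tendsto_stieltjes_zero {μ : Measure ℝ} [IsProbabilityMeasure μ] (hμ : ∀ᵐ x ∂μ, 0 ≤ x)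
    {t : ℝ} (ht : 0 ≤ t) :
    Tendsto (fun s => ∫ x, (1 + s * x) ^ (-t) ∂μ) (𝓝[>] 0) (𝓝 1) := by
  suffices h : Tendsto (fun s => ∫ x, (1 + s * x) ^ (-t) ∂μ) (𝓝[>] 0) (𝓝 (∫ _, (1 : ℝ) ∂μ)) by
    simpa using h
  refine tendsto_integral_filter_of_dominated_convergence (fun _ => 1)
    (Eventually.of_forall fun u => Measurable.aestronglyMeasurable (by fun_prop)) ?_
    (integrable_const _) ?_
  · filter_upwards [self_mem_nhdsWithin] with s hs
    filter_upwards [hμ] with x hx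
    have hs' : 0 < s := hs
    obtain ⟨h1, h2⟩ := stieltjes_bound hs'.le ht hx
    rwa [Real.norm_of_nonneg h1]
  · refine Eventually.of_forall fun x => ?_
    have h2 : Tendsto (fun s : ℝ => (1 + s * x) ^ (-t)) (𝓝 0) (𝓝 ((1 + 0 * x) ^ (-t))) := by
      refine Tendsto.rpow_const ?_ (Or.inl (by simp))
      exact (continuous_const.add (continuous_id.mul continuous_const)).tendsto _
    simp only [zero_mul, add_zero, Real.one_rpow] at h2
    exact h2.mono_left nhdsWithin_le_nhds

theorem nonneg_of_deriv_nonneg_of_tendsto {f f' : ℝ → ℝ} (hf : ∀ s, 0 < s → HasDerivAt f (f' s) s)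
    (hf' : ∀ s, 0 < s → 0 ≤ f' s) (h0 : Tendsto f (𝓝[>] 0) (𝓝 0)) {s : ℝ} (hs : 0 < s) :
    0 ≤ f s := by
  have hmono : MonotoneOn f (Ioi 0) := by
    refine monotoneOn_of_deriv_nonneg (convex_Ioi 0)
      (fun x hx => (hf x hx).continuousAt.continuousWithinAt) ?_ ?_
    · rw [interior_Ioi]
      exact fun x hx => (hf x hx).differentiableAt.differentiableWithinAt
    · rw [interior_Ioi]
      intro x hx
      rw [(hf x hx).deriv]
      exact hf' x hx
  refine le_of_tendsto h0 ?_
  filter_upwards [Ioo_mem_nhdsGT hs] with u hu using hmono hu.1 hs hu.2.le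

/-- The linear differential equation which characterises the law of a Dirichlet mean. -/
theorem stieltjes_eq_of_ode {μ : Measure ℝ} [IsProbabilityMeasure μ] (hμ : ∀ᵐ x ∂μ, 0 ≤ x)
    {t : ℝ} (ht : 0 < t) {G L : ℝ → ℝ}
    (hG : ∀ s, 0 < s → ∫ x, (1 + s * x) ^ (-(t + 1)) ∂μ = G s * ∫ x, (1 + s * x) ^ (-t) ∂μ)
    (hL : ∀ s, 0 < s → HasDerivAt L (-(t / s) * (1 - G s) * L s) s)
    (hLpos : ∀ s, 0 < s → 0 < L s) (hL0 : Tendsto L (𝓝[>] 0) (𝓝 1)) {s : ℝ} (hs : 0 < s) :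
    ∫ x, (1 + s * x) ^ (-t) ∂μ = L s := by
  set φ : ℝ → ℝ := fun s => ∫ x, (1 + s * x) ^ (-t) ∂μ with hφ
  have hd : ∀ s, 0 < s → HasDerivAt (fun s => φ s / L s) 0 s := by
    intro s hs
    have h1 := hasDerivAt_stieltjes hμ hs ht
    rw [hG s hs] at h1
    convert! h1.div (hL s hs) (hLpos s hs).ne' using 1
    have := (hLpos s hs).ne'
    field_simp
    ring
  have hlim : Tendsto (fun s => φ s / L s) (𝓝[>] 0) (𝓝 1) := by
    have h1 := (tendsto_stieltjes_zero hμ ht.le).div hL0 one_ne_zero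
    rw [div_one] at h1
    exact h1
  -- The quotient has zero derivative and limit `1` at `0+`; the one-sided comparison is applied to
  -- both signs of the difference.
  have h1 : 0 ≤ φ s / L s - 1 := by
    refine nonneg_of_deriv_nonneg_of_tendsto (f := fun s => φ s / L s - 1) (f' := fun _ => 0)
      (fun s hs => (hd s hs).sub_const 1) (fun _ _ => le_rfl) ?_ hs
    simpa using hlim.sub_const 1
  have h2 : 0 ≤ 1 - φ s / L s := by
    refine nonneg_of_deriv_nonneg_of_tendsto (f := fun s => 1 - φ s / L s) (f' := fun _ => 0)
      (fun s hs => by simpa using (hd s hs).const_sub 1) (fun _ _ => le_rfl) ?_ hs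
    simpa using hlim.const_sub 1
  have h3 : φ s / L s = 1 := by linarith
  rwa [div_eq_one_iff_eq (hLpos s hs).ne'] at h3

/-- The expected length of the stick which remains after `n` breaks. -/
noncomputable def remainder (a t : ℝ) (n : ℕ) : ℝ :=
  ∏ k ∈ Finset.range n, (t + ((k : ℝ) + 1) * a) / (t + k * a + 1)

/-- Splitting off the factor `k = 0` moves `t` to `t + a`, exactly as in the stick-breaking
recursion. -/
theorem remainder_succ (a t : ℝ) (n : ℕ) :
    remainder a t (n + 1) = (t + a) / (t + 1) * remainder a (t + a) n := by
  rw [remainder, Finset.prod_range_succ', mul_comm, remainder]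
  congr 1
  · simp
  · refine Finset.prod_congr rfl fun k _ => ?_
    push_cast
    ring_nf

theorem remainder_nonneg {a t : ℝ} (ha : 0 ≤ a) (ht : 0 < t) (n : ℕ) : 0 ≤ remainder a t n :=
  Finset.prod_nonneg fun k _ => by positivity

/-- Each factor is `1 - (1 - a) / (t + k a + 1)`, and these deficits dominate a multiple of the
harmonic series. -/
theorem tendsto_remainder {a t : ℝ} (ha : 0 ≤ a) (ha1 : a < 1) (ht : 0 < t) :
    Tendsto (remainder a t) atTop (𝓝 0) := by
  -- Chosen so that `b / (k + 1) ≤ (1 - a) / (t + k a + 1)` for every `k`, which rests on `t + k a +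
  -- 1 ≤ (t + a + 1) (k + 1)`.
  set b := (1 - a) / (t + a + 1) with hb
  have hb0 : 0 < b := div_pos (by linarith) (by linarith)
  have hle : ∀ n, remainder a t n ≤
      Real.exp (-(b * ∑ k ∈ Finset.range n, 1 / ((k : ℝ) + 1))) := by
    intro n
    rw [Finset.mul_sum, ← Finset.sum_neg_distrib, Real.exp_sum]
    refine Finset.prod_le_prod (fun k _ => by positivity) fun k _ => ?_
    have h1 : (t + ((k : ℝ) + 1) * a) / (t + k * a + 1) = -((1 - a) / (t + k * a + 1)) + 1 := by
      field_simp
      ring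
    have h2 : b * (1 / ((k : ℝ) + 1)) ≤ (1 - a) / (t + k * a + 1) := by
      rw [hb, div_mul_div_comm, mul_one]
      have hk : (0 : ℝ) ≤ k := k.cast_nonneg
      have : 0 ≤ 1 - a := by linarith
      gcongr
      nlinarith [mul_nonneg hk ht.le]
    rw [h1]
    refine (Real.add_one_le_exp _).trans (Real.exp_le_exp.2 ?_)
    linarith
  refine squeeze_zero (fun n => remainder_nonneg ha ht n) hle ?_
  refine Real.tendsto_exp_neg_atTop_nhds_zero.comp ?_
  exact Real.tendsto_sum_range_one_div_nat_succ_atTop.const_mul_atTop hb0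

theorem one_sub_le_rpow_neg {u τ : ℝ} (hu : 0 ≤ u) (hτ : 0 ≤ τ) : 1 - τ * u ≤ (1 + u) ^ (-τ) := by
  have hu1 : 0 < 1 + u := by linarith
  rw [Real.rpow_def_of_pos hu1]
  have h1 := Real.add_one_le_exp (Real.log (1 + u) * -τ)
  have h2 := Real.log_le_sub_one_of_pos hu1
  nlinarith

/-- A family of laws on `[0, 1]` which satisfies the stick-breaking differential system. -/
theorem stieltjes_eq_of_system {α p : ℝ} (h0 : 0 < α) (h1 : α < 1) (hp0 : 0 ≤ p) (hp1 : p ≤ 1)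
    {μ : ℝ → Measure ℝ} (hprob : ∀ t, 0 < t → IsProbabilityMeasure (μ t))
    (hsupp : ∀ t, 0 < t → ∀ᵐ x ∂(μ t), x ∈ Icc (0 : ℝ) 1)
    (hsys : ∀ t, 0 < t → ∀ s, 0 < s → ∫ x, (1 + s * x) ^ (-(t + 1)) ∂(μ t) =
      (p * (1 + s) ^ (α - 1) + (1 - p)) * ∫ x, (1 + s * x) ^ (-(t + α)) ∂(μ (t + α)))
    {t s : ℝ} (ht : 0 < t) (hs : 0 < s) :
    ∫ x, (1 + s * x) ^ (-t) ∂(μ t) = (p * (1 + s) ^ α + (1 - p)) ^ (-(t / α)) := by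
  set Φ : ℝ → ℝ → ℝ := fun t s => ∫ x, (1 + s * x) ^ (-t) ∂(μ t) with hΦ
  set Ψ : ℝ → ℝ → ℝ := fun t s => (p * (1 + s) ^ α + (1 - p)) ^ (-(t / α)) with hΨ
  set g : ℝ → ℝ := fun s => p * (1 + s) ^ (α - 1) + (1 - p) with hg
  have hbase : ∀ s : ℝ, 0 ≤ s → 1 ≤ (1 + s) ^ α := fun s hs =>
    Real.one_le_rpow (by linarith) h0.le
  have hB : ∀ s : ℝ, 0 ≤ s → 1 ≤ p * (1 + s) ^ α + (1 - p) := by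
    intro s hs
    nlinarith [hbase s hs]
  have hg01 : ∀ s : ℝ, 0 ≤ s → 0 ≤ g s ∧ g s ≤ 1 := by
    intro s hs
    have h3 : (1 + s) ^ (α - 1) ≤ 1 :=
      Real.rpow_le_one_of_one_le_of_nonpos (by linarith) (by linarith)
    have h4 : 0 ≤ (1 + s) ^ (α - 1) := by positivity
    simp only [hg]
    constructor <;> nlinarith
  have hΦd : ∀ t, 0 < t → ∀ s, 0 < s →
      HasDerivAt (Φ t) (-(t / s) * (Φ t s - g s * Φ (t + α) s)) s := by
    intro t ht s hs
    have := hprob t ht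
    have h3 := hasDerivAt_stieltjes ((hsupp t ht).mono fun x hx => hx.1) hs ht
    rwa [hsys t ht s hs] at h3
  -- The explicit functions solve the same coupled system as the transforms; what remains is
  -- uniqueness for this infinite system.
  have hΨd : ∀ t, 0 < t → ∀ s, 0 < s →
      HasDerivAt (Ψ t) (-(t / s) * (Ψ t s - g s * Ψ (t + α) s)) s := by
    intro t ht s hs
    have hb := hB s hs.le
    have hs1 : 0 < 1 + s := by linarith
    have e1 : HasDerivAt (fun s : ℝ => p * (1 + s) ^ α + (1 - p)) (p * (1 * α * (1 + s) ^ (α - 1)))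
        s := by
      refine HasDerivAt.add_const _ (HasDerivAt.const_mul _ ?_)
      exact ((hasDerivAt_id s).const_add 1).rpow_const (Or.inl hs1.ne')
    convert! e1.rpow_const (p := -(t / α)) (Or.inl (by linarith)) using 1
    have e2 : Ψ (t + α) s = (p * (1 + s) ^ α + (1 - p)) ^ (-(t / α) - 1) := by
      simp only [hΨ]
      congr 1
      field_simp
      ring
    have e3 : Ψ t s = (p * (1 + s) ^ α + (1 - p)) ^ (-(t / α) - 1) *
        (p * (1 + s) ^ α + (1 - p)) := by
      rw [← Real.rpow_add_one (by linarith)]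
      simp only [hΨ]
      congr 1
      ring
    have e4 : (1 + s) ^ α = (1 + s) ^ (α - 1) * (1 + s) := by
      rw [← Real.rpow_add_one hs1.ne']
      congr 1
      ring
    rw [e3, e2, hg]
    simp only []
    generalize (p * (1 + s) ^ α + (1 - p)) ^ (-(t / α) - 1) = W
    rw [e4]
    field_simp
    ring
  -- Iterating the system `n` times, the discrepancy at level `t` is controlled by that at level `t
  -- + n α`, which costs the factor `remainder α t n`. Since `n` is free, the discrepancy vanishes.
  -- For `n = 0`, both functions lie in `[1 - t s, 1]`.
  have hbound : ∀ n : ℕ, ∀ t, 0 < t → ∀ s, 0 < s → |Φ t s - Ψ t s| ≤ s * t * remainder α t n := by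
    intro n
    induction n with
    | zero =>
      intro t ht s hs
      have := hprob t ht
      have hsu := hsupp t ht
      have hin := integrable_stieltjes (hsu.mono fun x hx => hx.1) hs.le ht.le
      have a1 : Φ t s ≤ 1 := by
        have : Φ t s ≤ ∫ _, (1 : ℝ) ∂(μ t) := by
          refine integral_mono_ae hin (integrable_const _) ?_
          filter_upwards [hsu] with x hx using (stieltjes_bound hs.le ht.le hx.1).2
        simpa using this
      have a2 : 1 - t * s ≤ Φ t s := by
        have : ∫ _, (1 - t * s) ∂(μ t) ≤ Φ t s := by
          refine integral_mono_ae (integrable_const _) hin ?_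
          filter_upwards [hsu] with x hx
          refine le_trans ?_ (one_sub_le_rpow_neg (mul_nonneg hs.le hx.1) ht.le)
          have : s * x ≤ s := by nlinarith [hx.2]
          nlinarith
        simpa using this
      have a3 : Ψ t s ≤ 1 := by
        refine Real.rpow_le_one_of_one_le_of_nonpos (hB s hs.le) ?_
        have : 0 < t / α := by positivity
        linarith
      have a4 : 1 - t * s ≤ Ψ t s := by
        have b1 : p * (1 + s) ^ α + (1 - p) = 1 + p * ((1 + s) ^ α - 1) := by ring
        have b2 := hbase s hs.le
        have b3 := one_sub_le_rpow_neg (u := p * ((1 + s) ^ α - 1)) (τ := t / α)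
          (mul_nonneg hp0 (by linarith)) (by positivity)
        simp only [hΨ]
        rw [b1]
        refine le_trans ?_ b3
        have b4 : (1 + s) ^ α - 1 ≤ α * s := by
          have := rpow_one_add_le_one_add_mul_self (s := s) (by linarith) h0.le h1.le
          linarith
        have b5 : p * ((1 + s) ^ α - 1) ≤ α * s := by nlinarith
        have b6 : t / α * (p * ((1 + s) ^ α - 1)) ≤ t / α * (α * s) := by gcongr
        have b7 : t / α * (α * s) = t * s := by field_simp
        linarith
      rw [remainder, Finset.range_zero, Finset.prod_empty, abs_le]
      constructor <;> linarith
    | succ n ih =>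
      intro t ht s hs
      have htα : 0 < t + α := by linarith
      set K := (t + α) * remainder α (t + α) n with hK
      have hK0 : 0 ≤ K := mul_nonneg htα.le (remainder_nonneg h0.le htα n)
      -- The integrating factor `s ^ t` makes the derivative of `s ^ t (Φ_t - Ψ_t)` equal to `t s ^
      -- (t - 1) g(s)` times the discrepancy at `t + α`, which is at most `K s` by induction.
      -- Integration gives the majorant `t K s ^ (t + 1) / (t + 1)`; the two signs `σ` give the
      -- absolute value.
      have hsgn : ∀ σ : ℝ, |σ| = 1 →
          0 ≤ t * K / (t + 1) * s ^ (t + 1) - σ * (s ^ t * (Φ t s - Ψ t s)) := by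
        intro σ hσ
        refine nonneg_of_deriv_nonneg_of_tendsto
          (f := fun s => t * K / (t + 1) * s ^ (t + 1) - σ * (s ^ t * (Φ t s - Ψ t s)))
          (f' := fun s => t * s ^ (t - 1) *
            (K * s - σ * (g s * (Φ (t + α) s - Ψ (t + α) s)))) ?_ ?_ ?_ hs
        · intro s hs
          have c1 : HasDerivAt (fun s : ℝ => s ^ (t + 1)) ((t + 1) * s ^ (t + 1 - 1)) s :=
            Real.hasDerivAt_rpow_const (Or.inl hs.ne')
          have c2 : HasDerivAt (fun s : ℝ => s ^ t) (t * s ^ (t - 1)) s :=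
            Real.hasDerivAt_rpow_const (Or.inl hs.ne')
          have c3 := (hΦd t ht s hs).sub (hΨd t ht s hs)
          convert! (c1.const_mul (t * K / (t + 1))).sub ((c2.mul c3).const_mul σ) using 1
          have c4 : s ^ t = s ^ (t - 1) * s := by
            rw [← Real.rpow_add_one hs.ne']; congr 1; ring
          rw [add_sub_cancel_right, c4, Pi.sub_apply]
          field_simp
          ring
        · intro s hs
          have c1 := ih (t + α) htα s hs
          obtain ⟨c2, c3⟩ := hg01 s hs.le
          have c4 : σ * (g s * (Φ (t + α) s - Ψ (t + α) s)) ≤ K * s := by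
            refine (le_abs_self _).trans ?_
            rw [abs_mul, hσ, one_mul, abs_mul, abs_of_nonneg c2]
            calc g s * |Φ (t + α) s - Ψ (t + α) s| ≤ 1 * (s * (t + α) * remainder α (t + α) n) := by
                  gcongr
              _ = K * s := by rw [hK]; ring
          have : 0 ≤ K * s - σ * (g s * (Φ (t + α) s - Ψ (t + α) s)) := by linarith
          positivity
        · have d1 : ∀ r : ℝ, 0 < r → Tendsto (fun s : ℝ => s ^ r) (𝓝[>] 0) (𝓝 0) := by
            intro r hr
            have := (Real.continuousAt_rpow_const 0 r (Or.inr hr.le)).tendsto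
            rw [Real.zero_rpow hr.ne'] at this
            exact this.mono_left nhdsWithin_le_nhds
          have d2 : Tendsto (fun s : ℝ => s ^ t * (Φ t s - Ψ t s)) (𝓝[>] 0) (𝓝 0) := by
            have hpr := hprob t ht
            have d3 : Tendsto (Φ t) (𝓝[>] 0) (𝓝 1) :=
              tendsto_stieltjes_zero ((hsupp t ht).mono fun x hx => hx.1) ht.le
            have d4 : Tendsto (Ψ t) (𝓝[>] 0) (𝓝 ((p * (1 + 0) ^ α + (1 - p)) ^ (-(t / α)))) := by
              have : ContinuousAt (Ψ t) 0 := by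
                refine ContinuousAt.rpow_const ?_ (Or.inl ?_)
                · refine ContinuousAt.add (ContinuousAt.mul continuousAt_const ?_)
                    continuousAt_const
                  exact ContinuousAt.rpow_const (by fun_prop) (Or.inl (by norm_num))
                · have := hB 0 le_rfl
                  linarith
              exact this.tendsto.mono_left nhdsWithin_le_nhds
            simpa using (d1 t ht).mul (d3.sub d4)
          simpa using ((d1 (t + 1) (by linarith)).const_mul (t * K / (t + 1))).sub
            (d2.const_mul σ)
      have hst : 0 < s ^ t := by positivity
      have e1 : s ^ (t + 1) = s ^ t * s := Real.rpow_add_one hs.ne' t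
      have e2 : s * t * remainder α t (n + 1) = t * K / (t + 1) * s := by
        rw [remainder_succ, hK]; field_simp
      have f1 := hsgn 1 (by simp)
      have f2 := hsgn (-1) (by simp)
      rw [e1] at f1 f2
      rw [e2, abs_le]
      constructor
      · have : 0 ≤ s ^ t * (t * K / (t + 1) * s + (Φ t s - Ψ t s)) := by linarith
        have := nonneg_of_mul_nonneg_right this hst
        linarith
      · have : 0 ≤ s ^ t * (t * K / (t + 1) * s - (Φ t s - Ψ t s)) := by linarith
        have := nonneg_of_mul_nonneg_right this hst
        linarith
  have hlim : Tendsto (fun n => s * t * remainder α t n) atTop (𝓝 0) := by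
    simpa using (tendsto_remainder h0.le h1 ht).const_mul (s * t)
  have habs : |Φ t s - Ψ t s| ≤ 0 := ge_of_tendsto' hlim fun n => hbound n t ht s hs
  have := abs_nonpos_iff.1 habs
  linarith

/-! ### Moments of the stick-breaking weights -/

theorem lintegral_one_sub_rpow_beta {x y b : ℝ} (hx : 0 < x) (hy : 0 < y) (hb : 0 ≤ b) :
    ∫⁻ v, ENNReal.ofReal ((1 - v) ^ b) ∂(betaMeasure x y) =
      ENNReal.ofReal (beta x (y + b) / beta x y) := by
  have hB := beta_pos hx hy
  have hB' := beta_pos hx (by linarith : 0 < y + b)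
  have hp := isProbabilityMeasureBeta hx (by linarith : 0 < y + b)
  have h1 := lintegral_betaMeasure_Ioo 1 x (y + b)
  simp only [Pi.one_apply, lintegral_one, measure_univ, mul_one] at h1
  rw [lintegral_betaMeasure_Ioo]
  have : ∀ v ∈ Ioo (0 : ℝ) 1, ENNReal.ofReal (1 / beta x y * v ^ (x - 1) * (1 - v) ^ (y - 1)) *
      ENNReal.ofReal ((1 - v) ^ b) = ENNReal.ofReal (beta x (y + b) / beta x y) *
      ENNReal.ofReal (1 / beta x (y + b) * v ^ (x - 1) * (1 - v) ^ (y + b - 1)) := by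
    intro v hv
    have hv0 := hv.1
    have hv1 : 0 < 1 - v := by linarith [hv.2]
    rw [← ENNReal.ofReal_mul (by positivity), ← ENNReal.ofReal_mul (by positivity)]
    congr 1
    rw [show y + b - 1 = (y - 1) + b by ring, Real.rpow_add hv1]
    field_simp
  rw [setLIntegral_congr_fun measurableSet_Ioo this, lintegral_const_mul' _ _ ENNReal.ofReal_ne_top,
    ← h1, mul_one]

theorem lintegral_one_sub_beta {x y : ℝ} (hx : 0 < x) (hy : 0 < y) :
    ∫⁻ v, ENNReal.ofReal (1 - v) ∂(betaMeasure x y) = ENNReal.ofReal (y / (x + y)) := by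
  have := lintegral_one_sub_rpow_beta hx hy zero_le_one
  simp only [Real.rpow_one] at this
  rw [this, beta, beta, ← add_assoc, Real.Gamma_add_one hy.ne',
    Real.Gamma_add_one (by positivity : x + y ≠ 0)]
  have h1 := Real.Gamma_pos_of_pos hx
  have h2 := Real.Gamma_pos_of_pos hy
  have h3 := Real.Gamma_pos_of_pos (add_pos hx hy)
  congr 1
  field_simp

theorem lintegral_one_sub_rpow_beta_one {t b : ℝ} (ht : 0 < t) (hb : 0 ≤ b) :
    ∫⁻ v, ENNReal.ofReal ((1 - v) ^ b) ∂(betaMeasure 1 t) = ENNReal.ofReal (t / (t + b)) := by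
  have htb : 0 < t + b := by linarith
  rw [lintegral_one_sub_rpow_beta one_pos ht hb, beta, beta, add_comm 1, add_comm 1,
    Real.Gamma_add_one ht.ne', Real.Gamma_add_one htb.ne']
  have h1 := Real.Gamma_pos_of_pos htb
  have h2 := Real.Gamma_pos_of_pos ht
  congr 1
  rw [Real.Gamma_one]
  field_simp

theorem lintegral_prod_one_sub {a : ℝ} (ha : 0 ≤ a) (ha1 : a < 1) (n : ℕ) :
    ∀ t : ℝ, 0 < t → ∫⁻ v, ENNReal.ofReal (∏ k ∈ Finset.range n, (1 - v k)) ∂(stickLaw a t) =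
      ENNReal.ofReal (remainder a t n) := by
  induction n with
  | zero =>
    intro t ht
    have := isProbabilityMeasure_stickLaw ha ha1 ht
    simp [remainder]
  | succ n ih =>
    intro t ht
    have hta : 0 < t + a := by linarith
    rw [lintegral_stickLaw ha ha1 ht (by fun_prop)]
    have h1 : ∀ᵐ x ∂(betaMeasure (1 - a) (t + a)),
        ∫⁻ v, ENNReal.ofReal (∏ k ∈ Finset.range (n + 1), (1 - consSeq x v k))
          ∂(stickLaw a (t + a)) =
        ENNReal.ofReal (1 - x) * ENNReal.ofReal (remainder a (t + a) n) := by
      filter_upwards [ae_betaMeasure (1 - a) (t + a)] with x hx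
      rw [← ih (t + a) hta, ← lintegral_const_mul' _ _ ENNReal.ofReal_ne_top]
      refine lintegral_congr fun v => ?_
      rw [Finset.prod_range_succ', mul_comm, ← ENNReal.ofReal_mul (by linarith [hx.2])]
      rfl
    rw [lintegral_congr_ae h1, lintegral_mul_const _ (by fun_prop),
      lintegral_one_sub_beta (by linarith) hta, remainder_succ,
      ← ENNReal.ofReal_mul (div_nonneg hta.le (by linarith))]
    congr 3
    ring

/-- The first `n` weights and the unbroken part sum to one, and the mean of the unbroken part tends
to zero. -/
theorem tsum_lintegral_stickWeight {a t : ℝ} (ha : 0 ≤ a) (ha1 : a < 1) (ht : 0 < t) :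
    ∑' k, ∫⁻ v, ENNReal.ofReal (stickWeight v k) ∂(stickLaw a t) = 1 := by
  have hp := isProbabilityMeasure_stickLaw ha ha1 ht
  have hsum : ∀ n, ∑ k ∈ Finset.range n, ∫⁻ v, ENNReal.ofReal (stickWeight v k) ∂(stickLaw a t) +
      ENNReal.ofReal (remainder a t n) = 1 := by
    intro n
    have hmw := fun k => (measurable_stickWeight k).ennreal_ofReal
    rw [← lintegral_prod_one_sub ha ha1 n t ht, ← lintegral_finsetSum _ fun k _ => hmw k,
      ← lintegral_add_right _ (by fun_prop)]
    have : ∀ᵐ v ∂(stickLaw a t), ∑ k ∈ Finset.range n, ENNReal.ofReal (stickWeight v k) +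
        ENNReal.ofReal (∏ k ∈ Finset.range n, (1 - v k)) = 1 := by
      filter_upwards [ae_stickLaw ha ha1 ht] with v hv
      have h1 : 0 ≤ ∏ k ∈ Finset.range n, (1 - v k) :=
        Finset.prod_nonneg fun j _ => by linarith [(hv j).2]
      rw [← ENNReal.ofReal_sum_of_nonneg fun k _ => stickWeight_nonneg hv k,
        ← ENNReal.ofReal_add (Finset.sum_nonneg fun k _ => stickWeight_nonneg hv k) h1,
        sum_stickWeight]
      simp
    rw [lintegral_congr_ae this]
    simp
  have hlim := (ENNReal.tendsto_nat_tsum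
    fun k => ∫⁻ v, ENNReal.ofReal (stickWeight v k) ∂(stickLaw a t)).add
    (ENNReal.tendsto_ofReal (tendsto_remainder ha ha1 ht))
  simp only [hsum, ENNReal.ofReal_zero, add_zero] at hlim
  exact (tendsto_nhds_unique hlim tendsto_const_nhds)

/-- Weights and atoms are independent and the mean weights sum to one, so the mean of the random
measure is the law of an atom. -/
theorem lintegral_stick_sum {E : Type*} [MeasurableSpace E] {a t : ℝ} (ha : 0 ≤ a) (ha1 : a < 1)
    (ht : 0 < t) (H : Measure E) [IsProbabilityMeasure H] {f : E → ℝ≥0∞} (hf : Measurable f) :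
    ∫⁻ w, ∫⁻ x, f x ∂(discreteMeasure w.1 w.2) ∂(jointLaw a t H) = ∫⁻ x, f x ∂H := by
  have hp := isProbabilityMeasure_stickLaw ha ha1 ht
  simp only [lintegral_discreteMeasure _ _ hf]
  have hm1 := fun k => (measurable_stickWeight k).ennreal_ofReal
  have hm2 := fun k : ℕ => hf.comp (measurable_pi_apply (X := fun _ : ℕ => E) k)
  rw [lintegral_tsum]
  · have : ∀ k, ∫⁻ w, ENNReal.ofReal (stickWeight w.1 k) * f (w.2 k) ∂(jointLaw a t H) =
        (∫⁻ v, ENNReal.ofReal (stickWeight v k) ∂(stickLaw a t)) * ∫⁻ x, f x ∂H := by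
      intro k
      rw [jointLaw, lintegral_prod_mul (f := fun v => ENNReal.ofReal (stickWeight v k))
        (g := fun z : ℕ → E => f (z k)) (hm1 k).aemeasurable (hm2 k).aemeasurable]
      congr 1
      exact (measurePreserving_eval_infinitePi (fun _ : ℕ => H) k).lintegral_comp hf
    simp only [this]
    rw [ENNReal.tsum_mul_right, tsum_lintegral_stickWeight ha ha1 ht, one_mul]
  · exact fun k => (((hm1 k).comp measurable_fst).mul ((hm2 k).comp measurable_snd)).aemeasurable

theorem ae_jointLaw {E : Type*} [MeasurableSpace E] {a t : ℝ} (ha : 0 ≤ a) (ha1 : a < 1)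
    (ht : 0 < t) (H : Measure E) [IsProbabilityMeasure H] {q : E → Prop} (hq : ∀ᵐ x ∂H, q x) :
    ∀ᵐ w ∂(jointLaw a t H), (∀ k, w.1 k ∈ Ioo (0 : ℝ) 1) ∧ ∀ k, q (w.2 k) := by
  have hp := isProbabilityMeasure_stickLaw ha ha1 ht
  have e1 := Measure.quasiMeasurePreserving_fst
    (μ := stickLaw a t) (ν := Measure.infinitePi fun _ : ℕ => H) |>.ae (ae_stickLaw ha ha1 ht)
  have e2 := Measure.quasiMeasurePreserving_snd
    (μ := stickLaw a t) (ν := Measure.infinitePi fun _ : ℕ => H) |>.ae (ae_infinitePi_const H hq)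
  filter_upwards [e1, e2] with w h1 h2 using ⟨h1, h2⟩

theorem stick_sum_le_one {E : Type*} [MeasurableSpace E] {a t : ℝ} (ha : 0 ≤ a) (ha1 : a < 1)
    (ht : 0 < t) (H : Measure E) [IsProbabilityMeasure H] {g : E → ℝ} (hg : Measurable g)
    (hg1 : ∀ᵐ x ∂H, g x ≤ 1) : ∀ᵐ w ∂(jointLaw a t H),
      ∫⁻ u, ENNReal.ofReal (g u) ∂(discreteMeasure w.1 w.2) ≤ 1 := by
  filter_upwards [ae_jointLaw ha ha1 ht H hg1] with w hw
  rw [lintegral_discreteMeasure _ _ hg.ennreal_ofReal]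
  refine le_trans (ENNReal.tsum_le_tsum fun k => ?_) (tsum_stickWeight_le hw.1)
  calc _ ≤ ENNReal.ofReal (stickWeight w.1 k) * 1 := by
        gcongr
        exact ENNReal.ofReal_le_one.2 (hw.2 k)
    _ = _ := mul_one _

theorem stickMeanLaw_mem_Icc {E : Type*} [MeasurableSpace E] {a t : ℝ} (ha : 0 ≤ a) (ha1 : a < 1)
    (ht : 0 < t) (H : Measure E) [IsProbabilityMeasure H] {g : E → ℝ} (hg : Measurable g)
    (hg1 : ∀ᵐ x ∂H, g x ≤ 1) : ∀ᵐ x ∂(stickMeanLaw a t H g), x ∈ Icc (0 : ℝ) 1 := by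
  rw [stickMeanLaw, ae_map_iff (measurable_stickMean hg).aemeasurable
    (p := fun x => x ∈ Icc (0 : ℝ) 1) measurableSet_Icc]
  filter_upwards [stick_sum_le_one ha ha1 ht H hg hg1] with w hw
  exact ⟨stickMean_nonneg g w, ENNReal.toReal_le_of_le_ofReal zero_le_one (by simpa using hw)⟩

/-- A Dirichlet mean is finite as soon as the shape has a finite moment of positive order. -/
theorem stick_sum_ne_top_of_moment {E : Type*} [MeasurableSpace E] {t b : ℝ} (ht : 0 < t)
    (hb : 0 < b) (hb1 : b ≤ 1) (H : Measure E) [IsProbabilityMeasure H] {g : E → ℝ}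
    (hg : Measurable g) (hg0 : ∀ᵐ x ∂H, 0 ≤ g x)
    (hmom : ∫⁻ x, ENNReal.ofReal (g x ^ b) ∂H ≠ ∞) : ∀ᵐ w ∂(jointLaw 0 t H),
      ∫⁻ u, ENNReal.ofReal (g u) ∂(discreteMeasure w.1 w.2) ≠ ∞ := by
  have hJ := isProbabilityMeasure_jointLaw le_rfl one_pos ht H
  have hJ' := isProbabilityMeasureBeta one_pos ht
  have hmeas : ∀ k, Measurable fun w : (ℕ → ℝ) × (ℕ → E) =>
      ENNReal.ofReal (stickWeight w.1 k ^ b) * ENNReal.ofReal (g (w.2 k) ^ b) := by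
    intro k
    have := measurable_stickWeight k
    fun_prop
  set c : ℕ → ℝ≥0∞ := fun k => ∫⁻ w, ENNReal.ofReal (stickWeight w.1 k ^ b) *
    ENNReal.ofReal (g (w.2 k) ^ b) ∂(jointLaw 0 t H) with hc
  have hc0 : c 0 ≤ ∫⁻ x, ENNReal.ofReal (g x ^ b) ∂H := by
    simp only [hc]
    rw [lintegral_jointLaw le_rfl one_pos ht H (hmeas 0)]
    have h1 : ∀ᵐ x ∂(betaMeasure (1 - 0) (t + 0)), ∫⁻ y, ∫⁻ w,
        ENNReal.ofReal (stickWeight (consSeq x w.1) 0 ^ b) *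
          ENNReal.ofReal (g (consSeq y w.2 0) ^ b) ∂(jointLaw 0 (t + 0) H) ∂H ≤
        ∫⁻ x, ENNReal.ofReal (g x ^ b) ∂H := by
      filter_upwards [ae_betaMeasure (1 - 0) (t + 0)] with x hx
      refine lintegral_mono fun y => ?_
      simp only [stickWeight_zero, consSeq, add_zero, lintegral_const, measure_univ, mul_one]
      calc _ ≤ 1 * ENNReal.ofReal (g y ^ b) := by
            gcongr
            exact ENNReal.ofReal_le_one.2 (Real.rpow_le_one hx.1.le hx.2.le hb.le)
        _ = _ := one_mul _
    refine (lintegral_mono_ae h1).trans ?_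
    simp
  -- One more break multiplies the `b`-th moment of a weight by `E (1 - v) ^ b = t / (t + b) < 1`,
  -- so the moments `c k` form a geometric sequence.
  have hcs : ∀ k, c (k + 1) = ENNReal.ofReal (t / (t + b)) * c k := by
    intro k
    simp only [hc]
    rw [lintegral_jointLaw le_rfl one_pos ht H (hmeas (k + 1))]
    have h1 : ∀ᵐ x ∂(betaMeasure (1 - 0) (t + 0)), ∫⁻ y, ∫⁻ w,
        ENNReal.ofReal (stickWeight (consSeq x w.1) (k + 1) ^ b) *
          ENNReal.ofReal (g (consSeq y w.2 (k + 1)) ^ b) ∂(jointLaw 0 (t + 0) H) ∂H =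
        ENNReal.ofReal ((1 - x) ^ b) * c k := by
      filter_upwards [ae_betaMeasure (1 - 0) (t + 0)] with x hx
      have hx1 : 0 ≤ 1 - x := by linarith [hx.2]
      simp only [consSeq, lintegral_const, measure_univ, mul_one, add_zero]
      rw [hc, ← lintegral_const_mul' _ _ ENNReal.ofReal_ne_top]
      refine lintegral_congr_ae ?_
      filter_upwards [ae_jointLaw le_rfl one_pos ht H hg0] with w hw
      rw [stickWeight_succ, Real.mul_rpow hx1 (stickWeight_nonneg hw.1 k),
        ENNReal.ofReal_mul (by positivity), mul_assoc]
    rw [lintegral_congr_ae h1, lintegral_mul_const _ (by fun_prop), sub_zero, add_zero,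
      lintegral_one_sub_rpow_beta_one ht hb.le]
  have hck : ∀ k, c k = ENNReal.ofReal (t / (t + b)) ^ k * c 0 := by
    intro k
    induction k with
    | zero => simp
    | succ k ih => rw [hcs, ih, pow_succ']; ring
  have htot : ∑' k, c k ≠ ∞ := by
    rw [tsum_congr hck, ENNReal.tsum_mul_right, ENNReal.tsum_geometric]
    refine ENNReal.mul_ne_top (ENNReal.inv_ne_top.2 ?_) (ne_top_of_le_ne_top hmom hc0)
    rw [Ne, tsub_eq_zero_iff_le, not_le, ENNReal.ofReal_lt_one, div_lt_one (by linarith)]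
    linarith
  rw [← lintegral_tsum fun k => (hmeas k).aemeasurable] at htot
  have hae := ae_lt_top (Measurable.tsum hmeas) htot
  filter_upwards [hae, ae_jointLaw le_rfl one_pos ht H hg0] with w h1 h2
  have hnn : ∀ k, 0 ≤ stickWeight w.1 k * g (w.2 k) := fun k =>
    mul_nonneg (stickWeight_nonneg h2.1 k) (h2.2 k)
  have hS : Summable fun k => (stickWeight w.1 k * g (w.2 k)) ^ b := by
    have := ENNReal.summable_toReal h1.ne
    refine this.congr fun k => ?_
    have e1 := stickWeight_nonneg h2.1 k
    have e2 := h2.2 k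
    rw [ENNReal.toReal_mul, ENNReal.toReal_ofReal (by positivity),
      ENNReal.toReal_ofReal (by positivity), Real.mul_rpow e1 e2]
  -- The `b`-th powers are summable, so the terms are eventually at most `1`; there each term is
  -- below its `b`-th power because `b ≤ 1`.
  have hS' : Summable fun k => stickWeight w.1 k * g (w.2 k) := by
    refine hS.of_norm_bounded_eventually_nat ?_
    have := hS.tendsto_atTop_zero.eventually (gt_mem_nhds one_pos)
    filter_upwards [this] with k hk
    rw [Real.norm_of_nonneg (hnn k)]
    have hle : stickWeight w.1 k * g (w.2 k) ≤ 1 := by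
      by_contra hcon
      have := Real.one_lt_rpow (not_le.1 hcon) hb
      linarith
    rcases (hnn k).eq_or_lt with h0 | h0
    · rw [← h0, Real.zero_rpow hb.ne']
    · calc _ = (stickWeight w.1 k * g (w.2 k)) ^ (1 : ℝ) := (Real.rpow_one _).symm
        _ ≤ _ := Real.rpow_le_rpow_of_exponent_ge h0 hle hb1
  rw [lintegral_discreteMeasure _ _ hg.ennreal_ofReal]
  have hfin := hS'.tsum_ofReal_ne_top
  refine ne_of_eq_of_ne (tsum_congr fun k => ?_) hfin
  rw [ENNReal.ofReal_mul (stickWeight_nonneg h2.1 k)]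

/-! ### The laws of Poisson-Dirichlet masses and of Dirichlet means -/

theorem pdSetLaw_eq {E : Type*} [MeasurableSpace E] (a t : ℝ) (ν : Measure E) {C : Set E}
    (hC : MeasurableSet C) : pdSetLaw a t ν C = stickMeanLaw a t ν (C.indicator 1) := by
  unfold pdSetLaw stickMeanLaw jointLaw
  congr 1
  funext w
  have : (fun x => ENNReal.ofReal (C.indicator (1 : E → ℝ) x)) = C.indicator 1 := by
    funext x
    by_cases hx : x ∈ C <;> simp [hx]
  rw [stickMean, this, lintegral_indicator_one hC, measureReal_def]

theorem dirichletMeanLaw_eq {t : ℝ} (ht : 0 < t) (H : Measure ℝ) [IsProbabilityMeasure H]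
    (hH : ∀ᵐ x ∂H, 0 ≤ x) : dirichletMeanLaw t H = stickMeanLaw 0 t H id := by
  unfold dirichletMeanLaw stickMeanLaw
  refine Measure.map_congr ?_
  change ∀ᵐ w ∂(jointLaw 0 t H), _
  filter_upwards [ae_jointLaw le_rfl one_pos ht H hH] with w hw
  rw [stickMean, integral_eq_lintegral_of_nonneg_ae]
  · rfl
  · rw [discreteMeasure]
    refine (Measure.ae_sum_iff' measurableSet_Ici).2 fun k => ?_
    refine Measure.ae_smul_measure ?_ _
    rw [ae_dirac_eq]
    exact hw.2 k
  · exact Measurable.aestronglyMeasurable (by fun_prop)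

/-- Turns the hypothesis on the mean mass of `C` into `ν.real C = p`, the form in which it enters
the transforms. -/
theorem integral_pdSetLaw {E : Type*} [MeasurableSpace E] {a t : ℝ} (ha : 0 ≤ a) (ha1 : a < 1)
    (ht : 0 < t) (ν : Measure E) [IsProbabilityMeasure ν] {C : Set E} (hC : MeasurableSet C) :
    ∫ x, x ∂(pdSetLaw a t ν C) = ν.real C := by
  have hg : Measurable (C.indicator (1 : E → ℝ)) := measurable_one.indicator hC
  have h1 : ∀ᵐ x ∂ν, C.indicator (1 : E → ℝ) x ≤ 1 :=
    Eventually.of_forall fun x => indicator_le_self' (fun _ _ => zero_le_one) x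
  rw [pdSetLaw_eq a t ν hC, stickMeanLaw, integral_map (measurable_stickMean hg).aemeasurable
    (by fun_prop)]
  unfold stickMean
  rw [integral_toReal (measurable_lintegral_discreteMeasure hg.ennreal_ofReal).aemeasurable,
    lintegral_stick_sum ha ha1 ht ν hg.ennreal_ofReal, measureReal_def]
  · congr 1
    rw [← lintegral_indicator_one hC]
    refine lintegral_congr fun x => ?_
    by_cases hx : x ∈ C <;> simp [hx]
  · filter_upwards [stick_sum_le_one ha ha1 ht ν hg h1] with w hw
    exact hw.trans_lt ENNReal.one_lt_top

theorem lintegral_indicator_stieltjes {E : Type*} [MeasurableSpace E] (ν : Measure E)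
    [IsProbabilityMeasure ν] {C : Set E} (hC : MeasurableSet C) {s : ℝ} (hs : 0 < s) (b : ℝ) :
    ∫⁻ x, ENNReal.ofReal ((1 + s * C.indicator (1 : E → ℝ) x) ^ b) ∂ν =
      ENNReal.ofReal (ν.real C * (1 + s) ^ b + (1 - ν.real C)) := by
  have h1 : ∀ x, ENNReal.ofReal ((1 + s * C.indicator (1 : E → ℝ) x) ^ b) =
      C.indicator (fun _ => ENNReal.ofReal ((1 + s) ^ b)) x + Cᶜ.indicator (fun _ => 1) x := by
    intro x
    by_cases hx : x ∈ C <;> simp [hx]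
  have h2 : ν.real C ≤ 1 := measureReal_le_one
  rw [lintegral_congr h1, lintegral_add_left (measurable_const.indicator hC),
    lintegral_indicator_const hC, lintegral_indicator_const hC.compl, one_mul,
    ENNReal.ofReal_add (by positivity) (by linarith), mul_comm (ν.real C),
    ENNReal.ofReal_mul (by positivity), ofReal_measureReal, ← probReal_compl_eq_one_sub hC,
    ofReal_measureReal]

/-- For the indicator of `C`, the stick-breaking factor is `p (1 + s) ^ (α - 1) + (1 - p)` with `p =
ν.real C`, so the masses for `t, t + α, …` satisfy the system solved by powers of `p (1 + s) ^ α +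
(1 - p)`. -/
theorem stieltjes_pdSetLaw {E : Type*} [MeasurableSpace E] {α t : ℝ} (h0 : 0 < α) (h1 : α < 1)
    (ht : 0 < t) (ν : Measure E) [IsProbabilityMeasure ν] {C : Set E} (hC : MeasurableSet C)
    {s : ℝ} (hs : 0 < s) : stieltjes (pdSetLaw α t ν C) t s =
      ENNReal.ofReal ((ν.real C * (1 + s) ^ α + (1 - ν.real C)) ^ (-(t / α))) := by
  have hg : Measurable (C.indicator (1 : E → ℝ)) := measurable_one.indicator hC
  have hg1 : ∀ᵐ x ∂ν, C.indicator (1 : E → ℝ) x ≤ 1 :=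
    Eventually.of_forall fun x => indicator_le_self' (fun _ _ => zero_le_one) x
  have hg0 : ∀ᵐ x ∂ν, 0 ≤ C.indicator (1 : E → ℝ) x :=
    Eventually.of_forall fun x => indicator_nonneg (fun _ _ => zero_le_one) x
  have hp := fun t (ht : 0 < t) => isProbabilityMeasure_stickMeanLaw h0.le h1 ht ν hg
  have hnn := fun t => ae_stickMeanLaw α t ν hg
  have hp1 : ν.real C ≤ 1 := measureReal_le_one
  rw [pdSetLaw_eq α t ν hC]
  have hpt := hp t ht
  rw [stieltjes_eq_ofReal (hnn t) hs.le ht.le]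
  congr 1
  refine stieltjes_eq_of_system h0 h1 measureReal_nonneg hp1 hp
    (fun t ht => stickMeanLaw_mem_Icc h0.le h1 ht ν hg hg1) ?_ ht hs
  intro t ht s hs
  have hta : 0 < t + α := by linarith
  have hpt := hp t ht
  have hpta := hp (t + α) hta
  have key := stieltjes_stickMeanLaw h0.le h1 ht ν hg hg0 ((stick_sum_le_one h0.le h1 hta ν hg
    hg1).mono fun w hw => (hw.trans_lt ENNReal.one_lt_top).ne) hs
  rw [stieltjes_eq_ofReal (hnn t) hs.le (by linarith), stieltjes_eq_ofReal (hnn _) hs.le hta.le,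
    lintegral_indicator_stieltjes ν hC hs] at key
  have hg' : 0 ≤ ν.real C * (1 + s) ^ (-(1 - α)) + (1 - ν.real C) :=
    add_nonneg (by positivity) (by linarith)
  have hnn' : ∀ t r : ℝ, 0 ≤ ∫ x, (1 + s * x) ^ r ∂(stickMeanLaw α t ν (C.indicator 1)) := by
    intro t r
    refine integral_nonneg_of_ae ?_
    filter_upwards [hnn t] with x hx
    rw [Pi.zero_apply]; positivity
  rw [← ENNReal.ofReal_mul hg', ENNReal.ofReal_eq_ofReal_iff (hnn' _ _)
    (mul_nonneg hg' (hnn' _ _)), neg_sub] at key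
  exact key

/-- For `a = 0` the recursion stays at the same `t`: the transform of order `t + 1` is `G` times
that of order `t`, and the derivative formula becomes the closed equation satisfied by `L`. -/
theorem stieltjes_dirichletMeanLaw {t : ℝ} (ht : 0 < t) (H : Measure ℝ) [IsProbabilityMeasure H]
    (hH : ∀ᵐ x ∂H, 0 ≤ x) (hfin : ∀ᵐ w ∂(jointLaw 0 t H),
      ∫⁻ u, ENNReal.ofReal u ∂(discreteMeasure w.1 w.2) ≠ ∞) {G L : ℝ → ℝ}
    (hG0 : ∀ s, 0 < s → 0 ≤ G s) (hG : ∀ s, 0 < s → stieltjes H 1 s = ENNReal.ofReal (G s))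
    (hL : ∀ s, 0 < s → HasDerivAt L (-(t / s) * (1 - G s) * L s) s)
    (hLpos : ∀ s, 0 < s → 0 < L s) (hL0 : Tendsto L (𝓝[>] 0) (𝓝 1)) {s : ℝ} (hs : 0 < s) :
    stieltjes (dirichletMeanLaw t H) t s = ENNReal.ofReal (L s) := by
  have hp := isProbabilityMeasure_stickMeanLaw le_rfl one_pos ht H measurable_id
  have hnn := ae_stickMeanLaw 0 t H measurable_id
  rw [dirichletMeanLaw_eq ht H hH, stieltjes_eq_ofReal hnn hs.le ht.le]
  congr 1
  refine stieltjes_eq_of_ode hnn ht ?_ hL hLpos hL0 hs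
  intro s hs
  have key := stieltjes_stickMeanLaw le_rfl one_pos ht H measurable_id hH
    (by rw [add_zero]; exact hfin) hs
  simp only [sub_zero, add_zero, id] at key
  rw [← stieltjes, hG s hs, stieltjes_eq_ofReal hnn hs.le (by linarith),
    stieltjes_eq_ofReal hnn hs.le ht.le] at key
  have hnn' : ∀ r : ℝ, 0 ≤ ∫ x, (1 + s * x) ^ r ∂(stickMeanLaw 0 t H id) := by
    intro r
    refine integral_nonneg_of_ae ?_
    filter_upwards [hnn] with x hx
    rw [Pi.zero_apply]; positivity
  rwa [← ENNReal.ofReal_mul (hG0 s hs), ENNReal.ofReal_eq_ofReal_iff (hnn' _)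
    (mul_nonneg (hG0 s hs) (hnn' _))] at key

theorem isProbabilityMeasure_dirichletMeanLaw {t : ℝ} (ht : 0 < t) (H : Measure ℝ)
    [IsProbabilityMeasure H] (hH : ∀ᵐ x ∂H, 0 ≤ x) :
    IsProbabilityMeasure (dirichletMeanLaw t H) := by
  rw [dirichletMeanLaw_eq ht H hH]
  exact isProbabilityMeasure_stickMeanLaw le_rfl one_pos ht H measurable_id

theorem ae_dirichletMeanLaw {t : ℝ} (ht : 0 < t) (H : Measure ℝ)
    [IsProbabilityMeasure H] (hH : ∀ᵐ x ∂H, 0 ≤ x) : ∀ᵐ x ∂(dirichletMeanLaw t H), 0 ≤ x := by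
  rw [dirichletMeanLaw_eq ht H hH]
  exact ae_stickMeanLaw 0 t H measurable_id

theorem isProbabilityMeasure_zeroMixture {r : ℝ} (h0 : 0 ≤ r) (h1 : r ≤ 1) (H : Measure ℝ)
    [IsProbabilityMeasure H] : IsProbabilityMeasure (zeroMixture r H) := by
  constructor
  simp only [zeroMixture, Measure.add_apply, Measure.smul_apply, measure_univ, smul_eq_mul, mul_one]
  rw [← ENNReal.ofReal_add h0 (by linarith)]
  simp

theorem ae_zeroMixture {r : ℝ} {H : Measure ℝ} {q : ℝ → Prop} (hq : ∀ᵐ x ∂H, q x) (hq0 : q 0) :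
    ∀ᵐ x ∂(zeroMixture r H), q x := by
  rw [zeroMixture, ae_add_measure_iff]
  refine ⟨Measure.ae_smul_measure hq _, Measure.ae_smul_measure ?_ _⟩
  rwa [ae_dirac_eq]

theorem lintegral_zeroMixture (r : ℝ) (H : Measure ℝ) (f : ℝ → ℝ≥0∞) :
    ∫⁻ x, f x ∂(zeroMixture r H) =
      ENNReal.ofReal r * ∫⁻ x, f x ∂H + ENNReal.ofReal (1 - r) * f 0 := by
  rw [zeroMixture, lintegral_add_measure, lintegral_smul_measure, lintegral_smul_measure,
    lintegral_dirac, smul_eq_mul, smul_eq_mul]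

theorem stieltjes_zeroMixture {r s g : ℝ} (h0 : 0 ≤ r) (h1 : r ≤ 1) (hg : 0 ≤ g) {H : Measure ℝ}
    (h : stieltjes H 1 s = ENNReal.ofReal g) :
    stieltjes (zeroMixture r H) 1 s = ENNReal.ofReal (r * g + (1 - r)) := by
  rw [stieltjes, lintegral_zeroMixture, ← stieltjes, h, ← ENNReal.ofReal_mul h0,
    ENNReal.ofReal_add (by positivity) (by linarith)]
  simp

/-- Multiplication by an independent `Beta(t, 1 - t)` variable. -/
theorem stieltjes_productLaw_beta {t : ℝ} (ht : 0 < t) (ht1 : t < 1) {μ : Measure ℝ}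
    [IsProbabilityMeasure μ] (hμ : ∀ᵐ x ∂μ, 0 ≤ x) {s : ℝ} (hs : 0 < s) :
    stieltjes (productLaw (betaMeasure t (1 - t)) μ) 1 s = stieltjes μ t s := by
  have hp := isProbabilityMeasureBeta ht (by linarith : 0 < 1 - t)
  rw [stieltjes, productLaw, lintegral_map (by fun_prop) (by fun_prop),
    lintegral_prod_symm _ (by fun_prop), stieltjes]
  refine lintegral_congr_ae ?_
  filter_upwards [hμ] with x hx
  -- Here `1 + s v x = v (1 + s x) + (1 - v)`, and the parameters `t` and `1 - t` sum to the order
  -- `1`.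
  have := lintegral_beta_mix ht (by linarith : 0 < 1 - t) (by positivity : 0 < 1 + s * x) one_pos
  rw [Real.one_rpow, mul_one] at this
  rw [← this]
  refine lintegral_congr fun v => ?_
  congr 2
  · ring
  · ring

theorem isProbabilityMeasure_productLaw (μ ν : Measure ℝ) [IsProbabilityMeasure μ]
    [IsProbabilityMeasure ν] : IsProbabilityMeasure (productLaw μ ν) :=
  Measure.isProbabilityMeasure_map (by fun_prop)

theorem ae_productLaw {μ ν : Measure ℝ} [IsProbabilityMeasure μ] [IsProbabilityMeasure ν]
    (hμ : ∀ᵐ x ∂μ, 0 ≤ x) (hν : ∀ᵐ x ∂ν, 0 ≤ x) : ∀ᵐ x ∂(productLaw μ ν), 0 ≤ x := by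
  rw [productLaw, ae_map_iff (by fun_prop) (p := fun x => 0 ≤ x) measurableSet_Ici]
  filter_upwards [(Measure.quasiMeasurePreserving_fst (μ := μ) (ν := ν)).ae hμ,
    (Measure.quasiMeasurePreserving_snd (μ := μ) (ν := ν)).ae hν] with w h1 h2
  exact mul_nonneg h1 h2

/-! ### The substitution `x = c y / (c y + 1)` and Lamperti's law -/

theorem map_withDensity_squash {c : ℝ} (hc : 0 < c) {d f : ℝ → ℝ≥0∞}
    (h : ∀ y, 0 < y → d y = ENNReal.ofReal (c / (c * y + 1) ^ 2) * f (c * y / (c * y + 1))) :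
    squash c ((volume.restrict (Ioi 0)).withDensity d) =
      (volume.restrict (Ioo 0 1)).withDensity f := by
  have hm : Measurable fun x : ℝ => c * x / (c * x + 1) := by fun_prop
  ext s hs
  rw [squash, Measure.map_apply hm hs, withDensity_apply _ (hm hs), withDensity_apply _ hs,
    ← lintegral_indicator hs, lintegral_Ioo_comp_squash _ hc, ← lintegral_indicator (hm hs)]
  refine setLIntegral_congr_fun measurableSet_Ioi fun y hy => ?_
  by_cases hys : c * y / (c * y + 1) ∈ s
  · rw [indicator_of_mem (by exact hys), indicator_of_mem hys, h y hy]
  · rw [indicator_of_notMem (by exact hys), indicator_of_notMem hys, mul_zero]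

theorem scale_pos {α p : ℝ} (hp0 : 0 < p) (hp1 : p < 1) : 0 < scale α p :=
  Real.rpow_pos_of_pos (div_pos hp0 (by linarith)) _

theorem scale_rpow {α p : ℝ} (h0 : 0 < α) (hp0 : 0 < p) (hp1 : p < 1) :
    scale α p ^ α = p / (1 - p) := by
  have : 0 < p / (1 - p) := div_pos hp0 (by linarith)
  rw [scale, ← Real.rpow_mul this.le, one_div_mul_cancel h0.ne', Real.rpow_one]

theorem denom_squash {α p y : ℝ} (h0 : 0 < α) (hp0 : 0 < p) (hp1 : p < 1) (hy : 0 < y) :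
    denom α p (scale α p * y / (scale α p * y + 1)) =
      p ^ 2 * ratioDenom α y * (scale α p * y + 1) ^ (-(2 * α)) := by
  have hc := scale_pos (α := α) hp0 hp1
  have hcα := scale_rpow h0 hp0 hp1
  set c := scale α p
  have hz : 0 < c * y + 1 := by positivity
  have hq : 0 < 1 - p := by linarith
  have h1 : 1 - c * y / (c * y + 1) = (c * y + 1)⁻¹ := by field_simp; ring
  have h2 : ∀ z : ℝ, 0 < z → z ^ (2 * α) = (z ^ α) ^ 2 := by
    intro z hz
    rw [mul_comm, Real.rpow_mul hz.le]; norm_cast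
  rw [denom, ratioDenom, h1, Real.rpow_neg hz.le, Real.inv_rpow hz.le, Real.inv_rpow hz.le,
    Real.div_rpow (by positivity) hz.le, Real.div_rpow (by positivity) hz.le,
    h2 _ hz, h2 (c * y) (by positivity), h2 y hy, Real.mul_rpow hc.le hy.le, hcα, mul_comm α]
  field_simp

theorem lampertiLaw_eq {α p : ℝ} (h0 : 0 < α) (h1 : α < 1) (hp0 : 0 < p) (hp1 : p < 1) :
    lampertiLaw α p = squash (scale α p) (ratioLaw α) := by
  have hc := scale_pos (α := α) hp0 hp1
  symm
  refine map_withDensity_squash hc fun y hy => ?_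
  · have hcα := scale_rpow h0 hp0 hp1
    rw [denom_squash h0 hp0 hp1 hy]
    have hD := ratioDenom_pos h0 h1 hy.le
    set c := scale α p
    have hz : 0 < c * y + 1 := by positivity
    have hq : 0 < 1 - p := by linarith
    have h2 : 1 - c * y / (c * y + 1) = (c * y + 1)⁻¹ := by field_simp; ring
    rw [← ENNReal.ofReal_mul (by positivity), ratioDensity, ← ratioDenom, h2]
    congr 1
    rw [Real.inv_rpow hz.le, Real.div_rpow (by positivity) hz.le, Real.mul_rpow hc.le hy.le,
      Real.rpow_sub_one hc.ne', hcα, Real.rpow_sub_one hz.ne', Real.rpow_neg hz.le, mul_comm α]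
    have h3 : (c * y + 1) ^ (2 * α) = ((c * y + 1) ^ α) ^ 2 := by
      rw [mul_comm 2 α, Real.rpow_mul hz.le]; norm_cast
    rw [h3]
    field_simp

/-- The argument of the angle in `sineFactor` is the inverse of the substitution `y ↦ c y / (c y +
1)`, so the angle is `angle α y`. The constants match because `c ^ α = p / (1 - p)`. -/
theorem occDensity_squash {α θ p : ℝ} (h0 : 0 < α) (h1 : α < 1)
    (hp0 : 0 < p) (hp1 : p < 1) {y : ℝ} (hy : 0 < y) :
    tiltedDensity α θ y = scale α p / (scale α p * y + 1) ^ 2 *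
      occDensity α θ p (scale α p * y / (scale α p * y + 1)) := by
  have hc := scale_pos (α := α) hp0 hp1
  have hcα := scale_rpow h0 hp0 hp1
  have hq : 0 < 1 - p := by linarith
  have hsc : scale α p = p ^ (1 / α) / (1 - p) ^ (1 / α) := by
    rw [scale, Real.div_rpow hp0.le hq.le]
  have hD := ratioDenom_pos h0 h1 hy.le
  have hsin : sineFactor α θ p (scale α p * y / (scale α p * y + 1)) =
      Real.sin (θ * angle α y) := by
    have hz : 0 < scale α p * y + 1 := by positivity
    have e1 : 1 - scale α p * y / (scale α p * y + 1) = 1 / (scale α p * y + 1) := by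
      field_simp; ring
    rw [sineFactor, e1]
    congr 3
    have e2 : (1 - p) ^ (1 / α) * (scale α p * y / (scale α p * y + 1)) /
        (p ^ (1 / α) * (1 / (scale α p * y + 1))) =
        (1 - p) ^ (1 / α) * scale α p * y / p ^ (1 / α) := by
      field_simp
    rw [e2, hsc]
    have : 0 < (1 - p) ^ (1 / α) := by positivity
    field_simp
  rw [occDensity, hsin, denom_squash h0 hp0 hp1 hy, tiltedDensity]
  set c := scale α p
  have hz : 0 < c * y + 1 := by positivity
  have h2 : 1 - c * y / (c * y + 1) = (c * y + 1)⁻¹ := by field_simp; ring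
  have e3 : c ^ (α * θ - 1) = p ^ θ / (1 - p) ^ θ / c := by
    rw [Real.rpow_sub_one hc.ne', Real.rpow_mul hc.le, hcα, Real.div_rpow hp0.le hq.le]
  have e4 : (p ^ 2 * ratioDenom α y * (c * y + 1) ^ (-(2 * α))) ^ (θ / 2) =
      p ^ θ * ratioDenom α y ^ (θ / 2) * ((c * y + 1) ^ (α * θ))⁻¹ := by
    rw [Real.mul_rpow (by positivity) (by positivity), Real.mul_rpow (by positivity) hD.le,
      ← Real.rpow_mul hz.le, ← Real.rpow_natCast, ← Real.rpow_mul hp0.le, ← Real.rpow_neg hz.le]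
    congr 3
    · push_cast; ring
    · ring
  rw [h2, e4, Real.div_rpow (by positivity) hz.le, Real.mul_rpow hc.le hy.le, e3,
    Real.rpow_sub_one hz.ne']
  field_simp

theorem measurable_occDensity (α θ p : ℝ) : Measurable (occDensity α θ p) := by
  unfold occDensity sineFactor denom
  have := measurable_angle α
  fun_prop

theorem squash_tiltedLaw {α θ p : ℝ} (h0 : 0 < α) (h1 : α < 1)
    (hp0 : 0 < p) (hp1 : p < 1) : squash (scale α p) (tiltedLaw α θ) =
      (volume.restrict (Ioo 0 1)).withDensity fun y => ENNReal.ofReal (occDensity α θ p y) := by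
  have hc := scale_pos (α := α) hp0 hp1
  refine map_withDensity_squash hc fun y hy => ?_
  rw [occDensity_squash h0 h1 hp0 hp1 hy, ENNReal.ofReal_mul (by positivity)]

/-- The Stieltjes transform of Lamperti's law. -/
noncomputable def lampertiTransform (α p s : ℝ) : ℝ :=
  (p * (1 + s) ^ (α - 1) + (1 - p)) / (p * (1 + s) ^ α + (1 - p))

theorem stieltjes_lampertiLaw {α p : ℝ} (h0 : 0 < α) (h1 : α < 1) (hp0 : 0 < p) (hp1 : p < 1)
    {s : ℝ} (hs : 0 < s) :
    stieltjes (lampertiLaw α p) 1 s = ENNReal.ofReal (lampertiTransform α p s) := by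
  have hc := scale_pos (α := α) hp0 hp1
  have hcα := scale_rpow h0 hp0 hp1
  have hq : 0 < 1 - p := by linarith
  have hpr := isProbabilityMeasure_ratioLaw h0 h1
  have hst := stieltjes_ratioLaw h0 h1 (s := (1 + s) * scale α p) (by positivity)
  rw [lampertiLaw_eq h0 h1 hp0 hp1, stieltjes, squash, lintegral_map (by fun_prop) (by fun_prop)]
  -- Partial fractions: with `c` the scale, the kernel becomes `(c x + 1) / (1 + (1 + s) c x)`, a
  -- constant plus a multiple of the Stieltjes kernel at `(1 + s) c`.
  have hcongr : ∀ᵐ x ∂(ratioLaw α), ENNReal.ofReal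
      ((1 + s * (scale α p * x / (scale α p * x + 1))) ^ (-1 : ℝ)) =
      ENNReal.ofReal (1 / (1 + s)) + ENNReal.ofReal (s / (1 + s)) *
        ENNReal.ofReal ((1 + (1 + s) * scale α p * x) ^ (-1 : ℝ)) := by
    filter_upwards [ae_ratioLaw h0 h1] with x hx
    rw [← ENNReal.ofReal_mul (by positivity), ← ENNReal.ofReal_add (by positivity) (by positivity),
      Real.rpow_neg_one, Real.rpow_neg_one]
    congr 1
    have e1 : 1 + s * (scale α p * x / (scale α p * x + 1)) =
        (1 + (1 + s) * scale α p * x) / (scale α p * x + 1) := by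
      field_simp; ring
    rw [e1]
    field_simp
    ring
  rw [lintegral_congr_ae hcongr, lintegral_add_left measurable_const, lintegral_const,
    measure_univ, mul_one, lintegral_const_mul' _ _ ENNReal.ofReal_ne_top, ← stieltjes, hst,
    ← ENNReal.ofReal_mul (by positivity), ← ENNReal.ofReal_add (by positivity) (by positivity)]
  congr 1
  have hs1 : 0 < 1 + s := by positivity
  rw [Real.mul_rpow hs1.le hc.le, hcα, lampertiTransform, Real.rpow_sub_one hs1.ne']
  field_simp
  ring

theorem lampertiTransform_nonneg {α p s : ℝ} (hp0 : 0 < p) (hp1 : p < 1) (hs : 0 < s) :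
    0 ≤ lampertiTransform α p s := by
  have hq : 0 < 1 - p := by linarith
  unfold lampertiTransform
  positivity

theorem isProbabilityMeasure_lampertiLaw {α p : ℝ} (h0 : 0 < α) (h1 : α < 1) (hp0 : 0 < p)
    (hp1 : p < 1) : IsProbabilityMeasure (lampertiLaw α p) := by
  have := isProbabilityMeasure_ratioLaw h0 h1
  rw [lampertiLaw_eq h0 h1 hp0 hp1]
  exact Measure.isProbabilityMeasure_map (by fun_prop)

theorem ae_lampertiLaw (α p : ℝ) : ∀ᵐ x ∂(lampertiLaw α p), x ∈ Ioo (0 : ℝ) 1 :=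
  (withDensity_absolutelyContinuous _ _).ae_le (ae_restrict_mem measurableSet_Ioo)

/-! ### Explicit Dirichlet means -/

/-- The denominator is at least both `sin² (π α)` and `sin² (π α) y ^ (2 α)`, by completing the
square in either variable of the quadratic form. The two bounds control the density near zero and
near infinity. -/
theorem ratioDensity_le {α y : ℝ} (h0 : 0 < α) (h1 : α < 1) (hy : 0 < y) :
    ratioDensity α y ≤ 1 / (Real.pi * Real.sin (Real.pi * α)) * y ^ (α - 1) ∧
    ratioDensity α y ≤ 1 / (Real.pi * Real.sin (Real.pi * α)) * y ^ (-α - 1) := by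
  have hs := sin_pi_mul_pos h0 h1
  have hD := ratioDenom_pos h0 h1 hy.le
  have hDe := ratioDenom_eq (α := α) hy.le
  have hp := Real.pi_pos
  have hsc := Real.sin_sq_add_cos_sq (Real.pi * α)
  set S := Real.sin (Real.pi * α)
  have hyα : 0 < y ^ α := by positivity
  rw [ratioDensity, ← ratioDenom]
  constructor
  · have h2 : S ^ 2 ≤ ratioDenom α y := by
      rw [hDe]; nlinarith [sq_nonneg (y ^ α + Real.cos (Real.pi * α))]
    calc _ ≤ S / Real.pi * y ^ (α - 1) / S ^ 2 := by gcongr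
      _ = _ := by field_simp
  · have h2 : S ^ 2 * (y ^ α) ^ 2 ≤ ratioDenom α y := by
      rw [hDe]
      nlinarith [sq_nonneg (1 + y ^ α * Real.cos (Real.pi * α))]
    have h3 : y ^ (α - 1) = y ^ (-α - 1) * (y ^ α) ^ 2 := by
      rw [← Real.rpow_natCast, ← Real.rpow_mul hy.le, ← Real.rpow_add hy]
      congr 1; push_cast; ring
    calc _ ≤ S / Real.pi * y ^ (α - 1) / (S ^ 2 * (y ^ α) ^ 2) := by gcongr
      _ = _ := by rw [h3]; field_simp

/-- The density decays only like `y ^ (-α - 1)`, so the mean of `X_α` is infinite. A moment of order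
less than `α` is enough for its Dirichlet means to be finite. -/
theorem ratioLaw_moment {α : ℝ} (h0 : 0 < α) (h1 : α < 1) :
    ∫⁻ x, ENNReal.ofReal (x ^ (α / 2)) ∂(ratioLaw α) ≠ ∞ := by
  have hs := sin_pi_mul_pos h0 h1
  have hp := Real.pi_pos
  set K := 1 / (Real.pi * Real.sin (Real.pi * α)) with hK
  have hK0 : 0 < K := by positivity
  have hm : Measurable (ratioDensity α) := by unfold ratioDensity; fun_prop
  rw [ratioLaw, lintegral_withDensity_eq_lintegral_mul _ hm.ennreal_ofReal (by fun_prop),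
    ← Ioc_union_Ioi_eq_Ioi (zero_le_one (α := ℝ)),
    lintegral_union measurableSet_Ioi (Ioc_disjoint_Ioi le_rfl)]
  refine ENNReal.add_ne_top.2 ⟨?_, ?_⟩
  · have hint : IntegrableOn (fun y : ℝ => K * y ^ (α - 1 + α / 2)) (Ioc 0 1) := by
      refine Integrable.const_mul ?_ K
      rw [← IntegrableOn, ← intervalIntegrable_iff_integrableOn_Ioc_of_le zero_le_one]
      exact intervalIntegral.intervalIntegrable_rpow' (by linarith)
    refine ne_top_of_le_ne_top hint.lintegral_lt_top.ne ?_
    refine setLIntegral_mono' measurableSet_Ioc fun y hy => ?_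
    rw [Pi.mul_apply, ← ENNReal.ofReal_mul' (Real.rpow_nonneg hy.1.le _)]
    refine ENNReal.ofReal_le_ofReal ?_
    rw [Real.rpow_add hy.1, ← mul_assoc]
    exact mul_le_mul_of_nonneg_right (ratioDensity_le h0 h1 hy.1).1 (Real.rpow_nonneg hy.1.le _)
  · have hint : IntegrableOn (fun y : ℝ => K * y ^ (-α - 1 + α / 2)) (Ioi 1) := by
      refine Integrable.const_mul ?_ K
      exact integrableOn_Ioi_rpow_of_lt (by linarith) one_pos
    refine ne_top_of_le_ne_top hint.lintegral_lt_top.ne ?_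
    refine setLIntegral_mono' measurableSet_Ioi fun y hy => ?_
    have hy0 : 0 < y := zero_lt_one.trans hy
    rw [Pi.mul_apply, ← ENNReal.ofReal_mul' (Real.rpow_nonneg hy0.le _)]
    refine ENNReal.ofReal_le_ofReal ?_
    rw [Real.rpow_add hy0, ← mul_assoc]
    exact mul_le_mul_of_nonneg_right (ratioDensity_le h0 h1 hy0).2 (Real.rpow_nonneg hy0.le _)

/-- With `t = 1` and `G = α θ / (1 + s ^ α) + 1 - α θ`, the quantity `-(1 - G) / s` is `-θ α s ^ (α
- 1) / (1 + s ^ α)`, the logarithmic derivative of `(1 + s ^ α) ^ (-θ)`. -/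
theorem dirichletMeanLaw_ratio {α θ : ℝ} (h0 : 0 < α) (h1 : α < 1) (hθ : 0 < θ)
    (hαθ : α * θ < 1) :
    dirichletMeanLaw 1 (zeroMixture (α * θ) (ratioLaw α)) = tiltedLaw α θ := by
  have hr : 0 < α * θ := by positivity
  have hp1 := isProbabilityMeasure_ratioLaw h0 h1
  have hp2 := isProbabilityMeasure_tiltedLaw h0 h1 hθ hαθ
  have hp3 := isProbabilityMeasure_zeroMixture hr.le hαθ.le (ratioLaw α)
  have hnn : ∀ᵐ x ∂(zeroMixture (α * θ) (ratioLaw α)), 0 ≤ x :=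
    ae_zeroMixture ((ae_ratioLaw h0 h1).mono fun x hx => hx.le) le_rfl
  have hp4 := isProbabilityMeasure_dirichletMeanLaw one_pos _ hnn
  have hfin := stick_sum_ne_top_of_moment (b := α / 2) one_pos (by positivity) (by linarith)
    (zeroMixture (α * θ) (ratioLaw α)) measurable_id hnn (by
      rw [lintegral_zeroMixture]
      refine ENNReal.add_ne_top.2 ⟨ENNReal.mul_ne_top ENNReal.ofReal_ne_top
        (ratioLaw_moment h0 h1), ENNReal.mul_ne_top ENNReal.ofReal_ne_top ENNReal.ofReal_ne_top⟩)
  refine eq_of_stieltjes_one (ae_dirichletMeanLaw one_pos _ hnn) (ae_tiltedLaw α θ) fun s hs => ?_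
  rw [stieltjes_tiltedLaw h0 h1 hθ hαθ hs]
  refine stieltjes_dirichletMeanLaw one_pos _ hnn hfin
    (G := fun s => α * θ * (1 / (1 + s ^ α)) + (1 - α * θ))
    (L := fun s => (1 + s ^ α) ^ (-θ)) ?_ ?_ ?_ ?_ (tendsto_one_add_rpow θ h0) hs
  · intro s hs
    have : 0 ≤ 1 - α * θ := by linarith
    positivity
  · intro s hs
    exact stieltjes_zeroMixture hr.le hαθ.le (by positivity) (stieltjes_ratioLaw h0 h1 hs)
  · intro s hs
    have hb : 0 < 1 + s ^ α := by positivity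
    have e1 : HasDerivAt (fun s : ℝ => 1 + s ^ α) (α * s ^ (α - 1)) s :=
      (Real.hasDerivAt_rpow_const (Or.inl hs.ne')).const_add 1
    convert! e1.rpow_const (p := -θ) (Or.inl hb.ne') using 1
    have e2 : (1 + s ^ α) ^ (-θ) = (1 + s ^ α) ^ (-θ - 1) * (1 + s ^ α) := by
      rw [← Real.rpow_add_one hb.ne']; congr 1; ring
    rw [e2]
    generalize (1 + s ^ α) ^ (-θ - 1) = W
    rw [Real.rpow_sub_one hs.ne']
    field_simp
    ring
  · intro s hs
    positivity

/-- The function `(p (1 + s) ^ α + q) ^ (-θ)`, where `q = 1 - p`. -/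
noncomputable def occTransform (α θ p s : ℝ) : ℝ := (p * (1 + s) ^ α + (1 - p)) ^ (-θ)

theorem occTransform_pos {α θ p s : ℝ} (hp0 : 0 < p) (hp1 : p < 1) (hs : 0 < s) :
    0 < occTransform α θ p s := by
  have hq : 0 < 1 - p := by linarith
  unfold occTransform
  positivity

/-- Rests on `1 - lampertiTransform α p s = p s (1 + s) ^ (α - 1) / (p (1 + s) ^ α + (1 - p))`. This
is the equation for shape Lamperti and `t = α θ`, and equally for its zero mixture with weight `α θ`
and `t = 1`. -/
theorem hasDerivAt_occTransform {α p s : ℝ} (θ : ℝ) (h0 : 0 < α) (hp0 : 0 < p) (hp1 : p < 1)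
    (hs : 0 < s) : HasDerivAt (occTransform α θ p)
      (-(α * θ / s) * (1 - lampertiTransform α p s) * occTransform α θ p s) s := by
  have hq : 0 < 1 - p := by linarith
  have hs1 : 0 < 1 + s := by linarith
  have hb : 0 < p * (1 + s) ^ α + (1 - p) := by positivity
  have e1 : HasDerivAt (fun s : ℝ => p * (1 + s) ^ α + (1 - p)) (p * (1 * α * (1 + s) ^ (α - 1)))
      s := by
    refine HasDerivAt.add_const _ (HasDerivAt.const_mul _ ?_)
    exact ((hasDerivAt_id s).const_add 1).rpow_const (Or.inl hs1.ne')
  convert! e1.rpow_const (p := -θ) (Or.inl hb.ne') using 1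
  have e2 : (p * (1 + s) ^ α + (1 - p)) ^ (-θ) = (p * (1 + s) ^ α + (1 - p)) ^ (-θ - 1) *
      (p * (1 + s) ^ α + (1 - p)) := by
    rw [← Real.rpow_add_one hb.ne']; congr 1; ring
  rw [occTransform, e2, lampertiTransform]
  generalize (p * (1 + s) ^ α + (1 - p)) ^ (-θ - 1) = W
  have e3 : (1 + s) ^ α = (1 + s) ^ (α - 1) * (1 + s) := by
    rw [← Real.rpow_add_one hs1.ne']; congr 1; ring
  have e4 : 1 - (p * (1 + s) ^ (α - 1) + (1 - p)) / (p * (1 + s) ^ α + (1 - p)) =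
      p * s * (1 + s) ^ (α - 1) / (p * (1 + s) ^ α + (1 - p)) := by
    rw [one_sub_div hb.ne', e3]
    ring_nf
  rw [e4]
  field_simp

theorem tendsto_occTransform (α θ p : ℝ) :
    Tendsto (occTransform α θ p) (𝓝[>] 0) (𝓝 1) := by
  have h : ContinuousAt (occTransform α θ p) 0 := by
    refine ContinuousAt.rpow_const ?_ (Or.inl (by simp))
    refine ContinuousAt.add (ContinuousAt.mul continuousAt_const ?_) continuousAt_const
    exact ContinuousAt.rpow_const (by fun_prop) (Or.inl (by norm_num))
  have h2 : occTransform α θ p 0 = 1 := by simp [occTransform]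
  have := h.tendsto
  rw [h2] at this
  exact this.mono_left nhdsWithin_le_nhds

theorem stieltjes_dirichletMeanLaw_lamperti {α θ p : ℝ} (h0 : 0 < α) (h1 : α < 1) (hθ : 0 < θ)
    (hp0 : 0 < p) (hp1 : p < 1) {s : ℝ} (hs : 0 < s) :
    stieltjes (dirichletMeanLaw (α * θ) (lampertiLaw α p)) (α * θ) s =
      ENNReal.ofReal (occTransform α θ p s) := by
  have hr : 0 < α * θ := by positivity
  have hp := isProbabilityMeasure_lampertiLaw h0 h1 hp0 hp1
  refine stieltjes_dirichletMeanLaw hr _ ((ae_lampertiLaw α p).mono fun x hx => hx.1.le)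
    ((stick_sum_le_one le_rfl one_pos hr _ measurable_id
      ((ae_lampertiLaw α p).mono fun x hx => hx.2.le)).mono
      fun w hw => (hw.trans_lt ENNReal.one_lt_top).ne)
    (fun s hs => lampertiTransform_nonneg hp0 hp1 hs)
    (fun s hs => stieltjes_lampertiLaw h0 h1 hp0 hp1 hs)
    (fun s hs => hasDerivAt_occTransform θ h0 hp0 hp1 hs)
    (fun s hs => occTransform_pos hp0 hp1 hs) (tendsto_occTransform α θ p) hs

theorem stieltjes_dirichletMeanLaw_mixture {α θ p : ℝ} (h0 : 0 < α) (h1 : α < 1) (hθ : 0 < θ)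
    (hαθ : α * θ < 1) (hp0 : 0 < p) (hp1 : p < 1) {s : ℝ} (hs : 0 < s) :
    stieltjes (dirichletMeanLaw 1 (zeroMixture (α * θ) (lampertiLaw α p))) 1 s =
      ENNReal.ofReal (occTransform α θ p s) := by
  have hr : 0 < α * θ := by positivity
  have hp := isProbabilityMeasure_lampertiLaw h0 h1 hp0 hp1
  have hp' := isProbabilityMeasure_zeroMixture hr.le hαθ.le (lampertiLaw α p)
  refine stieltjes_dirichletMeanLaw one_pos _
    (ae_zeroMixture ((ae_lampertiLaw α p).mono fun x hx => hx.1.le) le_rfl)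
    ((stick_sum_le_one le_rfl one_pos one_pos _ measurable_id
      (ae_zeroMixture ((ae_lampertiLaw α p).mono fun x hx => hx.2.le) zero_le_one)).mono
      fun w hw => (hw.trans_lt ENNReal.one_lt_top).ne)
    (G := fun s => α * θ * lampertiTransform α p s + (1 - α * θ)) ?_ ?_ ?_
    (fun s hs => occTransform_pos hp0 hp1 hs) (tendsto_occTransform α θ p) hs
  · intro s hs
    have := lampertiTransform_nonneg (α := α) hp0 hp1 hs
    have : 0 ≤ 1 - α * θ := by linarith
    positivity
  · intro s hs
    exact stieltjes_zeroMixture hr.le hαθ.le (lampertiTransform_nonneg hp0 hp1 hs)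
      (stieltjes_lampertiLaw h0 h1 hp0 hp1 hs)
  · intro s hs
    convert! hasDerivAt_occTransform θ h0 hp0 hp1 hs using 1
    ring

/-- The beta factor converts the transform of order `α θ` of one mean into a transform of order `1`,
where both sides are `occTransform α θ p`. -/
theorem productLaw_dirichletMeanLaw {α θ p : ℝ} (h0 : 0 < α) (h1 : α < 1) (hθ : 0 < θ)
    (hαθ : α * θ < 1) (hp0 : 0 < p) (hp1 : p < 1) :
    productLaw (betaMeasure (α * θ) (1 - α * θ)) (dirichletMeanLaw (α * θ) (lampertiLaw α p)) =
      dirichletMeanLaw 1 (zeroMixture (α * θ) (lampertiLaw α p)) := by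
  have hr : 0 < α * θ := by positivity
  have hp := isProbabilityMeasure_lampertiLaw h0 h1 hp0 hp1
  have hp' := isProbabilityMeasure_zeroMixture hr.le hαθ.le (lampertiLaw α p)
  have hnn : ∀ᵐ x ∂(lampertiLaw α p), 0 ≤ x := (ae_lampertiLaw α p).mono fun x hx => hx.1.le
  have hnn' : ∀ᵐ x ∂(zeroMixture (α * θ) (lampertiLaw α p)), 0 ≤ x := ae_zeroMixture hnn le_rfl
  have hb := isProbabilityMeasureBeta hr (by linarith : 0 < 1 - α * θ)
  have hd := isProbabilityMeasure_dirichletMeanLaw hr _ hnn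
  have hd' := isProbabilityMeasure_dirichletMeanLaw one_pos _ hnn'
  have hpl := isProbabilityMeasure_productLaw (betaMeasure (α * θ) (1 - α * θ))
    (dirichletMeanLaw (α * θ) (lampertiLaw α p))
  refine eq_of_stieltjes_one
    (ae_productLaw ((ae_betaMeasure _ _).mono fun x hx => hx.1.le) (ae_dirichletMeanLaw hr _ hnn))
    (ae_dirichletMeanLaw one_pos _ hnn') fun s hs => ?_
  rw [stieltjes_productLaw_beta hr hαθ (ae_dirichletMeanLaw hr _ hnn) hs,
    stieltjes_dirichletMeanLaw_lamperti h0 h1 hθ hp0 hp1 hs,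
    stieltjes_dirichletMeanLaw_mixture h0 h1 hθ hαθ hp0 hp1 hs]

theorem productLaw_pdSetLaw {E : Type*} [MeasurableSpace E] {α θ p : ℝ} (h0 : 0 < α) (h1 : α < 1)
    (hθ : 0 < θ) (hαθ : α * θ < 1) (hp0 : 0 < p) (hp1 : p < 1) (ν : Measure E)
    [IsProbabilityMeasure ν] {C : Set E} (hC : MeasurableSet C)
    (hν : ∫ x, x ∂(pdSetLaw α (α * θ) ν C) = p) :
    productLaw (betaMeasure (α * θ) (1 - α * θ)) (pdSetLaw α (α * θ) ν C) =
      productLaw (betaMeasure (α * θ) (1 - α * θ))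
        (dirichletMeanLaw (α * θ) (lampertiLaw α p)) := by
  have hr : 0 < α * θ := by positivity
  rw [integral_pdSetLaw h0.le h1 hr ν hC] at hν
  have hp := isProbabilityMeasure_lampertiLaw h0 h1 hp0 hp1
  have hnn : ∀ᵐ x ∂(lampertiLaw α p), 0 ≤ x := (ae_lampertiLaw α p).mono fun x hx => hx.1.le
  have hb := isProbabilityMeasureBeta hr (by linarith : 0 < 1 - α * θ)
  have hg : Measurable (C.indicator (1 : E → ℝ)) := measurable_one.indicator hC
  have hd := isProbabilityMeasure_dirichletMeanLaw hr _ hnn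
  have hnp : ∀ᵐ x ∂(pdSetLaw α (α * θ) ν C), 0 ≤ x := by
    rw [pdSetLaw_eq α _ ν hC]; exact ae_stickMeanLaw _ _ _ hg
  have hpd : IsProbabilityMeasure (pdSetLaw α (α * θ) ν C) := by
    rw [pdSetLaw_eq α _ ν hC]; exact isProbabilityMeasure_stickMeanLaw h0.le h1 hr ν hg
  have hpl := isProbabilityMeasure_productLaw (betaMeasure (α * θ) (1 - α * θ))
    (dirichletMeanLaw (α * θ) (lampertiLaw α p))
  have hpl' := isProbabilityMeasure_productLaw (betaMeasure (α * θ) (1 - α * θ))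
    (pdSetLaw α (α * θ) ν C)
  have hbn : ∀ᵐ x ∂(betaMeasure (α * θ) (1 - α * θ)), 0 ≤ x :=
    (ae_betaMeasure _ _).mono fun x hx => hx.1.le
  refine eq_of_stieltjes_one (ae_productLaw hbn hnp)
    (ae_productLaw hbn (ae_dirichletMeanLaw hr _ hnn)) fun s hs => ?_
  rw [stieltjes_productLaw_beta hr hαθ (ae_dirichletMeanLaw hr _ hnn) hs,
    stieltjes_dirichletMeanLaw_lamperti h0 h1 hθ hp0 hp1 hs,
    stieltjes_productLaw_beta hr hαθ hnp hs, stieltjes_pdSetLaw h0 h1 hr ν hC hs, hν,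
    mul_div_cancel_left₀ _ h0.ne', occTransform]

/-- Under `y = c x / (c x + 1)` the weight `1 - y` is `1 / (c x + 1)`, which cancels the numerator
of the transformed kernel. What remains is the transform of `tiltedLaw α θ` at `(1 + s) c`, that is
`(1 + (1 + s) ^ α p / q) ^ (-θ)`, and the factor `q ^ (-θ)` makes it `occTransform α θ p s`. -/
theorem dirichletMeanLaw_mixture_eq {α θ p : ℝ} (h0 : 0 < α) (h1 : α < 1) (hθ : 0 < θ)
    (hαθ : α * θ < 1) (hp0 : 0 < p) (hp1 : p < 1) :
    dirichletMeanLaw 1 (zeroMixture (α * θ) (lampertiLaw α p)) =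
      (volume.restrict (Ioo 0 1)).withDensity
        (fun y => ENNReal.ofReal ((1 - y) / (1 - p) ^ θ * occDensity α θ p y)) := by
  have hr : 0 < α * θ := by positivity
  have hq : 0 < 1 - p := by linarith
  have hqθ : 0 < (1 - p) ^ θ := Real.rpow_pos_of_pos hq θ
  have hc := scale_pos (α := α) hp0 hp1
  have hcα := scale_rpow h0 hp0 hp1
  have hp := isProbabilityMeasure_lampertiLaw h0 h1 hp0 hp1
  have hp' := isProbabilityMeasure_zeroMixture hr.le hαθ.le (lampertiLaw α p)
  have hnn' : ∀ᵐ x ∂(zeroMixture (α * θ) (lampertiLaw α p)), 0 ≤ x :=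
    ae_zeroMixture ((ae_lampertiLaw α p).mono fun x hx => hx.1.le) le_rfl
  have hd' := isProbabilityMeasure_dirichletMeanLaw one_pos _ hnn'
  set ρ : Measure ℝ := (volume.restrict (Ioo 0 1)).withDensity
    (fun y => ENNReal.ofReal ((1 - y) / (1 - p) ^ θ * occDensity α θ p y)) with hρ
  have hρnn : ∀ᵐ x ∂ρ, 0 ≤ x := by
    refine (withDensity_absolutelyContinuous _ _).ae_le ?_
    filter_upwards [ae_restrict_mem measurableSet_Ioo] with x hx using hx.1.le
  have hρs : ∀ s, 0 < s → stieltjes ρ 1 s = ENNReal.ofReal (occTransform α θ p s) := by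
    intro s hs
    have hm := measurable_occDensity α θ p
    have e1 : ρ = (squash (scale α p) (tiltedLaw α θ)).withDensity
        fun y => ENNReal.ofReal ((1 - y) / (1 - p) ^ θ) := by
      rw [squash_tiltedLaw h0 h1 hp0 hp1, ← withDensity_mul _ hm.ennreal_ofReal (by fun_prop), hρ]
      refine withDensity_congr_ae ?_
      filter_upwards [ae_restrict_mem measurableSet_Ioo] with y hy
      have : 0 ≤ 1 - y := by linarith [hy.2]
      rw [Pi.mul_apply, mul_comm, ENNReal.ofReal_mul' (div_nonneg this hqθ.le)]
    rw [stieltjes, e1, lintegral_withDensity_eq_lintegral_mul _ (by fun_prop) (by fun_prop), squash,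
      lintegral_map (by fun_prop) (by fun_prop)]
    have hcongr : ∀ᵐ x ∂(tiltedLaw α θ),
        ((fun y => ENNReal.ofReal ((1 - y) / (1 - p) ^ θ)) *
          fun x => ENNReal.ofReal ((1 + s * x) ^ (-1 : ℝ)))
          (scale α p * x / (scale α p * x + 1)) = ENNReal.ofReal (1 / (1 - p) ^ θ) *
          ENNReal.ofReal ((1 + (1 + s) * scale α p * x) ^ (-1 : ℝ)) := by
      filter_upwards [ae_tiltedLaw α θ] with x hx
      have hz : 0 < scale α p * x + 1 := by positivity
      have e2 : 1 - scale α p * x / (scale α p * x + 1) = 1 / (scale α p * x + 1) := by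
        field_simp; ring
      have e3 : 1 + s * (scale α p * x / (scale α p * x + 1)) =
          (1 + (1 + s) * scale α p * x) / (scale α p * x + 1) := by
        field_simp; ring
      rw [Pi.mul_apply, e2, e3, ← ENNReal.ofReal_mul (by positivity),
        ← ENNReal.ofReal_mul (by positivity), Real.rpow_neg_one, Real.rpow_neg_one]
      congr 1
      field_simp
    rw [lintegral_congr_ae hcongr, lintegral_const_mul' _ _ ENNReal.ofReal_ne_top, ← stieltjes,
      stieltjes_tiltedLaw h0 h1 hθ hαθ (mul_pos (by linarith) hc),
      ← ENNReal.ofReal_mul (by positivity)]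
    congr 1
    have hs1 : 0 < 1 + s := by linarith
    rw [Real.mul_rpow hs1.le hc.le, hcα, occTransform]
    have e4 : p * (1 + s) ^ α + (1 - p) = (1 + (1 + s) ^ α * (p / (1 - p))) * (1 - p) := by
      field_simp; ring
    rw [e4, Real.mul_rpow (by positivity) hq.le, Real.rpow_neg hq.le]
    ring
  have hρp : IsProbabilityMeasure ρ :=
    isProbabilityMeasure_of_stieltjes hρnn (tendsto_occTransform α θ p) hρs
  refine eq_of_stieltjes_one (ae_dirichletMeanLaw one_pos _ hnn') hρnn fun s hs => ?_
  rw [hρs s hs, stieltjes_dirichletMeanLaw_mixture h0 h1 hθ hαθ hp0 hp1 hs]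

theorem tilted_occDensity {α θ p : ℝ} (hp1 : p < 1) {y : ℝ}
    (hy : y ∈ Ioo (0 : ℝ) 1) : (1 - y) / (1 - p) ^ θ * occDensity α θ p y =
      1 / Real.pi * (y ^ (α * θ - 1) * sineFactor α θ p y) / denom α p y ^ (θ / 2) := by
  have hq : 0 < 1 - p := by linarith
  have hy1 : 0 < 1 - y := by linarith [hy.2]
  have : 0 < (1 - p) ^ θ := by positivity
  rw [occDensity]
  field_simp

theorem skewnessLaw_eq {θ p : ℝ} (hθ : 0 < θ) (hθ1 : θ < 1) (hp0 : 0 < p) (hp1 : p < 1) :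
    skewnessLaw θ p = ((gammaMeasure θ 1).prod (gammaMeasure (1 - θ) 1)).map
      (fun g => p * g.1 / (g.1 + g.2 * (1 - p))) := by
  have hθ' : 0 < 1 - θ := by linarith
  have hg1 := isProbabilityMeasure_gammaMeasure hθ one_pos
  have hg2 := isProbabilityMeasure_gammaMeasure hθ' one_pos
  have hpos : ∀ a : ℝ, ∀ᵐ x ∂(gammaMeasure a 1), 0 < x := by
    intro a
    rw [ae_iff]
    have := lintegral_gammaMeasure ((Ioi (0 : ℝ))ᶜ.indicator 1) a
    rw [lintegral_indicator_one measurableSet_Ioi.compl] at this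
    change gammaMeasure a 1 ((Ioi (0 : ℝ))ᶜ) = 0
    rw [this]
    refine setLIntegral_eq_zero measurableSet_Ioi fun v hv => ?_
    have hv' : 0 < v := hv
    simp [hv']
  rw [skewnessLaw, ← map_gamma_ratio hθ hθ', Measure.map_map (by fun_prop) (by fun_prop)]
  refine Measure.map_congr ?_
  filter_upwards [(Measure.quasiMeasurePreserving_fst (μ := gammaMeasure θ 1)
    (ν := gammaMeasure (1 - θ) 1)).ae (hpos θ), (Measure.quasiMeasurePreserving_snd
    (μ := gammaMeasure θ 1) (ν := gammaMeasure (1 - θ) 1)).ae (hpos (1 - θ))] with g h1 h2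
  have hq : 0 < 1 - p := by linarith
  simp only [Function.comp]
  have e1 : 1 - p + p * (g.1 / (g.1 + g.2)) = (g.1 + g.2 * (1 - p)) / (g.1 + g.2) := by
    field_simp; ring
  rw [e1]
  field_simp

/-! ### Transition densities of Bessel processes -/

theorem lintegral_Ioi_comp_inv (f : ℝ → ℝ≥0∞) :
    ∫⁻ y in Ioi 0, f y = ∫⁻ y in Ioi 0, ENNReal.ofReal (y ^ (-2 : ℝ)) * f y⁻¹ := by
  rw [lintegral_Ioi_comp_exp, lintegral_Ioi_comp_exp,
    ← lintegral_neg_eq_self (fun x => ENNReal.ofReal (Real.exp x) * f (Real.exp x))]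
  refine lintegral_congr fun x => ?_
  rw [← mul_assoc, ← ENNReal.ofReal_mul (Real.exp_pos x).le, ← Real.exp_mul, ← Real.exp_add,
    ← Real.exp_neg]
  ring_nf

theorem lintegral_rpow_mul_exp_sq {a b : ℝ} (ha : -1 < a) (hb : 0 < b) :
    ∫⁻ y in Ioi 0, ENNReal.ofReal (y ^ a * Real.exp (-b * y ^ 2)) =
      ENNReal.ofReal (b ^ (-(a + 1) / 2) * (1 / 2) * Real.Gamma ((a + 1) / 2)) := by
  rw [← integral_rpow_mul_exp_neg_mul_rpow two_pos ha hb]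
  simp only [Real.rpow_two]
  rw [ofReal_integral_eq_lintegral_ofReal (integrableOn_rpow_mul_exp_neg_mul_sq hb ha)]
  filter_upwards [ae_restrict_mem measurableSet_Ioi] with y hy
  have : (0 : ℝ) < y := hy
  simp only [Pi.zero_apply]
  positivity

theorem hittingDensity_nonneg {α x s : ℝ} (h0 : 0 < α) (hx : 0 ≤ x) (hs : 0 ≤ s) :
    0 ≤ hittingDensity α x s := by
  have := Real.Gamma_pos_of_pos h0
  unfold hittingDensity
  positivity

/-- The inversion `s ↦ 1 / s` turns this into a gamma integral: the first zero is `x ^ 2 / 2`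
divided by a `Gamma(α)` variable. -/
theorem lintegral_hittingDensity {α x : ℝ} (h0 : 0 < α) (hx : 0 < x) :
    ∫⁻ s in Ioi 0, ENNReal.ofReal (hittingDensity α x s) = 1 := by
  have hΓ := Real.Gamma_pos_of_pos h0
  rw [lintegral_Ioi_comp_inv]
  have hc : ∀ᵐ s ∂(volume.restrict (Ioi (0 : ℝ))),
      ENNReal.ofReal (s ^ (-2 : ℝ)) * ENNReal.ofReal (hittingDensity α x s⁻¹) =
      ENNReal.ofReal (x ^ (2 * α) / (2 ^ α * Real.Gamma α)) *
        ENNReal.ofReal (s ^ (α - 1) * Real.exp (-(x ^ 2 / 2 * s))) := by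
    filter_upwards [ae_restrict_mem measurableSet_Ioi] with s hs
    have hs : (0 : ℝ) < s := hs
    rw [← ENNReal.ofReal_mul (by positivity), ← ENNReal.ofReal_mul (by positivity), hittingDensity]
    congr 1
    have e1 : s ^ (α - 1) = s ^ (-2 : ℝ) * s⁻¹ ^ (-α - 1) := by
      rw [Real.inv_rpow hs.le, ← Real.rpow_neg hs.le, ← Real.rpow_add hs]; ring_nf
    have e2 : -x ^ 2 / (2 * s⁻¹) = -(x ^ 2 / 2 * s) := by field_simp
    rw [e1, e2]; ring
  rw [lintegral_congr_ae hc, lintegral_const_mul' _ _ ENNReal.ofReal_ne_top,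
    lintegral_rpow_mul_exp h0 (by positivity), ← ENNReal.ofReal_mul (by positivity),
    ← ENNReal.ofReal_one]
  congr 1
  rw [Real.div_rpow (by positivity) (by positivity), ← Real.rpow_natCast, ← Real.rpow_mul hx.le,
    Real.rpow_neg two_pos.le, Nat.cast_ofNat, mul_neg, Real.rpow_neg hx.le]
  field_simp

/-- The `k`-th term of the series of the killed transition density. -/
noncomputable def killedTerm (α t x y : ℝ) (k : ℕ) : ℝ :=
  y / t * (x / y) ^ α * Real.exp (-(x ^ 2 + y ^ 2) / (2 * t)) *
    ((x * y / t / 2) ^ (2 * (k : ℝ) + α) / ((k.factorial : ℝ) * Real.Gamma ((k : ℝ) + α + 1)))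

theorem Gamma_add_one_le {α : ℝ} (h0 : 0 < α) (k : ℕ) :
    Real.Gamma (α + 1) ≤ Real.Gamma ((k : ℝ) + α + 1) := by
  induction k with
  | zero => simp
  | succ k ih =>
    refine ih.trans ?_
    push_cast
    have h := Real.Gamma_add_one (s := (k : ℝ) + α + 1) (by positivity)
    have h2 := Real.Gamma_pos_of_pos (s := (k : ℝ) + α + 1) (by positivity)
    have e : (k : ℝ) + 1 + α + 1 = (k : ℝ) + α + 1 + 1 := by ring
    rw [e, h]
    nlinarith [(Nat.cast_nonneg k : (0 : ℝ) ≤ k)]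

theorem summable_besselI {α z : ℝ} (h0 : 0 < α) (hz : 0 < z) :
    Summable fun k : ℕ => (z / 2) ^ (2 * (k : ℝ) + α) /
      ((k.factorial : ℝ) * Real.Gamma ((k : ℝ) + α + 1)) := by
  have hΓ := Real.Gamma_pos_of_pos (by linarith : 0 < α + 1)
  refine Summable.of_nonneg_of_le (fun k => ?_) (fun k => ?_)
    ((Real.summable_pow_div_factorial ((z / 2) ^ 2)).mul_left
      ((z / 2) ^ α / Real.Gamma (α + 1)))
  · have := Real.Gamma_pos_of_pos (s := (k : ℝ) + α + 1) (by positivity)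
    positivity
  · have h := Gamma_add_one_le h0 k
    rw [Real.rpow_add (by positivity), Real.rpow_mul (by positivity), Real.rpow_natCast,
      Real.rpow_two, mul_comm (((z / 2) ^ 2) ^ k), div_mul_div_comm,
      mul_comm (k.factorial : ℝ)]
    gcongr

theorem ofReal_killedDensity {α t x y : ℝ} (h0 : 0 < α) (ht : 0 < t) (hx : 0 < x) (hy : 0 < y) :
    ENNReal.ofReal (killedDensity α t x y) = ∑' k, ENNReal.ofReal (killedTerm α t x y k) := by
  rw [killedDensity, besselI, ← tsum_mul_left]
  refine ENNReal.ofReal_tsum_of_nonneg (fun k => ?_)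
    ((summable_besselI h0 (by positivity)).mul_left _)
  have := Real.Gamma_pos_of_pos (s := (k : ℝ) + α + 1) (by positivity)
  positivity

/-- Each term of the Bessel series is a power of `y` times a Gaussian, and so is the hitting
density. The Gaussian moment produces exactly the gamma factor in the denominator of the `k`-th
term. -/
theorem lintegral_killedTerm_mul_hittingDensity {α t x s : ℝ} (h0 : 0 < α) (ht : 0 < t)
    (hx : 0 < x) (hs : 0 < s) (k : ℕ) :
    ∫⁻ y in Ioi 0, ENNReal.ofReal (killedTerm α t x y k) *
        ENNReal.ofReal (hittingDensity α y s) =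
      ENNReal.ofReal (x ^ (2 * α) / (2 ^ α * Real.Gamma α) * (t + s) ^ (-α - 1) *
        Real.exp (-x ^ 2 / (2 * t)) *
        ((x ^ 2 * s / (2 * t * (t + s))) ^ k / (k.factorial : ℝ))) := by
  have hΓ := Real.Gamma_pos_of_pos h0
  have hΓk := Real.Gamma_pos_of_pos (s := (k : ℝ) + α + 1) (by positivity)
  set G := Real.Gamma ((k : ℝ) + α + 1) with hG
  set β := (t + s) / (2 * t * s) with hβ
  have hβ0 : 0 < β := by positivity
  have hc : ∀ᵐ y ∂(volume.restrict (Ioi (0 : ℝ))),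
      ENNReal.ofReal (killedTerm α t x y k) * ENNReal.ofReal (hittingDensity α y s) =
      ENNReal.ofReal (1 / t * x ^ α * Real.exp (-x ^ 2 / (2 * t)) *
        ((x / (2 * t)) ^ (2 * (k : ℝ) + α) / ((k.factorial : ℝ) * G)) *
        (1 / (2 ^ α * Real.Gamma α) * s ^ (-α - 1))) *
        ENNReal.ofReal (y ^ (2 * (k : ℝ) + 1 + 2 * α) * Real.exp (-β * y ^ 2)) := by
    filter_upwards [ae_restrict_mem measurableSet_Ioi] with y hy
    have hy : (0 : ℝ) < y := hy
    rw [killedTerm, ← hG, ← ENNReal.ofReal_mul (by positivity),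
      ← ENNReal.ofReal_mul (by positivity), hittingDensity]
    congr 1
    have e1 : Real.exp (-(x ^ 2 + y ^ 2) / (2 * t)) * Real.exp (-y ^ 2 / (2 * s)) =
        Real.exp (-x ^ 2 / (2 * t)) * Real.exp (-β * y ^ 2) := by
      rw [← Real.exp_add, ← Real.exp_add]; congr 1; rw [hβ]; field_simp; ring
    have e2 : y * y ^ (2 * (k : ℝ) + α) * y ^ (2 * α) =
        y ^ (2 * (k : ℝ) + 1 + 2 * α) * y ^ α := by
      nth_rewrite 1 [← Real.rpow_one y]
      rw [← Real.rpow_add hy, ← Real.rpow_add hy, ← Real.rpow_add hy]; congr 1; ring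
    have e3 : (x * y / t / 2) ^ (2 * (k : ℝ) + α) =
        (x / (2 * t)) ^ (2 * (k : ℝ) + α) * y ^ (2 * (k : ℝ) + α) := by
      rw [← Real.mul_rpow (by positivity) hy.le]; congr 1; field_simp
    rw [e3, Real.div_rpow hx.le hy.le]
    have hyα : 0 < y ^ α := by positivity
    calc _ = 1 / t * x ^ α * ((x / (2 * t)) ^ (2 * (k : ℝ) + α) / ((k.factorial : ℝ) * G)) *
        (1 / (2 ^ α * Real.Gamma α) * s ^ (-α - 1)) *
        (y * y ^ (2 * (k : ℝ) + α) * y ^ (2 * α) / y ^ α) *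
        (Real.exp (-(x ^ 2 + y ^ 2) / (2 * t)) * Real.exp (-y ^ 2 / (2 * s))) := by ring
      _ = _ := by
        rw [e1, e2, mul_div_cancel_right₀ _ hyα.ne']; ring
  rw [lintegral_congr_ae hc, lintegral_const_mul' _ _ ENNReal.ofReal_ne_top,
    lintegral_rpow_mul_exp_sq (by linarith [(by positivity : 0 < 2 * (k : ℝ) + 1 + 2 * α)]) hβ0,
    ← ENNReal.ofReal_mul (by positivity)]
  congr 1
  have e4 : (2 * (k : ℝ) + 1 + 2 * α + 1) / 2 = (k : ℝ) + α + 1 := by ring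
  have e5 : -(2 * (k : ℝ) + 1 + 2 * α + 1) / 2 = -(k : ℝ) + (-α - 1) := by ring
  have e6 : (x / (2 * t)) ^ (2 * (k : ℝ) + α) =
      ((x / (2 * t)) ^ 2) ^ k * (x / (2 * t)) ^ α := by
    rw [Real.rpow_add (by positivity), Real.rpow_mul (by positivity), Real.rpow_natCast,
      Real.rpow_two]
  have e7 : β ^ (-(k : ℝ) + (-α - 1)) = (β⁻¹) ^ k * β ^ (-α - 1) := by
    rw [Real.rpow_add hβ0, Real.rpow_neg hβ0.le, Real.rpow_natCast, inv_pow]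
  have e8 : (x / (2 * t)) ^ 2 * β⁻¹ = x ^ 2 * s / (2 * t * (t + s)) := by
    rw [hβ]; field_simp
  have e9 : 1 / t * x ^ α * (x / (2 * t)) ^ α * s ^ (-α - 1) * β ^ (-α - 1) * (1 / 2) =
      x ^ (2 * α) * (t + s) ^ (-α - 1) := by
    have h1 : β * s * (2 * t) = t + s := by rw [hβ]; field_simp
    have h2 : (2 * t) ^ (-α - 1) * (2 * t) ^ α = 1 / (2 * t) := by
      rw [← Real.rpow_add (by positivity)]
      rw [show -α - 1 + α = -1 by ring, Real.rpow_neg_one, one_div]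
    have h3 : 0 < (2 * t) ^ α := by positivity
    rw [← h1, Real.mul_rpow (by positivity) (by positivity), Real.mul_rpow hβ0.le hs.le,
      Real.div_rpow hx.le (by positivity), (eq_div_iff h3.ne').2 h2, two_mul α, Real.rpow_add hx]
    field_simp
  rw [e4, e5, ← hG, e6, e7, ← e8, mul_pow]
  calc _ = (1 / t * x ^ α * (x / (2 * t)) ^ α * s ^ (-α - 1) * β ^ (-α - 1) * (1 / 2)) *
      (Real.exp (-x ^ 2 / (2 * t)) * (((x / (2 * t)) ^ 2) ^ k * β⁻¹ ^ k / k.factorial) *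
        (1 / (2 ^ α * Real.Gamma α))) * (G / G) := by ring
    _ = _ := by rw [e9, div_self hΓk.ne']; ring

/-- Markov property of the hitting time: not yet absorbed at time `t`, then absorbed `s` later. The
series sums to `exp (x ^ 2 s / (2 t (t + s)))`, which changes the exponent `-x ^ 2 / (2 t)` into `-x
^ 2 / (2 (t + s))`. -/
theorem lintegral_killedDensity_mul_hittingDensity {α t x s : ℝ} (h0 : 0 < α) (ht : 0 < t)
    (hx : 0 < x) (hs : 0 < s) :
    ∫⁻ y in Ioi 0, (∑' k, ENNReal.ofReal (killedTerm α t x y k)) *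
        ENNReal.ofReal (hittingDensity α y s) =
      ENNReal.ofReal (hittingDensity α x (t + s)) := by
  have hΓ := Real.Gamma_pos_of_pos h0
  simp_rw [← ENNReal.tsum_mul_right]
  rw [lintegral_tsum fun k => by unfold killedTerm hittingDensity; fun_prop]
  simp_rw [lintegral_killedTerm_mul_hittingDensity h0 ht hx hs]
  have hz : (0 : ℝ) ≤ x ^ 2 * s / (2 * t * (t + s)) := by positivity
  rw [← ENNReal.ofReal_tsum_of_nonneg (fun k => by positivity)
    ((Real.summable_pow_div_factorial _).mul_left _), tsum_mul_left,
    ← congrFun NormedSpace.exp_eq_tsum_div, ← Real.exp_eq_exp_ℝ, hittingDensity]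
  congr 1
  rw [mul_assoc, ← Real.exp_add]
  congr 2
  field_simp
  ring

/-- The generalized arcsine density: starting from the origin, the wait `s` after time `t` until the
next zero. The powers of `y` combine to `y`, so only an elementary Gaussian integral is left. -/
theorem lintegral_entranceDensity_mul_hittingDensity {α t s : ℝ} (h0 : 0 < α) (h1 : α < 1)
    (ht : 0 < t) (hs : 0 < s) :
    ∫⁻ y in Ioi 0, ENNReal.ofReal (entranceDensity α t y) *
        ENNReal.ofReal (hittingDensity α y s) =
      ENNReal.ofReal (Real.sin (Real.pi * α) / Real.pi * (s ^ (-α) * t ^ α / (s + t))) := by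
  have hΓ := Real.Gamma_pos_of_pos h0
  have hΓ' := Real.Gamma_pos_of_pos (by linarith : 0 < 1 - α)
  set β := (t + s) / (2 * t * s) with hβ
  have hβ0 : 0 < β := by positivity
  have hc : ∀ᵐ y ∂(volume.restrict (Ioi (0 : ℝ))),
      ENNReal.ofReal (entranceDensity α t y) * ENNReal.ofReal (hittingDensity α y s) =
      ENNReal.ofReal (2 / ((2 * t) ^ (1 - α) * Real.Gamma (1 - α)) *
        (1 / (2 ^ α * Real.Gamma α) * s ^ (-α - 1))) *
        ENNReal.ofReal (y ^ (1 : ℝ) * Real.exp (-β * y ^ 2)) := by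
    filter_upwards [ae_restrict_mem measurableSet_Ioi] with y hy
    have hy : (0 : ℝ) < y := hy
    rw [entranceDensity, ← ENNReal.ofReal_mul (by positivity),
      ← ENNReal.ofReal_mul (by positivity), hittingDensity]
    congr 1
    have e1 : Real.exp (-y ^ 2 / (2 * t)) * Real.exp (-y ^ 2 / (2 * s)) =
        Real.exp (-β * y ^ 2) := by
      rw [← Real.exp_add]; congr 1; rw [hβ]; field_simp; ring
    have e2 : y ^ (1 - 2 * α) * y ^ (2 * α) = y ^ (1 : ℝ) := by
      rw [← Real.rpow_add hy]; congr 1; ring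
    rw [← e1, ← e2]; ring
  rw [lintegral_congr_ae hc, lintegral_const_mul' _ _ ENNReal.ofReal_ne_top,
    lintegral_rpow_mul_exp_sq (by norm_num) hβ0, ← ENNReal.ofReal_mul (by positivity)]
  congr 1
  have hsin : Real.sin (Real.pi * α) / Real.pi = 1 / (Real.Gamma α * Real.Gamma (1 - α)) := by
    rw [Real.Gamma_mul_Gamma_one_sub, one_div_div]
  have e3 : -((1 : ℝ) + 1) / 2 = -1 := by norm_num
  have e4 : ((1 : ℝ) + 1) / 2 = 1 := by norm_num
  rw [hsin, e3, e4, Real.Gamma_one, Real.rpow_neg_one, hβ, Real.mul_rpow two_pos.le ht.le,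
    Real.rpow_sub two_pos, Real.rpow_sub ht, Real.rpow_sub hs, Real.rpow_one, Real.rpow_one,
    Real.rpow_one]
  field_simp
  ring

/-! ### Laplace transforms of occupation times -/

theorem lintegral_Ioi_comp_add (f : ℝ → ℝ≥0∞) (s : ℝ) :
    ∫⁻ x in Ioi s, f x = ∫⁻ x in Ioi 0, f (s + x) := by
  rw [← lintegral_indicator measurableSet_Ioi, ← lintegral_indicator measurableSet_Ioi,
    ← lintegral_add_left_eq_self _ s]
  refine lintegral_congr fun x => ?_
  by_cases hx : 0 < x
  · rw [indicator_of_mem (by simpa using hx), indicator_of_mem (by simpa using hx)]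
  · rw [indicator_of_notMem (by simpa using hx), indicator_of_notMem (by simpa using hx)]

theorem lintegral_exp_neg_mul {b : ℝ} (hb : 0 < b) :
    ∫⁻ x in Ioi 0, ENNReal.ofReal (Real.exp (-(b * x))) = ENNReal.ofReal (1 / b) := by
  have h := lintegral_rpow_mul_exp one_pos hb
  simpa [Real.rpow_neg_one] using h

/-- The exponential law with mean `1`. -/
noncomputable def expLaw : Measure ℝ :=
  (volume.restrict (Ioi 0)).withDensity fun x => ENNReal.ofReal (Real.exp (-x))

theorem lintegral_expLaw (f : ℝ → ℝ≥0∞) :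
    ∫⁻ x, f x ∂expLaw = ∫⁻ x in Ioi 0, ENNReal.ofReal (Real.exp (-x)) * f x := by
  rw [expLaw, lintegral_withDensity_eq_lintegral_mul_non_measurable _ (by fun_prop)
    (ae_of_all _ fun _ => ENNReal.ofReal_lt_top)]
  rfl

theorem ae_expLaw : ∀ᵐ x ∂expLaw, 0 < x :=
  (withDensity_absolutelyContinuous _ _).ae_le (ae_restrict_mem measurableSet_Ioi)

instance isProbabilityMeasure_expLaw : IsProbabilityMeasure expLaw := by
  constructor
  rw [← lintegral_one, lintegral_expLaw]
  simpa using lintegral_exp_neg_mul one_pos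

theorem lintegral_exp_expLaw {b : ℝ} (hb : 0 ≤ b) :
    ∫⁻ x, ENNReal.ofReal (Real.exp (-(b * x))) ∂expLaw = ENNReal.ofReal (1 / (1 + b)) := by
  rw [lintegral_expLaw, ← lintegral_exp_neg_mul (by linarith)]
  refine lintegral_congr fun x => ?_
  rw [← ENNReal.ofReal_mul (Real.exp_pos _).le, ← Real.exp_add]
  ring_nf

/-- The law with density proportional to `y ^ (-α) / (1 + y)` on the half line. -/
noncomputable def ageLaw (α : ℝ) : Measure ℝ :=
  (volume.restrict (Ioi 0)).withDensity fun y =>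
    ENNReal.ofReal (Real.sin (Real.pi * α) / Real.pi * (y ^ (-α) / (y + 1)))

theorem lintegral_ageLaw (α : ℝ) (f : ℝ → ℝ≥0∞) :
    ∫⁻ x, f x ∂(ageLaw α) = ∫⁻ y in Ioi 0,
      ENNReal.ofReal (Real.sin (Real.pi * α) / Real.pi * (y ^ (-α) / (y + 1))) * f y := by
  rw [ageLaw, lintegral_withDensity_eq_lintegral_mul_non_measurable _ (by fun_prop)
    (ae_of_all _ fun _ => ENNReal.ofReal_lt_top)]
  rfl

theorem ae_ageLaw (α : ℝ) : ∀ᵐ x ∂(ageLaw α), 0 < x :=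
  (withDensity_absolutelyContinuous _ _).ae_le (ae_restrict_mem measurableSet_Ioi)

theorem lintegral_rpow_neg_div_add {α c : ℝ} (h0 : 0 < α) (h1 : α < 1) (hc : 0 < c) :
    ∫⁻ y in Ioi 0, ENNReal.ofReal (Real.sin (Real.pi * α) / Real.pi * (y ^ (-α) / (y + c))) =
      ENNReal.ofReal (c ^ (-α)) := by
  have h := lintegral_rpow_div_add (a := 1 - α) (by linarith) (by linarith) hc
  rw [show 1 - α - 1 = -α by ring, show Real.pi * (1 - α) = Real.pi - Real.pi * α by ring,
    Real.sin_pi_sub] at h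
  rw [← h]
  refine lintegral_congr fun y => ?_
  rw [add_comm c, mul_div_assoc]

theorem isProbabilityMeasure_ageLaw {α : ℝ} (h0 : 0 < α) (h1 : α < 1) :
    IsProbabilityMeasure (ageLaw α) := by
  constructor
  rw [← lintegral_one, lintegral_ageLaw]
  simpa using lintegral_rpow_neg_div_add h0 h1 one_pos

theorem lintegral_inv_ageLaw {α b : ℝ} (h0 : 0 < α) (h1 : α < 1) (hb : 1 < b) :
    ∫⁻ y, ENNReal.ofReal (1 / (1 + b * y)) ∂(ageLaw α) =
      ENNReal.ofReal ((b ^ α - 1) / (b - 1)) := by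
  have hb0 : 0 < b := by linarith
  have hb1 : 0 < b - 1 := by linarith
  have hs : 0 ≤ Real.sin (Real.pi * α) / Real.pi :=
    div_nonneg (Real.sin_nonneg_of_nonneg_of_le_pi (by positivity)
      (by nlinarith [Real.pi_pos])) Real.pi_pos.le
  have hbα : 1 ≤ b ^ α := Real.one_le_rpow hb.le h0.le
  have h := lintegral_rpow_neg_div_add h0 h1 (inv_pos.2 hb0)
  have h' := lintegral_rpow_neg_div_add h0 h1 one_pos
  -- Partial fractions with `1 / (b - 1)` added to both sides, so that only sums of nonnegative
  -- terms occur: `1 / (1 + b y) + 1 / (b - 1) = (1 + y) / ((b - 1) (y + 1 / b))`, where `1 + y`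
  -- cancels the denominator of the density.
  have key : ∫⁻ y, ENNReal.ofReal (1 / (1 + b * y)) ∂(ageLaw α) +
      ENNReal.ofReal (1 / (b - 1)) = ENNReal.ofReal ((b ^ α - 1) / (b - 1)) +
      ENNReal.ofReal (1 / (b - 1)) := by
    rw [← ENNReal.ofReal_add (div_nonneg (by linarith) hb1.le) (by positivity), ← add_div,
      sub_add_cancel, lintegral_ageLaw]
    rw [Real.inv_rpow hb0.le, Real.rpow_neg hb0.le, inv_inv] at h
    have e0 : ENNReal.ofReal (b ^ α / (b - 1)) = ENNReal.ofReal (1 / (b - 1)) *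
        ENNReal.ofReal (b ^ α) := by
      rw [← ENNReal.ofReal_mul (by positivity)]; ring_nf
    rw [e0, ← h, ← lintegral_const_mul' _ _ ENNReal.ofReal_ne_top]
    have e : ENNReal.ofReal (1 / (b - 1)) = ENNReal.ofReal (1 / (b - 1)) * ∫⁻ y in Ioi 0,
        ENNReal.ofReal (Real.sin (Real.pi * α) / Real.pi * (y ^ (-α) / (y + 1))) := by
      rw [h']; simp
    nth_rewrite 1 [e]
    rw [← lintegral_const_mul' _ _ ENNReal.ofReal_ne_top, ← lintegral_add_right _ (by fun_prop)]
    refine setLIntegral_congr_fun measurableSet_Ioi fun y hy => ?_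
    have hy : (0 : ℝ) < y := hy
    rw [← ENNReal.ofReal_mul (by positivity), ← ENNReal.ofReal_mul (by positivity),
      ← ENNReal.ofReal_mul (by positivity), ← ENNReal.ofReal_add (by positivity) (by positivity)]
    congr 1
    have hbi : 0 < b⁻¹ + y := by positivity
    field_simp
    ring
  exact (ENNReal.add_left_inj ENNReal.ofReal_ne_top).1 key

/-- The time spent positive up to time `τ` by a path which is positive up to time `s` and then
spends a proportion `a` of the remaining time positive. -/
noncomputable def occTime (s τ a : ℝ) : ℝ := min s τ + max (τ - s) 0 * a

theorem occTime_nonneg {s τ a : ℝ} (hs : 0 ≤ s) (hτ : 0 ≤ τ) (ha : 0 ≤ a) :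
    0 ≤ occTime s τ a := by
  have := le_min hs hτ
  unfold occTime
  positivity

@[fun_prop]
theorem measurable_occTime {β : Type*} [MeasurableSpace β] {f g h : β → ℝ} (hf : Measurable f)
    (hg : Measurable g) (hh : Measurable h) : Measurable fun x => occTime (f x) (g x) (h x) := by
  unfold occTime
  fun_prop

/-- Splitting at time `s`: before `s` the functional is `τ` itself, and beyond `s` the memoryless
exponential clock runs afresh with rate `l a` in place of `l`. -/
theorem lintegral_exp_occTime {s l a : ℝ} (hs : 0 < s) (hl : 0 < l) (ha : a ∈ Ioo (0 : ℝ) 1) :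
    ∫⁻ τ, ENNReal.ofReal (Real.exp (-(l * occTime s τ a))) ∂expLaw =
      ENNReal.ofReal (1 / (1 + l) +
        (1 / (1 + l * a) - 1 / (1 + l)) * Real.exp (-((1 + l) * s))) := by
  have hla : 0 < l * a := mul_pos hl ha.1
  have hd : 1 / (1 + l) ≤ 1 / (1 + l * a) :=
    one_div_le_one_div_of_le (by linarith) (by nlinarith [ha.2])
  have hd' : 0 ≤ (1 / (1 + l * a) - 1 / (1 + l)) * Real.exp (-((1 + l) * s)) :=
    mul_nonneg (by linarith) (Real.exp_pos _).le
  have hsplit : Ioi (0 : ℝ) = Ioc 0 s ∪ Ioi s := (Ioc_union_Ioi_eq_Ioi hs.le).symm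
  have hdis : Disjoint (Ioc 0 s) (Ioi s) := by
    rw [Set.disjoint_left]; intro x hx hx'; exact absurd hx.2 (not_le.2 hx')
  set f : ℝ → ℝ≥0∞ := fun τ => ENNReal.ofReal (Real.exp (-τ)) *
    ENNReal.ofReal (Real.exp (-(l * occTime s τ a))) with hf
  set g : ℝ → ℝ≥0∞ := fun τ => ENNReal.ofReal (Real.exp (-((1 + l) * τ))) with hg
  have h1 : ∫⁻ τ in Ioi s, f τ = ENNReal.ofReal (Real.exp (-((1 + l) * s)) / (1 + l * a)) := by
    rw [lintegral_Ioi_comp_add, div_eq_mul_one_div, ENNReal.ofReal_mul (Real.exp_pos _).le,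
      ← lintegral_exp_neg_mul (by linarith : 0 < 1 + l * a),
      ← lintegral_const_mul' _ _ ENNReal.ofReal_ne_top]
    refine setLIntegral_congr_fun measurableSet_Ioi fun y hy => ?_
    have hy : (0 : ℝ) < y := hy
    have e : occTime s (s + y) a = s + y * a := by
      rw [occTime, min_eq_left (by linarith), add_sub_cancel_left, max_eq_left hy.le]
    rw [hf]; beta_reduce
    rw [e, ← ENNReal.ofReal_mul (Real.exp_pos _).le, ← ENNReal.ofReal_mul (Real.exp_pos _).le,
      ← Real.exp_add, ← Real.exp_add]
    ring_nf
  have h2 : ∫⁻ τ in Ioi s, g τ = ENNReal.ofReal (Real.exp (-((1 + l) * s)) / (1 + l)) := by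
    rw [lintegral_Ioi_comp_add, div_eq_mul_one_div, ENNReal.ofReal_mul (Real.exp_pos _).le,
      ← lintegral_exp_neg_mul (by linarith : 0 < 1 + l),
      ← lintegral_const_mul' _ _ ENNReal.ofReal_ne_top]
    refine lintegral_congr fun y => ?_
    rw [hg]; beta_reduce
    rw [← ENNReal.ofReal_mul (Real.exp_pos _).le, ← Real.exp_add]
    ring_nf
  have h3 : ∫⁻ τ in Ioc 0 s, f τ = ∫⁻ τ in Ioc 0 s, g τ := by
    refine setLIntegral_congr_fun measurableSet_Ioc fun y hy => ?_
    have e : occTime s y a = y := by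
      rw [occTime, min_eq_right hy.2, max_eq_right (by linarith [hy.2]), zero_mul, add_zero]
    rw [hf, hg]; beta_reduce
    rw [e, ← ENNReal.ofReal_mul (Real.exp_pos _).le, ← Real.exp_add]
    ring_nf
  have h4 : ∫⁻ τ in Ioi 0, g τ = ENNReal.ofReal (1 / (1 + l)) :=
    lintegral_exp_neg_mul (by linarith)
  rw [lintegral_expLaw]
  change ∫⁻ τ in Ioi 0, f τ = _
  rw [hsplit, lintegral_union measurableSet_Ioi hdis] at h4 ⊢
  have h5 : ENNReal.ofReal (Real.exp (-((1 + l) * s)) / (1 + l)) ≠ ⊤ := ENNReal.ofReal_ne_top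
  refine (ENNReal.add_left_inj h5).1 ?_
  rw [h3, add_right_comm, ← h2, h4, h1, h2, ← ENNReal.ofReal_add (by positivity) (by positivity),
    ← ENNReal.ofReal_add (by positivity) (by positivity)]
  ring_nf

/-- Averages the previous formula over `s = v y`: the exponential `v` turns `exp (-(1 + l) v y)`
into `1 / (1 + (1 + l) y)`, whose mean under `ageLaw α` is `((1 + l) ^ α - 1) / l`. -/
theorem lintegral_exp_occTime_age {α l a : ℝ} (h0 : 0 < α) (h1 : α < 1) (hl : 0 < l)
    (ha : a ∈ Ioo (0 : ℝ) 1) :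
    ∫⁻ y, ∫⁻ v, ∫⁻ τ, ENNReal.ofReal (Real.exp (-(l * occTime (v * y) τ a)))
        ∂expLaw ∂expLaw ∂(ageLaw α) =
      ENNReal.ofReal ((1 - ((1 + l) ^ α - 1) / l) / (1 + l) +
        ((1 + l) ^ α - 1) / l * (1 + l * a) ^ (-1 : ℝ)) := by
  have hla : 0 < l * a := mul_pos hl ha.1
  have hd : 1 / (1 + l) ≤ 1 / (1 + l * a) :=
    one_div_le_one_div_of_le (by linarith) (by nlinarith [ha.2])
  have hd' : 0 ≤ 1 / (1 + l * a) - 1 / (1 + l) := by linarith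
  have hp := isProbabilityMeasure_ageLaw h0 h1
  have e : ∀ᵐ y ∂(ageLaw α), ∫⁻ v, ∫⁻ τ, ENNReal.ofReal (Real.exp (-(l * occTime (v * y) τ a)))
      ∂expLaw ∂expLaw = ENNReal.ofReal (1 / (1 + l)) +
        ENNReal.ofReal (1 / (1 + l * a) - 1 / (1 + l)) *
          ENNReal.ofReal (1 / (1 + (1 + l) * y)) := by
    filter_upwards [ae_ageLaw α] with y hy
    have e2 : ∀ᵐ v ∂expLaw, ∫⁻ τ, ENNReal.ofReal (Real.exp (-(l * occTime (v * y) τ a))) ∂expLaw =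
        ENNReal.ofReal (1 / (1 + l)) + ENNReal.ofReal (1 / (1 + l * a) - 1 / (1 + l)) *
          ENNReal.ofReal (Real.exp (-((1 + l) * y * v))) := by
      filter_upwards [ae_expLaw] with v hv
      rw [lintegral_exp_occTime (mul_pos hv hy) hl ha, ← ENNReal.ofReal_mul hd',
        ← ENNReal.ofReal_add (by positivity) (mul_nonneg hd' (Real.exp_pos _).le)]
      ring_nf
    rw [lintegral_congr_ae e2, lintegral_add_left measurable_const,
      lintegral_const_mul' _ _ ENNReal.ofReal_ne_top, lintegral_exp_expLaw (by positivity)]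
    simp
  have hh : 0 ≤ ((1 + l) ^ α - 1) / (1 + l - 1) :=
    div_nonneg (by linarith [Real.one_le_rpow (by linarith : 1 ≤ 1 + l) h0.le]) (by linarith)
  rw [lintegral_congr_ae e, lintegral_add_left measurable_const,
    lintegral_const_mul' _ _ ENNReal.ofReal_ne_top,
    lintegral_inv_ageLaw h0 h1 (by linarith : 1 < 1 + l), lintegral_const, measure_univ, mul_one,
    ← ENNReal.ofReal_mul hd', ← ENNReal.ofReal_add (by positivity) (mul_nonneg hd' hh)]
  rw [Real.rpow_neg_one, add_sub_cancel_left]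
  congr 1
  ring

/-- The image under `x ↦ e ^ (-x)` lives on `[0, 1]` and its moments are Laplace transforms at
integers. The weight `e ^ (-x)` shifts the `n`-th moment to the point `n + 1`, so the value at `0`
is not needed. -/
theorem ext_of_laplace {μ ν : Measure ℝ} [IsFiniteMeasure μ] [IsFiniteMeasure ν]
    (hμ : ∀ᵐ x ∂μ, 0 ≤ x) (hν : ∀ᵐ x ∂ν, 0 ≤ x)
    (h : ∀ l : ℝ, 0 < l → ∫⁻ x, ENNReal.ofReal (Real.exp (-(l * x))) ∂μ =
      ∫⁻ x, ENNReal.ofReal (Real.exp (-(l * x))) ∂ν) : μ = ν := by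
  let w : ℝ → ℝ≥0∞ := fun x => ENNReal.ofReal (Real.exp (-x))
  let T : ℝ → ℝ := fun x => Real.exp (-x)
  have hwm : Measurable w := by fun_prop
  have hTm : Measurable T := by fun_prop
  have fin : ∀ (ρ : Measure ℝ) [IsFiniteMeasure ρ], (∀ᵐ x ∂ρ, 0 ≤ x) →
      IsFiniteMeasure ((ρ.withDensity w).map T) := by
    intro ρ _ hρ
    have : IsFiniteMeasure (ρ.withDensity w) := by
      refine isFiniteMeasure_withDensity (ne_of_lt ?_)
      refine (lintegral_mono_ae (g := fun _ => 1) ?_).trans_lt (by simp [measure_lt_top])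
      filter_upwards [hρ] with x hx
      exact ENNReal.ofReal_le_one.2 (Real.exp_le_one_iff.2 (by linarith))
    infer_instance
  have sup : ∀ (ρ : Measure ℝ), (∀ᵐ x ∂ρ, 0 ≤ x) →
      ∀ᵐ x ∂((ρ.withDensity w).map T), x ∈ Icc (0 : ℝ) 1 := by
    intro ρ hρ
    rw [ae_map_iff hTm.aemeasurable (p := fun x => x ∈ Icc (0 : ℝ) 1) measurableSet_Icc]
    refine (withDensity_absolutelyContinuous _ _).ae_le ?_
    filter_upwards [hρ] with x hx
    exact ⟨(Real.exp_pos _).le, Real.exp_le_one_iff.2 (by linarith)⟩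
  have back : ∀ (ρ : Measure ℝ), ρ =
      (((ρ.withDensity w).map T).withDensity fun u => ENNReal.ofReal u⁻¹).map
        fun u => -Real.log u := by
    intro ρ
    refine Measure.ext_of_lintegral _ fun f hf => ?_
    rw [lintegral_map hf (by fun_prop), lintegral_withDensity_eq_lintegral_mul _ (by fun_prop)
      (by fun_prop), lintegral_map (by fun_prop) hTm,
      lintegral_withDensity_eq_lintegral_mul _ hwm (by fun_prop)]
    refine lintegral_congr fun x => ?_
    simp only [Pi.mul_apply, w, T, Real.log_exp, neg_neg]
    rw [← mul_assoc, ← ENNReal.ofReal_mul (Real.exp_pos _).le,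
      mul_inv_cancel₀ (Real.exp_pos _).ne', ENNReal.ofReal_one, one_mul]
  have mom : ∀ (ρ : Measure ℝ) (n : ℕ), ∫ x, x ^ n ∂((ρ.withDensity w).map T) =
      (∫⁻ x, ENNReal.ofReal (Real.exp (-(((n : ℝ) + 1) * x))) ∂ρ).toReal := by
    intro ρ n
    rw [integral_map hTm.aemeasurable (by fun_prop),
      integral_withDensity_eq_integral_toReal_smul hwm (ae_of_all _ fun _ => ENNReal.ofReal_lt_top),
      integral_eq_lintegral_of_nonneg_ae (ae_of_all _ fun x => by positivity) (by fun_prop)]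
    congr 1
    refine lintegral_congr fun x => ?_
    simp only [w, T, smul_eq_mul]
    rw [ENNReal.toReal_ofReal (Real.exp_pos _).le, ← Real.exp_nat_mul, ← Real.exp_add]
    ring_nf
  have := fin μ hμ
  have := fin ν hν
  rw [back μ, back ν, ext_of_moments (sup μ hμ) (sup ν hν) fun n => by
    rw [mom, mom, h _ (by positivity)]]

/-! ### The occupation time at an exponential time -/

theorem lintegral_pow_expLaw (n : ℕ) :
    ∫⁻ x, ENNReal.ofReal x ^ n ∂expLaw = (n.factorial : ℝ≥0∞) := by
  have h := lintegral_rpow_mul_exp (a := (n : ℝ) + 1) (by positivity) one_pos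
  rw [Real.Gamma_nat_eq_factorial, Real.one_rpow, one_mul, ENNReal.ofReal_natCast] at h
  rw [lintegral_expLaw, ← h]
  refine setLIntegral_congr_fun measurableSet_Ioi fun x hx => ?_
  have hx : (0 : ℝ) < x := hx
  rw [← ENNReal.ofReal_pow hx.le, ← ENNReal.ofReal_mul (Real.exp_pos _).le, add_sub_cancel_right,
    Real.rpow_natCast, one_mul, mul_comm]

/-- The law of `occTime (v * y) τ a` for independent exponential `v`, `τ`, `y` with law `ageLaw α`
and `a` with Lamperti's law. -/
noncomputable def occLaw (α r : ℝ) : Measure ℝ :=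
  (((expLaw.prod expLaw).prod (ageLaw α)).prod (lampertiLaw α r)).map
    fun w => occTime (w.1.1.1 * w.1.2) w.1.1.2 w.2

section

variable {α r : ℝ}

theorem lintegral_occLaw (h0 : 0 < α) (h1 : α < 1) (hr0 : 0 < r) (hr1 : r < 1) {f : ℝ → ℝ≥0∞}
    (hf : Measurable f) :
    ∫⁻ x, f x ∂(occLaw α r) = ∫⁻ v, ∫⁻ τ, ∫⁻ y, ∫⁻ a, f (occTime (v * y) τ a)
      ∂(lampertiLaw α r) ∂(ageLaw α) ∂expLaw ∂expLaw := by
  have := isProbabilityMeasure_ageLaw h0 h1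
  have := isProbabilityMeasure_lampertiLaw h0 h1 hr0 hr1
  rw [occLaw, lintegral_map hf (by fun_prop), lintegral_prod _ (by fun_prop),
    lintegral_prod _ (by fun_prop), lintegral_prod _ (by fun_prop)]

theorem lintegral_occLaw_symm (h0 : 0 < α) (h1 : α < 1) (hr0 : 0 < r) (hr1 : r < 1)
    {f : ℝ → ℝ≥0∞} (hf : Measurable f) :
    ∫⁻ x, f x ∂(occLaw α r) = ∫⁻ a, ∫⁻ y, ∫⁻ v, ∫⁻ τ, f (occTime (v * y) τ a)
      ∂expLaw ∂expLaw ∂(ageLaw α) ∂(lampertiLaw α r) := by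
  have := isProbabilityMeasure_ageLaw h0 h1
  have := isProbabilityMeasure_lampertiLaw h0 h1 hr0 hr1
  rw [occLaw, lintegral_map hf (by fun_prop), lintegral_prod_symm _ (by fun_prop)]
  refine lintegral_congr fun a => ?_
  rw [lintegral_prod_symm _ (by fun_prop)]
  refine lintegral_congr fun y => ?_
  rw [lintegral_prod _ (by fun_prop)]

theorem lintegral_exp_occLaw (h0 : 0 < α) (h1 : α < 1) (hr0 : 0 < r) (hr1 : r < 1) {l : ℝ}
    (hl : 0 < l) :
    ENNReal.ofReal r * ∫⁻ x, ENNReal.ofReal (Real.exp (-(l * x))) ∂(occLaw α r) =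
      ENNReal.ofReal ((1 - lampertiTransform α r l) / l) := by
  have hp := isProbabilityMeasure_lampertiLaw h0 h1 hr0 hr1
  have hs := stieltjes_lampertiLaw h0 h1 hr0 hr1 hl
  have ht := lampertiTransform_nonneg (α := α) hr0 hr1 hl
  have hb : 1 < 1 + l := by linarith
  have hbα : 1 ≤ (1 + l) ^ α := Real.one_le_rpow hb.le h0.le
  have hbα' : (1 + l) ^ α ≤ 1 + l := Real.rpow_le_self_of_one_le hb.le h1.le
  have hh : 0 ≤ ((1 + l) ^ α - 1) / l := div_nonneg (by linarith) hl.le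
  have hh' : 0 ≤ (1 - ((1 + l) ^ α - 1) / l) / (1 + l) := by
    refine div_nonneg ?_ (by linarith)
    rw [sub_nonneg, div_le_one hl]
    linarith
  rw [lintegral_occLaw_symm h0 h1 hr0 hr1 (by fun_prop)]
  have e : ∀ᵐ a ∂(lampertiLaw α r), ∫⁻ y, ∫⁻ v, ∫⁻ τ,
      ENNReal.ofReal (Real.exp (-(l * occTime (v * y) τ a))) ∂expLaw ∂expLaw ∂(ageLaw α) =
      ENNReal.ofReal ((1 - ((1 + l) ^ α - 1) / l) / (1 + l)) +
        ENNReal.ofReal (((1 + l) ^ α - 1) / l) * ENNReal.ofReal ((1 + l * a) ^ (-1 : ℝ)) := by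
    filter_upwards [ae_lampertiLaw α r] with a ha
    have : 0 < 1 + l * a := by nlinarith [ha.1]
    rw [lintegral_exp_occTime_age h0 h1 hl ha, ENNReal.ofReal_add hh' (by positivity),
      ENNReal.ofReal_mul hh]
  rw [lintegral_congr_ae e, lintegral_add_left measurable_const,
    lintegral_const_mul' _ _ ENNReal.ofReal_ne_top, ← stieltjes, hs, lintegral_const,
    measure_univ, mul_one, ← ENNReal.ofReal_mul hh, ← ENNReal.ofReal_add hh' (by positivity),
    ← ENNReal.ofReal_mul hr0.le]
  congr 1
  have hq : 0 < 1 - r := by linarith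
  have hD : 0 < r * (1 + l) ^ α + (1 - r) := by positivity
  rw [lampertiTransform, Real.rpow_sub_one (by positivity)]
  generalize (1 + l) ^ α = b at *
  have hl1 : 0 < 1 + l := by linarith
  field_simp
  ring

/-- Both Laplace transforms equal `(1 - lampertiTransform α r l) / l`; on the right this is `∫ a /
(1 + l a)`. The factor `r` is the probability of being positive at an exponential time, and the
density `a` on the right expresses size biasing by the proportion of positive time. -/
theorem occLaw_eq (h0 : 0 < α) (h1 : α < 1) (hr0 : 0 < r) (hr1 : r < 1) :
    ENNReal.ofReal r • occLaw α r =
      (((lampertiLaw α r).withDensity ENNReal.ofReal).prod expLaw).map fun w => w.2 * w.1 := by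
  have hpa := isProbabilityMeasure_ageLaw h0 h1
  have hp := isProbabilityMeasure_lampertiLaw h0 h1 hr0 hr1
  have hfin : IsFiniteMeasure ((lampertiLaw α r).withDensity ENNReal.ofReal) := by
    refine isFiniteMeasure_withDensity (ne_of_lt ?_)
    refine (lintegral_mono_ae (g := fun _ => 1) ?_).trans_lt (by simp)
    filter_upwards [ae_lampertiLaw α r] with x hx using ENNReal.ofReal_le_one.2 hx.2.le
  have hfo : IsFiniteMeasure (occLaw α r) := by unfold occLaw; infer_instance
  have hfo' : IsFiniteMeasure (ENNReal.ofReal r • occLaw α r) :=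
    Measure.smul_finite _ ENNReal.ofReal_ne_top
  have hae : ∀ᵐ a ∂((lampertiLaw α r).withDensity ENNReal.ofReal), a ∈ Ioo (0 : ℝ) 1 :=
    (withDensity_absolutelyContinuous _ _).ae_le (ae_lampertiLaw α r)
  refine ext_of_laplace (Measure.ae_smul_measure ?_ _) ?_ fun l hl => ?_
  · rw [occLaw, ae_map_iff (by fun_prop) (p := fun x => 0 ≤ x) measurableSet_Ici]
    have a1 := (Measure.quasiMeasurePreserving_snd (μ := (expLaw.prod expLaw).prod (ageLaw α))
      (ν := lampertiLaw α r)).ae (ae_lampertiLaw α r)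
    have a2 := (Measure.quasiMeasurePreserving_fst (μ := (expLaw.prod expLaw).prod (ageLaw α))
      (ν := lampertiLaw α r)).ae ((Measure.quasiMeasurePreserving_snd (μ := expLaw.prod expLaw)
      (ν := ageLaw α)).ae (ae_ageLaw α))
    have a3 := (Measure.quasiMeasurePreserving_fst (μ := (expLaw.prod expLaw).prod (ageLaw α))
      (ν := lampertiLaw α r)).ae ((Measure.quasiMeasurePreserving_fst (μ := expLaw.prod expLaw)
      (ν := ageLaw α)).ae ((Measure.quasiMeasurePreserving_fst (μ := expLaw)
      (ν := expLaw)).ae ae_expLaw))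
    have a4 := (Measure.quasiMeasurePreserving_fst (μ := (expLaw.prod expLaw).prod (ageLaw α))
      (ν := lampertiLaw α r)).ae ((Measure.quasiMeasurePreserving_fst (μ := expLaw.prod expLaw)
      (ν := ageLaw α)).ae ((Measure.quasiMeasurePreserving_snd (μ := expLaw)
      (ν := expLaw)).ae ae_expLaw))
    filter_upwards [a1, a2, a3, a4] with w w1 w2 w3 w4
    exact occTime_nonneg (mul_pos w3 w2).le w4.le w1.1.le
  · rw [ae_map_iff (by fun_prop) (p := fun x => 0 ≤ x) measurableSet_Ici]
    have a1 := (Measure.quasiMeasurePreserving_fst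
      (μ := (lampertiLaw α r).withDensity ENNReal.ofReal) (ν := expLaw)).ae hae
    have a2 := (Measure.quasiMeasurePreserving_snd
      (μ := (lampertiLaw α r).withDensity ENNReal.ofReal) (ν := expLaw)).ae ae_expLaw
    filter_upwards [a1, a2] with w w1 w2 using (mul_pos w2 w1.1).le
  · rw [lintegral_smul_measure, smul_eq_mul, lintegral_exp_occLaw h0 h1 hr0 hr1 hl,
      lintegral_map (by fun_prop) (by fun_prop), lintegral_prod _ (by fun_prop)]
    have hs := stieltjes_lampertiLaw h0 h1 hr0 hr1 hl
    have e : ∀ᵐ a ∂((lampertiLaw α r).withDensity ENNReal.ofReal),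
        ∫⁻ τ, ENNReal.ofReal (Real.exp (-(l * (τ * a)))) ∂expLaw =
        ENNReal.ofReal ((1 + l * a) ^ (-1 : ℝ)) := by
      filter_upwards [hae] with a ha
      have := lintegral_exp_expLaw (mul_pos hl ha.1).le
      rw [Real.rpow_neg_one, ← one_div, ← this]
      refine lintegral_congr fun τ => ?_
      ring_nf
    rw [lintegral_congr_ae e, lintegral_withDensity_eq_lintegral_mul _ (by fun_prop) (by fun_prop)]
    have hq : 0 < 1 - r := by linarith
    have ht := lampertiTransform_nonneg (α := α) hr0 hr1 hl
    -- Integrates `l a / (1 + l a) + 1 / (1 + l a) = 1`, which avoids subtraction of extended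
    -- nonnegative numbers.
    have key : ENNReal.ofReal l * ∫⁻ a, (ENNReal.ofReal * fun a =>
        ENNReal.ofReal ((1 + l * a) ^ (-1 : ℝ))) a ∂(lampertiLaw α r) +
        ENNReal.ofReal (lampertiTransform α r l) = 1 := by
      rw [← hs, stieltjes, ← lintegral_const_mul' _ _ ENNReal.ofReal_ne_top,
        ← lintegral_add_right _ (by fun_prop)]
      have e2 : ∀ᵐ a ∂(lampertiLaw α r), ENNReal.ofReal l * (ENNReal.ofReal * fun a =>
          ENNReal.ofReal ((1 + l * a) ^ (-1 : ℝ))) a +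
          ENNReal.ofReal ((1 + l * a) ^ (-1 : ℝ)) = 1 := by
        filter_upwards [ae_lampertiLaw α r] with a ha
        have ha0 : 0 < a := ha.1
        rw [Pi.mul_apply, ← ENNReal.ofReal_mul ha.1.le, ← ENNReal.ofReal_mul hl.le,
          ← ENNReal.ofReal_add (by positivity) (by positivity), ← ENNReal.ofReal_one]
        congr 1
        rw [Real.rpow_neg_one]
        field_simp
        ring
      rw [lintegral_congr_ae e2, lintegral_one, measure_univ]
    generalize (∫⁻ a, (ENNReal.ofReal * fun a =>
        ENNReal.ofReal ((1 + l * a) ^ (-1 : ℝ))) a ∂(lampertiLaw α r)) = I at key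
    have hI : I ≠ ⊤ := by
      rintro rfl
      rw [ENNReal.mul_top (by simpa using hl)] at key
      simp at key
    obtain ⟨i, hi0, rfl⟩ : ∃ i : ℝ, 0 ≤ i ∧ I = ENNReal.ofReal i :=
      ⟨I.toReal, ENNReal.toReal_nonneg, (ENNReal.ofReal_toReal hI).symm⟩
    rw [← ENNReal.ofReal_mul hl.le, ← ENNReal.ofReal_add (by positivity) ht,
      ← ENNReal.ofReal_one, ENNReal.ofReal_eq_ofReal_iff (by positivity) zero_le_one] at key
    congr 1
    rw [← key]
    field_simp
    ring

/-- The `n`-th moments in `occLaw_eq`: the exponential clock contributes `n!`, and the size bias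
raises the power of `a` by one. -/
theorem lintegral_pow_occTime (h0 : 0 < α) (h1 : α < 1) (hr0 : 0 < r) (hr1 : r < 1) (n : ℕ) :
    ENNReal.ofReal r * ∫⁻ v, ∫⁻ τ, ∫⁻ y, ∫⁻ a, ENNReal.ofReal (occTime (v * y) τ a) ^ n
      ∂(lampertiLaw α r) ∂(ageLaw α) ∂expLaw ∂expLaw =
      (n.factorial : ℝ≥0∞) * ∫⁻ a, ENNReal.ofReal a ^ (n + 1) ∂(lampertiLaw α r) := by
  have hp := isProbabilityMeasure_lampertiLaw h0 h1 hr0 hr1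
  rw [← lintegral_occLaw h0 h1 hr0 hr1 (f := fun x => ENNReal.ofReal x ^ n) (by fun_prop),
    ← smul_eq_mul, ← lintegral_smul_measure, occLaw_eq h0 h1 hr0 hr1,
    lintegral_map (by fun_prop) (by fun_prop), lintegral_prod _ (by fun_prop)]
  have e : ∀ a : ℝ, ∫⁻ τ, ENNReal.ofReal (τ * a) ^ n ∂expLaw =
      (n.factorial : ℝ≥0∞) * ENNReal.ofReal a ^ n := by
    intro a
    rw [← lintegral_pow_expLaw, ← lintegral_mul_const _ (by fun_prop)]
    refine lintegral_congr_ae ?_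
    filter_upwards [ae_expLaw] with τ hτ
    rw [ENNReal.ofReal_mul hτ.le, mul_pow]
  simp only [e]
  rw [lintegral_withDensity_eq_lintegral_mul _ (by fun_prop) (by fun_prop),
    ← lintegral_const_mul _ (by fun_prop)]
  refine lintegral_congr fun a => ?_
  rw [Pi.mul_apply, pow_succ]
  ring

end

/-! ### The recursion for the moments at the origin -/

theorem lintegral_region_swap {μ : Measure ℝ} [SFinite μ] {A A' : Set ℝ} {B B' : ℝ → Set ℝ}
    (hA : MeasurableSet A) (hA' : MeasurableSet A') (hB : ∀ t, MeasurableSet (B t))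
    (hB' : ∀ t, MeasurableSet (B' t))
    (h : ∀ v t, (t ∈ A ∧ v ∈ B t) ↔ (v ∈ A' ∧ t ∈ B' v))
    (hS : MeasurableSet {w : ℝ × ℝ | w.2 ∈ A ∧ w.1 ∈ B w.2}) {H : ℝ → ℝ → ℝ≥0∞}
    (hH : Measurable (Function.uncurry H)) :
    ∫⁻ t in A, ∫⁻ v in B t, H v t ∂μ ∂μ = ∫⁻ v in A', ∫⁻ t in B' v, H v t ∂μ ∂μ := by
  set S : Set (ℝ × ℝ) := {w : ℝ × ℝ | w.2 ∈ A ∧ w.1 ∈ B w.2} with hSd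
  have e1 : ∫⁻ t in A, ∫⁻ v in B t, H v t ∂μ ∂μ =
      ∫⁻ t, ∫⁻ v, S.indicator (Function.uncurry H) (v, t) ∂μ ∂μ := by
    rw [← lintegral_indicator hA]
    refine lintegral_congr fun t => ?_
    by_cases ht : t ∈ A
    · rw [indicator_of_mem ht, ← lintegral_indicator (hB t)]
      refine lintegral_congr fun v => ?_
      by_cases hv : v ∈ B t
      · rw [indicator_of_mem hv, indicator_of_mem (show (v, t) ∈ S from ⟨ht, hv⟩)]; rfl
      · rw [indicator_of_notMem hv, indicator_of_notMem (fun h' => hv h'.2)]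
    · rw [indicator_of_notMem ht]
      symm
      rw [lintegral_eq_zero_iff (by exact (hH.indicator hS).comp (by fun_prop))]
      exact ae_of_all _ fun v => indicator_of_notMem (fun h' => ht h'.1) _
  have e2 : ∫⁻ v in A', ∫⁻ t in B' v, H v t ∂μ ∂μ =
      ∫⁻ v, ∫⁻ t, S.indicator (Function.uncurry H) (v, t) ∂μ ∂μ := by
    rw [← lintegral_indicator hA']
    refine lintegral_congr fun v => ?_
    by_cases hv : v ∈ A'
    · rw [indicator_of_mem hv, ← lintegral_indicator (hB' v)]
      refine lintegral_congr fun t => ?_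
      by_cases ht : t ∈ B' v
      · rw [indicator_of_mem ht, indicator_of_mem (show (v, t) ∈ S from (h v t).2 ⟨hv, ht⟩)]; rfl
      · rw [indicator_of_notMem ht,
          indicator_of_notMem (s := S) (a := (v, t)) (fun h' => ht ((h v t).1 h').2)]
    · rw [indicator_of_notMem hv]
      symm
      rw [lintegral_eq_zero_iff (by exact (hH.indicator hS).comp (by fun_prop))]
      exact ae_of_all _ fun t =>
        indicator_of_notMem (s := S) (a := (v, t)) (fun h' => hv ((h v t).1 h').1) _
  rw [e1, e2, lintegral_lintegral_swap]
  exact ((hH.indicator hS).comp measurable_swap).aemeasurable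

theorem lintegral_Ioo_comp_add (f : ℝ → ℝ≥0∞) (s t : ℝ) :
    ∫⁻ x in Ioo s t, f x = ∫⁻ x in Ioo 0 (t - s), f (s + x) := by
  rw [← lintegral_indicator measurableSet_Ioo, ← lintegral_indicator measurableSet_Ioo,
    ← lintegral_add_left_eq_self _ s]
  refine lintegral_congr fun x => ?_
  by_cases hx : x ∈ Ioo 0 (t - s)
  · rw [indicator_of_mem (show s + x ∈ Ioo s t from ⟨by linarith [hx.1], by linarith [hx.2]⟩),
      indicator_of_mem hx]
  · rw [indicator_of_notMem (fun h : s + x ∈ Ioo s t =>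
      hx ⟨by linarith [h.1], by linarith [h.2]⟩), indicator_of_notMem hx]

theorem lintegral_quadrant {H : ℝ → ℝ → ℝ≥0∞} (hH : Measurable (Function.uncurry H)) :
    ∫⁻ t in Ioi 0, ∫⁻ v in Ioo 0 t, H v t = ∫⁻ v in Ioi 0, ∫⁻ x in Ioi 0, H v (v + x) := by
  rw [lintegral_region_swap (A' := Ioi 0) (B' := fun v => Ioi v) measurableSet_Ioi
    measurableSet_Ioi (fun _ => measurableSet_Ioo) (fun _ => measurableSet_Ioi) ?_ ?_ hH]
  · exact lintegral_congr fun v => lintegral_Ioi_comp_add _ _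
  · intro v t
    simp only [mem_Ioi, mem_Ioo]
    exact ⟨fun h => h.2, fun h => ⟨h.1.trans h.2, h⟩⟩
  · simp only [mem_Ioi, mem_Ioo]
    exact (measurableSet_lt measurable_const measurable_snd).inter
      ((measurableSet_lt measurable_const measurable_fst).inter
        (measurableSet_lt measurable_fst measurable_snd))

theorem lintegral_triangle {H : ℝ → ℝ → ℝ≥0∞} (hH : Measurable (Function.uncurry H)) (t : ℝ) :
    ∫⁻ v in Ioo 0 t, ∫⁻ s in Ioo 0 v, H s v =
      ∫⁻ s in Ioo 0 t, ∫⁻ u in Ioo 0 (t - s), H s (s + u) := by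
  rw [lintegral_region_swap (A' := Ioo 0 t) (B' := fun s => Ioo s t) measurableSet_Ioo
    measurableSet_Ioo (fun _ => measurableSet_Ioo) (fun _ => measurableSet_Ioo) ?_ ?_ hH]
  · exact lintegral_congr fun s => lintegral_Ioo_comp_add _ _ _
  · intro s v
    simp only [mem_Ioo]
    exact ⟨fun h => ⟨⟨h.2.1, h.2.2.trans h.1.2⟩, h.2.2, h.1.2⟩,
      fun h => ⟨⟨h.1.1.trans h.2.1, h.2.2⟩, h.1.1, h.2.1⟩⟩
  · simp only [mem_Ioo]
    exact ((measurableSet_lt measurable_const measurable_snd).inter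
      (measurableSet_lt measurable_snd measurable_const)).inter
      ((measurableSet_lt measurable_const measurable_fst).inter
        (measurableSet_lt measurable_fst measurable_snd))

theorem lintegral_strip {H : ℝ → ℝ → ℝ≥0∞} (hH : Measurable (Function.uncurry H)) (t : ℝ) :
    ∫⁻ v in Ioo 0 t, ∫⁻ s in Ioi 0, H v (v + s) =
      ∫⁻ x in Ioi 0, ∫⁻ v in Ioo 0 (min t x), H v x := by
  have h := lintegral_region_swap (μ := volume) (A := Ioi 0) (A' := Ioo 0 t)
    (B := fun x => Ioo 0 (min t x)) (B' := fun v => Ioi v) measurableSet_Ioi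
    measurableSet_Ioo (fun _ => measurableSet_Ioo) (fun _ => measurableSet_Ioi) ?_ ?_ hH
  · rw [h]
    exact lintegral_congr fun v => (lintegral_Ioi_comp_add _ _).symm
  · intro v x
    simp only [mem_Ioi, mem_Ioo, lt_min_iff]
    exact ⟨fun h => ⟨⟨h.2.1, h.2.2.1⟩, h.2.2.2⟩, fun h => ⟨h.1.1.trans h.2, h.1.1, h.1.2, h.2⟩⟩
  · simp only [mem_Ioi, mem_Ioo]
    exact (measurableSet_lt measurable_const measurable_snd).inter
      ((measurableSet_lt measurable_const measurable_fst).inter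
        (measurableSet_lt measurable_fst (by fun_prop)))

/-- The `n`-th moment of `occTime s t a` when `a` has Lamperti's law. -/
noncomputable def occMoment (α r : ℝ) (n : ℕ) (s t : ℝ) : ℝ≥0∞ :=
  ∫⁻ a, ENNReal.ofReal (occTime s t a) ^ n ∂(lampertiLaw α r)

section

variable {α r : ℝ}

theorem measurable_occMoment (h0 : 0 < α) (h1 : α < 1) (hr0 : 0 < r) (hr1 : r < 1) (n : ℕ)
    {β : Type*} [MeasurableSpace β] {f g : β → ℝ} (hf : Measurable f) (hg : Measurable g) :
    Measurable fun x => occMoment α r n (f x) (g x) := by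
  have := isProbabilityMeasure_lampertiLaw h0 h1 hr0 hr1
  unfold occMoment
  exact Measurable.lintegral_prod_right' (f := fun w : β × ℝ =>
    ENNReal.ofReal (occTime (f w.1) (g w.1) w.2) ^ n) (by fun_prop)

theorem occMoment_mul (n : ℕ) {c : ℝ} (hc : 0 < c) (s t : ℝ) :
    occMoment α r n (c * s) (c * t) = ENNReal.ofReal c ^ n * occMoment α r n s t := by
  rw [occMoment, occMoment, ← lintegral_const_mul' _ _ (by finiteness)]
  refine lintegral_congr fun a => ?_
  have e : occTime (c * s) (c * t) a = c * occTime s t a := by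
    have hmax : max (c * (t - s)) 0 = c * max (t - s) 0 := by
      rw [mul_max_of_nonneg _ _ hc.le, mul_zero]
    rw [occTime, occTime, ← mul_sub, ← mul_min_of_nonneg _ _ hc.le, hmax]
    ring
  rw [e, ENNReal.ofReal_mul hc.le, mul_pow]

theorem occMoment_zero_left (n : ℕ) {t : ℝ} (ht : 0 < t) :
    occMoment α r n 0 t = ENNReal.ofReal t ^ n *
      ∫⁻ a, ENNReal.ofReal a ^ n ∂(lampertiLaw α r) := by
  rw [← mul_one t]
  nth_rewrite 1 [← mul_zero t]
  rw [occMoment_mul n ht, mul_one, occMoment]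
  congr 1
  refine lintegral_congr fun a => ?_
  rw [occTime, min_eq_left zero_le_one, sub_zero, max_eq_left zero_le_one]
  simp

/-- The density of the time at which a process with entrance density `entranceDensity α v` at
time `v` returns to the origin, counted from `v`. -/
noncomputable def returnDensity (α s v : ℝ) : ℝ :=
  Real.sin (Real.pi * α) / Real.pi * (s ^ (-α) * v ^ α / (s + v))

/-- Scaling: the wait after time `v` until the next zero is `v` times a variable with law `ageLaw
α`. -/
theorem lintegral_returnDensity {v : ℝ} (hv : 0 < v) (f : ℝ → ℝ≥0∞) :
    ∫⁻ s in Ioi 0, ENNReal.ofReal (returnDensity α s v) * f s =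
      ∫⁻ y, f (v * y) ∂(ageLaw α) := by
  rw [lintegral_Ioi_comp_mul _ hv, lintegral_ageLaw,
    ← lintegral_const_mul' _ _ ENNReal.ofReal_ne_top]
  refine setLIntegral_congr_fun measurableSet_Ioi fun y hy => ?_
  have hy : (0 : ℝ) < y := hy
  rw [← mul_assoc, ← ENNReal.ofReal_mul hv.le]
  congr 2
  have hvα : 0 < v ^ α := by positivity
  have hyv : 0 < v * y + v := by positivity
  rw [returnDensity, Real.mul_rpow hv.le hy.le, Real.rpow_neg hv.le]
  field_simp

theorem lintegral_returnDensity_mul (n : ℕ) {t : ℝ} (ht : 0 < t) :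
    ∫⁻ v in Ioo 0 t, ∫⁻ s in Ioi 0,
        ENNReal.ofReal (returnDensity α s v) * occMoment α r n s (t - v) =
      ENNReal.ofReal t ^ (n + 1) * ∫⁻ v in Ioo 0 1, ∫⁻ s in Ioi 0,
        ENNReal.ofReal (returnDensity α s v) * occMoment α r n s (1 - v) := by
  have e1 : ∀ c : ℝ, ∀ g : ℝ → ℝ≥0∞,
      ∫⁻ v in Ioo 0 c, g v = ∫⁻ v in Ioi 0, (Iio c).indicator g v := by
    intro c g
    rw [← Ioi_inter_Iio, setLIntegral_indicator (s := Iio c) measurableSet_Iio, inter_comm]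
  rw [e1, e1, lintegral_Ioi_comp_mul _ ht, pow_succ', mul_assoc]
  congr 1
  rw [← lintegral_const_mul' _ _ (by finiteness)]
  refine setLIntegral_congr_fun measurableSet_Ioi fun v hv => ?_
  have hv : (0 : ℝ) < v := hv
  by_cases h : v < 1
  · rw [indicator_of_mem (show t * v ∈ Iio t by rw [mem_Iio]; nlinarith),
      indicator_of_mem (show v ∈ Iio 1 from h), lintegral_returnDensity (mul_pos ht hv),
      lintegral_returnDensity hv, ← lintegral_const_mul' _ _ (by finiteness)]
    refine lintegral_congr fun y => ?_
    rw [← occMoment_mul n ht, mul_assoc, mul_one_sub]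
  · rw [indicator_of_notMem (show t * v ∉ Iio t by rw [mem_Iio]; nlinarith),
      indicator_of_notMem (show v ∉ Iio 1 from h),
      mul_zero]

/-- The moment recursion at the origin: at time `v` the path is positive with probability `r`, stays
so until its next zero, and then restarts from the origin. By scaling both sides are proportional to
`t ^ (n + 1)`, so it is enough to average over an exponential horizon `t`, where `v` and `t - v`
decouple into independent exponentials and `lintegral_pow_occTime` applies. -/
theorem lintegral_occMoment_zero (h0 : 0 < α) (h1 : α < 1) (hr0 : 0 < r) (hr1 : r < 1) (n : ℕ)
    {t : ℝ} (ht : 0 < t) :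
    occMoment α r (n + 1) 0 t = ((n : ℝ≥0∞) + 1) * (ENNReal.ofReal r *
      ∫⁻ v in Ioo 0 t, ∫⁻ s in Ioi 0,
        ENNReal.ofReal (returnDensity α s v) * occMoment α r n s (t - v)) := by
  have hpa := isProbabilityMeasure_ageLaw h0 h1
  rw [occMoment_zero_left _ ht, lintegral_returnDensity_mul n ht]
  set F := ∫⁻ v in Ioo 0 1, ∫⁻ s in Ioi 0,
        ENNReal.ofReal (returnDensity α s v) * occMoment α r n s (1 - v) with hF
  set m := ∫⁻ a, ENNReal.ofReal a ^ (n + 1) ∂(lampertiLaw α r) with hm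
  -- The factorial is `E t ^ (n + 1)` for exponential `t`, and `e ^ (-t) = e ^ (-v) e ^ (-(t - v))`
  -- separates the two times.
  have key : ((n + 1).factorial : ℝ≥0∞) * F = ∫⁻ v, ∫⁻ τ, ∫⁻ y, occMoment α r n (v * y) τ
      ∂(ageLaw α) ∂expLaw ∂expLaw := by
    have hm1 : Measurable fun w : ℝ × ℝ => ∫⁻ y, occMoment α r n (w.1 * y) (w.2 - w.1)
        ∂(ageLaw α) :=
      Measurable.lintegral_prod_right' (f := fun w : (ℝ × ℝ) × ℝ =>
        occMoment α r n (w.1.1 * w.2) (w.1.2 - w.1.1))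
        (measurable_occMoment h0 h1 hr0 hr1 n (by fun_prop) (by fun_prop))
    rw [← lintegral_pow_expLaw, ← lintegral_mul_const _ (by fun_prop)]
    have e1 : ∀ᵐ t ∂expLaw, ENNReal.ofReal t ^ (n + 1) * F = ∫⁻ v in Ioo 0 t,
        ∫⁻ y, occMoment α r n (v * y) (t - v) ∂(ageLaw α) := by
      filter_upwards [ae_expLaw] with t ht
      rw [hF, ← lintegral_returnDensity_mul n ht]
      exact setLIntegral_congr_fun measurableSet_Ioo fun v hv => lintegral_returnDensity hv.1 _
    rw [lintegral_congr_ae e1, lintegral_expLaw, lintegral_expLaw]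
    have e2 : ∀ t : ℝ, ENNReal.ofReal (Real.exp (-t)) *
        ∫⁻ v in Ioo 0 t, ∫⁻ y, occMoment α r n (v * y) (t - v) ∂(ageLaw α) =
        ∫⁻ v in Ioo 0 t, ENNReal.ofReal (Real.exp (-t)) *
          ∫⁻ y, occMoment α r n (v * y) (t - v) ∂(ageLaw α) :=
      fun t => (lintegral_const_mul' _ _ ENNReal.ofReal_ne_top).symm
    rw [lintegral_congr e2, lintegral_quadrant (H := fun v t => ENNReal.ofReal (Real.exp (-t)) *
      ∫⁻ y, occMoment α r n (v * y) (t - v) ∂(ageLaw α))]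
    · refine lintegral_congr fun v => ?_
      rw [lintegral_expLaw, ← lintegral_const_mul' _ _ ENNReal.ofReal_ne_top]
      refine lintegral_congr fun x => ?_
      rw [← mul_assoc, ← ENNReal.ofReal_mul (Real.exp_pos _).le, ← Real.exp_add,
        add_sub_cancel_left]
      ring_nf
    · exact Measurable.mul (by fun_prop) hm1
  have hq := lintegral_pow_occTime h0 h1 hr0 hr1 n
  have e3 : ENNReal.ofReal r * (((n + 1).factorial : ℝ≥0∞) * F) = (n.factorial : ℝ≥0∞) * m := by
    rw [key]; exact hq
  have e4 : m = ((n : ℝ≥0∞) + 1) * (ENNReal.ofReal r * F) := by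
    have hn : (n.factorial : ℝ≥0∞) ≠ 0 := by exact_mod_cast n.factorial_ne_zero
    refine (ENNReal.mul_right_inj hn (by finiteness)).1 ?_
    rw [← e3, Nat.factorial_succ]
    push_cast
    ring
  rw [e4]
  ring

end

/-! ### The recursion for the moments at a general starting point -/

/-- The transition density, from `[0, ∞)` to `(0, ∞)`, of the skew Bessel process, written with
sums and integrals of nonnegative terms. -/
noncomputable def skewKernel (α r t x y : ℝ) : ℝ≥0∞ :=
  if x = 0 then ENNReal.ofReal (r * entranceDensity α t y)
  else (∑' k, ENNReal.ofReal (killedTerm α t x y k)) +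
    ∫⁻ s in Ioo 0 t, ENNReal.ofReal (hittingDensity α x s) *
      ENNReal.ofReal (r * entranceDensity α (t - s) y)

/-- The `n`-th moment of the time spent positive up to time `t` by a skew Bessel process which
starts at `x ≥ 0`. -/
noncomputable def posMoment (α r : ℝ) (n : ℕ) (t x : ℝ) : ℝ≥0∞ :=
  if x = 0 then occMoment α r n 0 t
  else ∫⁻ s in Ioi 0, ENNReal.ofReal (hittingDensity α x s) * occMoment α r n s t

@[fun_prop]
theorem measurable_hittingDensity {β : Type*} [MeasurableSpace β] (α : ℝ) {f g : β → ℝ}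
    (hf : Measurable f) (hg : Measurable g) :
    Measurable fun x => hittingDensity α (f x) (g x) := by
  unfold hittingDensity
  fun_prop

@[fun_prop]
theorem measurable_entranceDensity {β : Type*} [MeasurableSpace β] (α : ℝ) {f g : β → ℝ}
    (hf : Measurable f) (hg : Measurable g) :
    Measurable fun x => entranceDensity α (f x) (g x) := by
  unfold entranceDensity
  fun_prop

theorem measurable_setLIntegral_Ioo {β : Type*} [MeasurableSpace β] {F : β → ℝ → ℝ≥0∞}
    (hF : Measurable (Function.uncurry F)) {f : β → ℝ} (hf : Measurable f) :
    Measurable fun x => ∫⁻ s in Ioo 0 (f x), F x s := by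
  have e : ∀ x, ∫⁻ s in Ioo 0 (f x), F x s = ∫⁻ s,
      {w : β × ℝ | 0 < w.2 ∧ w.2 < f w.1}.indicator (Function.uncurry F) (x, s) := by
    intro x
    rw [← lintegral_indicator measurableSet_Ioo]
    rfl
  simp_rw [e]
  refine Measurable.lintegral_prod_right' (hF.indicator ?_)
  exact (measurableSet_lt measurable_const measurable_snd).inter
    (measurableSet_lt measurable_snd (by fun_prop))

theorem measurable_skewKernel {β : Type*} [MeasurableSpace β] (α r : ℝ) {t x y : β → ℝ}
    (ht : Measurable t) (hx : Measurable x) (hy : Measurable y) :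
    Measurable fun w => skewKernel α r (t w) (x w) (y w) := by
  unfold skewKernel
  refine Measurable.ite (measurableSet_eq_fun hx measurable_const) (by fun_prop)
    (Measurable.add (Measurable.tsum fun k => ?_) (measurable_setLIntegral_Ioo
      (F := fun w s => ENNReal.ofReal (hittingDensity α (x w) s) *
        ENNReal.ofReal (r * entranceDensity α (t w - s) (y w))) ?_ ht))
  · unfold killedTerm
    fun_prop
  · unfold Function.uncurry
    fun_prop

theorem skewTransitionDensity_eq {α r t x y : ℝ} (h0 : 0 < α) (ht : 0 < t) (hx : 0 ≤ x)
    (hy : 0 < y) : skewTransitionDensity α r t x y = skewKernel α r t x y := by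
  rcases eq_or_lt_of_le hx with rfl | hx
  · simp [skewTransitionDensity, skewKernel, skewEntranceDensity, hy]
  · rw [skewTransitionDensity, skewKernel, if_neg hx.ne', if_neg hx.ne', if_pos (mul_pos hx hy),
      abs_of_pos hx, abs_of_pos hy, ofReal_killedDensity h0 ht hx hy]
    congr 1
    refine setLIntegral_congr_fun measurableSet_Ioo fun s hs => ?_
    rw [skewEntranceDensity, if_pos hy, ENNReal.ofReal_mul (hittingDensity_nonneg h0 hx.le hs.1.le)]

theorem lintegral_mul_hitting_swap {α : ℝ} {g M : ℝ → ℝ≥0∞} (hg : Measurable g)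
    (hM : Measurable M) :
    ∫⁻ y in Ioi 0, g y * ∫⁻ s in Ioi 0, ENNReal.ofReal (hittingDensity α y s) * M s =
      ∫⁻ s in Ioi 0, (∫⁻ y in Ioi 0, g y * ENNReal.ofReal (hittingDensity α y s)) * M s := by
  have e1 : ∀ y, g y * ∫⁻ s in Ioi 0, ENNReal.ofReal (hittingDensity α y s) * M s =
      ∫⁻ s in Ioi 0, g y * (ENNReal.ofReal (hittingDensity α y s) * M s) := fun y =>
    (lintegral_const_mul _ (by fun_prop)).symm
  have e2 : ∀ s, (∫⁻ y in Ioi 0, g y * ENNReal.ofReal (hittingDensity α y s)) * M s =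
      ∫⁻ y in Ioi 0, g y * ENNReal.ofReal (hittingDensity α y s) * M s := fun s =>
    (lintegral_mul_const _ (by fun_prop)).symm
  simp_rw [e1, e2, ← mul_assoc]
  refine lintegral_lintegral_swap (Measurable.aemeasurable ?_)
  unfold Function.uncurry
  fun_prop

/-- Fundamental theorem of calculus for `-(X - v) ^ (n + 1)`, in additive form. -/
theorem lintegral_sub_pow {X m : ℝ} (hm : 0 ≤ m) (hX : m ≤ X) (n : ℕ) :
    ((n : ℝ≥0∞) + 1) * (∫⁻ v in Ioo 0 m, ENNReal.ofReal (X - v) ^ n) +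
      ENNReal.ofReal (X - m) ^ (n + 1) = ENNReal.ofReal X ^ (n + 1) := by
  have e : ∫⁻ v in Ioo 0 m, ENNReal.ofReal (X - v) ^ n =
      ENNReal.ofReal ((X ^ (n + 1) - (X - m) ^ (n + 1)) / ((n : ℝ) + 1)) := by
    have h1 : ∫ v in (0 : ℝ)..m, (X - v) ^ n =
        (X ^ (n + 1) - (X - m) ^ (n + 1)) / ((n : ℝ) + 1) := by
      rw [intervalIntegral.integral_comp_sub_left (fun v => v ^ n) X, integral_pow, sub_zero]
    rw [← h1, intervalIntegral.integral_of_le hm, ← integral_Ioc_eq_integral_Ioo.symm,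
      ofReal_integral_eq_lintegral_ofReal]
    · refine setLIntegral_congr_fun measurableSet_Ioo fun v hv => ?_
      rw [ENNReal.ofReal_pow (by linarith [hv.2])]
    · exact (Continuous.integrableOn_Icc (by fun_prop)).mono_set Ioo_subset_Icc_self
    · filter_upwards [ae_restrict_mem measurableSet_Ioo] with v hv
      exact pow_nonneg (by linarith [hv.2]) n
  have hp : (X - m) ^ (n + 1) ≤ X ^ (n + 1) := by gcongr; linarith
  have hn : ((n : ℝ≥0∞) + 1) = ENNReal.ofReal ((n : ℝ) + 1) := by
    rw [ENNReal.ofReal_add (by positivity) zero_le_one]; simp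
  rw [e, hn, ← ENNReal.ofReal_mul (by positivity), ← ENNReal.ofReal_pow (by linarith),
    ← ENNReal.ofReal_pow (by linarith), ← ENNReal.ofReal_add _ (pow_nonneg (by linarith) _)]
  · congr 1
    field_simp
    ring
  · have : 0 ≤ X ^ (n + 1) - (X - m) ^ (n + 1) := by linarith
    positivity

section

variable {α r : ℝ}

theorem occMoment_eq_zero (n : ℕ) {t : ℝ} (ht : t ≤ 0) : occMoment α r (n + 1) 0 t = 0 := by
  rw [occMoment]
  have : ∀ a : ℝ, ENNReal.ofReal (occTime 0 t a) ^ (n + 1) = 0 := by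
    intro a
    rw [occTime, min_eq_right ht, sub_zero, max_eq_right ht, zero_mul, add_zero,
      ENNReal.ofReal_of_nonpos ht]
    simp
  simp [this]

/-- For a path which is positive until its first zero at time `x`: starting `v` later lowers the
positive time by `v`. Integrating over `v` up to `min t x` accounts for the positive stretch, and
what is left is the contribution after the zero. -/
theorem occMoment_step (h0 : 0 < α) (h1 : α < 1) (hr0 : 0 < r) (hr1 : r < 1) (n : ℕ) {t x : ℝ}
    (ht : 0 < t) (hx : 0 < x) :
    ((n : ℝ≥0∞) + 1) * (∫⁻ v in Ioo 0 (min t x), occMoment α r n (x - v) (t - v)) +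
      occMoment α r (n + 1) 0 (t - x) = occMoment α r (n + 1) x t := by
  have hp := isProbabilityMeasure_lampertiLaw h0 h1 hr0 hr1
  have hm : 0 < min t x := lt_min ht hx
  have e1 : ∀ v a : ℝ, occTime (x - v) (t - v) a = occTime x t a - v := by
    intro v a
    rw [occTime, occTime, min_sub_sub_right, sub_sub_sub_cancel_right]
    ring
  have e2 : ∀ᵐ a ∂(lampertiLaw α r), ENNReal.ofReal (occTime 0 (t - x) a) ^ (n + 1) =
      ENNReal.ofReal (occTime x t a - min t x) ^ (n + 1) := by
    filter_upwards with a
    rcases le_total t x with h | h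
    · rw [occTime, occTime, min_eq_right (by linarith), sub_zero, max_eq_right (by linarith),
        min_eq_left h, min_eq_right h, ENNReal.ofReal_of_nonpos (by linarith)]
      simp
    · rw [occTime, occTime, min_eq_left (by linarith), sub_zero, min_eq_left h, min_eq_right h]
      congr 2
      ring
  unfold occMoment
  rw [lintegral_lintegral_swap (Measurable.aemeasurable (by unfold Function.uncurry; fun_prop)),
    lintegral_congr_ae e2, ← lintegral_const_mul _ (by
      simp_rw [e1]
      exact Measurable.lintegral_prod_right' (f := fun w : ℝ × ℝ =>
        ENNReal.ofReal (occTime x t w.1 - w.2) ^ n) (by fun_prop)),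
    ← lintegral_add_right _ (by fun_prop)]
  refine lintegral_congr_ae ?_
  filter_upwards [ae_lampertiLaw α r] with a ha
  simp_rw [e1]
  refine lintegral_sub_pow hm.le ?_ n
  rw [occTime, min_comm]
  have : 0 ≤ max (t - x) 0 * a := mul_nonneg (le_max_right _ _) ha.1.le
  linarith

theorem measurable_posMoment (h0 : 0 < α) (h1 : α < 1) (hr0 : 0 < r) (hr1 : r < 1) (n : ℕ)
    {β : Type*} [MeasurableSpace β] {t x : β → ℝ} (ht : Measurable t) (hx : Measurable x) :
    Measurable fun w => posMoment α r n (t w) (x w) := by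
  unfold posMoment
  refine Measurable.ite (measurableSet_eq_fun hx measurable_const)
    (measurable_occMoment h0 h1 hr0 hr1 n measurable_const ht) ?_
  refine Measurable.lintegral_prod_right' (f := fun w : β × ℝ =>
    ENNReal.ofReal (hittingDensity α (x w.1) w.2) * occMoment α r n w.2 (t w.1)) ?_
  exact Measurable.mul (by fun_prop)
    (measurable_occMoment h0 h1 hr0 hr1 n (by fun_prop) (by fun_prop))

theorem posMoment_zero (h0 : 0 < α) (h1 : α < 1) (hr0 : 0 < r) (hr1 : r < 1) {t x : ℝ}
    (hx : 0 ≤ x) : posMoment α r 0 t x = 1 := by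
  have hp := isProbabilityMeasure_lampertiLaw h0 h1 hr0 hr1
  have e : ∀ s t, occMoment α r 0 s t = 1 := fun s t => by simp [occMoment]
  unfold posMoment
  split_ifs with h
  · exact e _ _
  · simp_rw [e, mul_one]
    exact lintegral_hittingDensity h0 (lt_of_le_of_ne hx (Ne.symm h))

/-- Integrating the entrance density against the hitting density gives `returnDensity`, which
identifies the left side with the recursion at the origin. -/
theorem posMoment_step_zero (h0 : 0 < α) (h1 : α < 1) (hr0 : 0 < r) (hr1 : r < 1) (n : ℕ) {t : ℝ}
    (ht : 0 < t) :
    ((n : ℝ≥0∞) + 1) * ∫⁻ v in Ioo 0 t, ∫⁻ y in Ioi 0,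
      ENNReal.ofReal (r * entranceDensity α v y) * posMoment α r n (t - v) y =
      occMoment α r (n + 1) 0 t := by
  rw [lintegral_occMoment_zero h0 h1 hr0 hr1 n ht,
    ← lintegral_const_mul' _ _ ENNReal.ofReal_ne_top]
  congr 1
  refine setLIntegral_congr_fun measurableSet_Ioo fun v hv => ?_
  have hM : Measurable fun s => occMoment α r n s (t - v) :=
    measurable_occMoment h0 h1 hr0 hr1 n measurable_id measurable_const
  have e : ∀ y ∈ Ioi (0 : ℝ), ENNReal.ofReal (r * entranceDensity α v y) *
      posMoment α r n (t - v) y = ENNReal.ofReal r * (ENNReal.ofReal (entranceDensity α v y) *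
        ∫⁻ s in Ioi 0, ENNReal.ofReal (hittingDensity α y s) * occMoment α r n s (t - v)) := by
    intro y hy
    rw [posMoment, if_neg (ne_of_gt hy), ENNReal.ofReal_mul hr0.le, mul_assoc]
  rw [setLIntegral_congr_fun measurableSet_Ioi e, lintegral_const_mul' _ _ ENNReal.ofReal_ne_top,
    lintegral_mul_hitting_swap (by fun_prop) hM]
  congr 1
  refine setLIntegral_congr_fun measurableSet_Ioi fun s hs => ?_
  rw [lintegral_entranceDensity_mul_hittingDensity h0 h1 hv.1 hs, returnDensity]

theorem measurable_entrance_posMoment (h0 : 0 < α) (h1 : α < 1) (hr0 : 0 < r) (hr1 : r < 1)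
    (n : ℕ) {β : Type*} [MeasurableSpace β] {f g : β → ℝ} (hf : Measurable f)
    (hg : Measurable g) : Measurable fun w => ∫⁻ y in Ioi 0,
      ENNReal.ofReal (r * entranceDensity α (f w) y) * posMoment α r n (g w) y :=
  Measurable.lintegral_prod_right' (f := fun w : β × ℝ =>
    ENNReal.ofReal (r * entranceDensity α (f w.1) w.2) * posMoment α r n (g w.1) w.2)
    (Measurable.mul (by fun_prop)
      (measurable_posMoment h0 h1 hr0 hr1 n (by fun_prop) (by fun_prop)))

/-- The transition kernel has two parts. If zero has not been hit by time `v`, the Markov property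
of the hitting time applies and Tonelli on a strip puts the first zero outside; if it was hit at `s
< v`, Tonelli on a triangle reduces to the case `x = 0` with horizon `t - s`. Conditionally on the
first zero, `occMoment_step` adds the two contributions. -/
theorem posMoment_step (h0 : 0 < α) (h1 : α < 1) (hr0 : 0 < r) (hr1 : r < 1) (n : ℕ) {t x : ℝ}
    (ht : 0 < t) (hx : 0 ≤ x) :
    ((n : ℝ≥0∞) + 1) * ∫⁻ v in Ioo 0 t, ∫⁻ y in Ioi 0,
      skewKernel α r v x y * posMoment α r n (t - v) y = posMoment α r (n + 1) t x := by
  rcases eq_or_lt_of_le hx with rfl | hx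
  · simp only [skewKernel, if_true]
    rw [posMoment, if_pos rfl, posMoment_step_zero h0 h1 hr0 hr1 n ht]
  have hkm : ∀ v, Measurable fun y => ∑' k, ENNReal.ofReal (killedTerm α v x y k) := fun v =>
    Measurable.tsum fun k => by unfold killedTerm; fun_prop
  have split : ∀ v ∈ Ioo 0 t, ∫⁻ y in Ioi 0, skewKernel α r v x y * posMoment α r n (t - v) y =
      (∫⁻ s in Ioi 0, ENNReal.ofReal (hittingDensity α x (v + s)) *
        occMoment α r n (v + s - v) (t - v)) +
      ∫⁻ s in Ioo 0 v, ENNReal.ofReal (hittingDensity α x s) * ∫⁻ y in Ioi 0,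
        ENNReal.ofReal (r * entranceDensity α (v - s) y) * posMoment α r n (t - v) y := by
    intro v hv
    have hP : Measurable fun y => posMoment α r n (t - v) y :=
      measurable_posMoment h0 h1 hr0 hr1 n measurable_const measurable_id
    have hM : Measurable fun s => occMoment α r n s (t - v) :=
      measurable_occMoment h0 h1 hr0 hr1 n measurable_id measurable_const
    simp_rw [skewKernel, if_neg hx.ne', add_mul]
    have hKP : Measurable fun y => (∑' k, ENNReal.ofReal (killedTerm α v x y k)) *
        posMoment α r n (t - v) y := (hkm v).mul hP
    rw [lintegral_add_left hKP]
    congr 1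
    · have e : ∀ y ∈ Ioi (0 : ℝ), (∑' k, ENNReal.ofReal (killedTerm α v x y k)) *
          posMoment α r n (t - v) y = (∑' k, ENNReal.ofReal (killedTerm α v x y k)) *
          ∫⁻ s in Ioi 0, ENNReal.ofReal (hittingDensity α y s) * occMoment α r n s (t - v) := by
        intro y hy
        rw [posMoment, if_neg (ne_of_gt hy)]
      rw [setLIntegral_congr_fun measurableSet_Ioi e, lintegral_mul_hitting_swap (hkm v) hM]
      refine setLIntegral_congr_fun measurableSet_Ioi fun s hs => ?_
      rw [lintegral_killedDensity_mul_hittingDensity h0 hv.1 hx hs, add_sub_cancel_left]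
    · have e1 : ∀ y, (∫⁻ s in Ioo 0 v, ENNReal.ofReal (hittingDensity α x s) *
          ENNReal.ofReal (r * entranceDensity α (v - s) y)) * posMoment α r n (t - v) y =
          ∫⁻ s in Ioo 0 v, ENNReal.ofReal (hittingDensity α x s) *
          ENNReal.ofReal (r * entranceDensity α (v - s) y) * posMoment α r n (t - v) y := fun y =>
        (lintegral_mul_const _ (by fun_prop)).symm
      simp_rw [e1]
      rw [lintegral_lintegral_swap (Measurable.aemeasurable (by
        unfold Function.uncurry; exact Measurable.mul (by fun_prop) (hP.comp measurable_fst)))]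
      refine lintegral_congr fun s => ?_
      simp_rw [mul_assoc]
      rw [lintegral_const_mul' _ _ ENNReal.ofReal_ne_top]
  have hH1 : Measurable (Function.uncurry fun v s => ENNReal.ofReal (hittingDensity α x s) *
      occMoment α r n (s - v) (t - v)) := by
    unfold Function.uncurry
    exact Measurable.mul (by fun_prop)
      (measurable_occMoment h0 h1 hr0 hr1 n (by fun_prop) (by fun_prop))
  have hH2 : Measurable (Function.uncurry fun s v => ENNReal.ofReal (hittingDensity α x s) *
      ∫⁻ y in Ioi 0, ENNReal.ofReal (r * entranceDensity α (v - s) y) *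
        posMoment α r n (t - v) y) := by
    unfold Function.uncurry
    exact Measurable.mul (by fun_prop)
      (measurable_entrance_posMoment h0 h1 hr0 hr1 n (by fun_prop) (by fun_prop))
  have hH3 : Measurable (Function.uncurry fun v s => ENNReal.ofReal (hittingDensity α x s) *
      ∫⁻ y in Ioi 0, ENNReal.ofReal (r * entranceDensity α (v - s) y) *
        posMoment α r n (t - v) y) := by
    unfold Function.uncurry
    exact Measurable.mul (by fun_prop)
      (measurable_entrance_posMoment h0 h1 hr0 hr1 n (by fun_prop) (by fun_prop))
  have hm2 : Measurable fun v => ∫⁻ s in Ioo 0 v, ENNReal.ofReal (hittingDensity α x s) *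
      ∫⁻ y in Ioi 0, ENNReal.ofReal (r * entranceDensity α (v - s) y) *
        posMoment α r n (t - v) y :=
    measurable_setLIntegral_Ioo (F := fun v s => ENNReal.ofReal (hittingDensity α x s) *
      ∫⁻ y in Ioi 0, ENNReal.ofReal (r * entranceDensity α (v - s) y) *
        posMoment α r n (t - v) y) hH3 measurable_id
  rw [setLIntegral_congr_fun measurableSet_Ioo split, lintegral_add_right _ hm2,
    lintegral_strip (H := fun v s => ENNReal.ofReal (hittingDensity α x s) *
      occMoment α r n (s - v) (t - v)) hH1,
    lintegral_triangle (H := fun s v => ENNReal.ofReal (hittingDensity α x s) *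
      ∫⁻ y in Ioi 0, ENNReal.ofReal (r * entranceDensity α (v - s) y) *
        posMoment α r n (t - v) y) hH2, posMoment, if_neg hx.ne', mul_add]
  have e3 : ∀ s ∈ Ioo 0 t, ((n : ℝ≥0∞) + 1) * ∫⁻ u in Ioo 0 (t - s),
      ENNReal.ofReal (hittingDensity α x s) * ∫⁻ y in Ioi 0,
        ENNReal.ofReal (r * entranceDensity α (s + u - s) y) * posMoment α r n (t - (s + u)) y =
      ENNReal.ofReal (hittingDensity α x s) * occMoment α r (n + 1) 0 (t - s) := by
    intro s hs
    rw [lintegral_const_mul' _ _ ENNReal.ofReal_ne_top,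
      ← posMoment_step_zero h0 h1 hr0 hr1 n (sub_pos.2 hs.2), mul_left_comm]
    simp_rw [add_sub_cancel_left, sub_sub]
  -- For `s ≥ t` no time is left after the first zero and a moment of order `n + 1 ≥ 1` vanishes;
  -- the integral may run over all `s > 0` to match the first part.
  have e4 : ∫⁻ s in Ioo 0 t,
      ENNReal.ofReal (hittingDensity α x s) * occMoment α r (n + 1) 0 (t - s) =
      ∫⁻ s in Ioi 0, ENNReal.ofReal (hittingDensity α x s) *
        occMoment α r (n + 1) 0 (t - s) := by
    rw [← Iio_inter_Ioi, ← setLIntegral_indicator measurableSet_Iio]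
    refine lintegral_congr fun s => ?_
    by_cases h : s < t
    · rw [indicator_of_mem (show s ∈ Iio t from h)]
    · rw [indicator_of_notMem (show s ∉ Iio t from h),
        occMoment_eq_zero n (by linarith : t - s ≤ 0), mul_zero]
  have hn : ((n : ℝ≥0∞) + 1) ≠ ⊤ := by finiteness
  rw [← lintegral_const_mul' _ _ hn, ← lintegral_const_mul' _ _ hn,
    setLIntegral_congr_fun measurableSet_Ioo e3, e4, ← lintegral_add_right _ (by
      exact Measurable.mul (by fun_prop)
        (measurable_occMoment h0 h1 hr0 hr1 _ (by fun_prop) (by fun_prop)))]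
  refine setLIntegral_congr_fun measurableSet_Ioi fun s hs => ?_
  rw [lintegral_const_mul' _ _ ENNReal.ofReal_ne_top, mul_left_comm, ← mul_add,
    occMoment_step h0 h1 hr0 hr1 n ht hs]

end

/-! ### The time spent positive by a skew Bessel process -/

/-- Change of variable `-d(F ^ (n + 1)) = (n + 1) F ^ n dμ` for the tail `F` of an atomless measure.
Inductively, Tonelli produces the factor `μ (Ioo s w)`, which together with `μ (Ioi w)` adds up to
the full tail `μ (Ioi s)`. -/
theorem measure_Ioi_pow_succ (μ : Measure ℝ) [IsFiniteMeasure μ] [NullSingletonClass μ] (n : ℕ)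
    (s : ℝ) : ((n : ℝ≥0∞) + 1) * ∫⁻ u in Ioi s, μ (Ioi u) ^ n ∂μ = μ (Ioi s) ^ (n + 1) := by
  have hf : Measurable fun u => μ (Ioi u) :=
    Antitone.measurable fun u v h => measure_mono (Ioi_subset_Ioi h)
  induction n generalizing s with
  | zero => simp
  | succ n ih =>
    have e1 : ∀ w ∈ Ioi s, μ (Ioo s w) + μ (Ioi w) = μ (Ioi s) := by
      intro w hw
      rw [measure_congr Ioo_ae_eq_Ioc, ← measure_union _ measurableSet_Ioi,
        Ioc_union_Ioi_eq_Ioi (le_of_lt hw)]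
      rw [Set.disjoint_left]
      intro x hx hx'
      exact absurd hx.2 (not_le.2 hx')
    have e2 : ∫⁻ u in Ioi s, μ (Ioi u) ^ (n + 1) ∂μ =
        ((n : ℝ≥0∞) + 1) * ∫⁻ w in Ioi s, μ (Ioo s w) * μ (Ioi w) ^ n ∂μ := by
      simp_rw [← ih]
      rw [lintegral_const_mul' _ _ (by finiteness),
        lintegral_region_swap (A' := Ioi s) (B := fun u => Ioi u) (B' := fun w => Ioo s w)
          (H := fun w _ => μ (Ioi w) ^ n) measurableSet_Ioi measurableSet_Ioi
          (fun _ => measurableSet_Ioi) (fun _ => measurableSet_Ioo) ?_ ?_ ?_]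
      · congr 1
        refine lintegral_congr fun w => ?_
        rw [lintegral_const, Measure.restrict_apply_univ, mul_comm]
      · intro w u
        simp only [mem_Ioi, mem_Ioo]
        exact ⟨fun h => ⟨h.1.trans h.2, h⟩, fun h => h.2⟩
      · simp only [mem_Ioi]
        exact (measurableSet_lt measurable_const measurable_snd).inter
          (measurableSet_lt measurable_snd measurable_fst)
      · exact (hf.pow_const n).comp measurable_fst
    have hg : Measurable fun w => μ (Ioo s w) :=
      Monotone.measurable fun u v h => measure_mono (Ioo_subset_Ioo_right h)
    have hn : ((n : ℝ≥0∞) + 1) ≠ ⊤ := by finiteness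
    push_cast
    rw [add_mul ((n : ℝ≥0∞) + 1), one_mul]
    nth_rewrite 2 [e2]
    rw [← mul_add, ← lintegral_add_left (hf.pow_const _), pow_succ _ (n + 1), ← ih, mul_assoc,
      ← lintegral_mul_const _ (hf.pow_const n)]
    congr 1
    refine setLIntegral_congr_fun measurableSet_Ioi fun w hw => ?_
    rw [← e1 w hw]
    ring

section

variable {Ω : Type*} [mΩ : MeasurableSpace Ω] {α r : ℝ} {κ : Measure Ω} {B : ℝ≥0 → Ω → ℝ}

/-- Restricting the Markov property to `B s ≥ 0` and to positive values at time `s + t` leaves only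
the part of the transition density described by `skewKernel`. The recursion restarts only at
positive points, so negative ones are never needed. -/
theorem setLIntegral_markov [SFinite κ] (h0 : 0 < α) (hB : IsSkewBessel α r B κ) {s t : ℝ≥0}
    (ht : 0 < t) {G : Set Ω}
    (hG : MeasurableSet[⨆ u : Iic s, MeasurableSpace.comap (B u) inferInstance] G)
    (hpos : ∀ᵐ ω ∂(κ.restrict G), 0 ≤ B s ω) {g : ℝ → ℝ≥0∞} (hg : Measurable g) :
    ∫⁻ ω in G ∩ {ω | 0 < B (s + t) ω}, g (B (s + t) ω) ∂κ =
      ∫⁻ ω in G, (∫⁻ y in Ioi 0, skewKernel α r t (B s ω) y * g y) ∂κ := by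
  have hGm : MeasurableSet G :=
    (iSup_le fun u : Iic s => (hB.measurable u).comap_le) G hG
  have hBs := hB.measurable s
  have hBt := hB.measurable (s + t)
  have hkm : Measurable fun w : Ω × ℝ => skewKernel α r t (B s w.1) w.2 :=
    measurable_skewKernel α r measurable_const (by fun_prop) measurable_snd
  have hkm' : Measurable fun y => ∫⁻ ω in G, skewKernel α r t (B s ω) y ∂κ :=
    Measurable.lintegral_prod_left' hkm
  have key : ((κ.restrict G).map (B (s + t))).restrict (Ioi 0) =
      (volume.restrict (Ioi 0)).withDensity
        fun y => ∫⁻ ω in G, skewKernel α r t (B s ω) y ∂κ := by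
    ext D hD
    rw [Measure.restrict_apply hD, Measure.map_apply hBt (hD.inter measurableSet_Ioi),
      Measure.restrict_apply (hBt (hD.inter measurableSet_Ioi)), inter_comm,
      hB.markov s t ht G hG _ (hD.inter measurableSet_Ioi), withDensity_apply _ hD,
      Measure.restrict_restrict hD, lintegral_lintegral_swap
        (by exact (hkm.comp measurable_swap).aemeasurable)]
    refine lintegral_congr_ae ?_
    filter_upwards [hpos] with ω hω
    rw [skewTransition, withDensity_apply _ (hD.inter measurableSet_Ioi)]
    exact setLIntegral_congr_fun (hD.inter measurableSet_Ioi) fun y hy =>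
      skewTransitionDensity_eq h0 (by exact_mod_cast ht) hω hy.2
  have hS : MeasurableSet {ω | 0 < B (s + t) ω} := measurableSet_lt measurable_const hBt
  calc ∫⁻ ω in G ∩ {ω | 0 < B (s + t) ω}, g (B (s + t) ω) ∂κ
      = ∫⁻ y, g y ∂(((κ.restrict G).map (B (s + t))).restrict (Ioi 0)) := by
        rw [setLIntegral_map measurableSet_Ioi hg hBt, Measure.restrict_restrict
          (hBt measurableSet_Ioi), inter_comm]
        rfl
    _ = ∫⁻ y in Ioi 0, ∫⁻ ω in G, skewKernel α r t (B s ω) y * g y ∂κ := by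
        rw [key, lintegral_withDensity_eq_lintegral_mul _ hkm' hg]
        refine lintegral_congr fun y => ?_
        rw [Pi.mul_apply, lintegral_mul_const]
        exact hkm.comp (by fun_prop : Measurable fun ω : Ω => (ω, y))
    _ = _ := by
        rw [lintegral_lintegral_swap]
        exact Measurable.aemeasurable (Measurable.mul (hkm.comp measurable_swap)
          (hg.comp measurable_fst))

/-- The time spent positive between `s` and `1`. -/
noncomputable def posTime (B : ℝ≥0 → Ω → ℝ) (s : ℝ) (ω : Ω) : ℝ≥0∞ :=
  volume ({u : ℝ | 0 < B u.toNNReal ω} ∩ Ioo s 1)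

theorem measurable_path (hB : IsSkewBessel α r B κ) :
    Measurable fun w : ℝ × Ω => B w.1.toNNReal w.2 :=
  (measurable_uncurry_of_continuous_of_measurable hB.continuous hB.measurable).comp
    ((measurable_real_toNNReal.comp measurable_fst).prodMk measurable_snd)

theorem measurableSet_path_pos (hB : IsSkewBessel α r B κ) (ω : Ω) :
    MeasurableSet {u : ℝ | 0 < B u.toNNReal ω} :=
  measurableSet_lt measurable_const
    ((measurable_path hB).comp (by fun_prop : Measurable fun u : ℝ => (u, ω)))

theorem measurable_posTime (hB : IsSkewBessel α r B κ) :
    Measurable fun w : ℝ × Ω => posTime B w.1 w.2 := by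
  have hS : MeasurableSet {w : (ℝ × Ω) × ℝ |
      0 < B w.2.toNNReal w.1.2 ∧ w.1.1 < w.2 ∧ w.2 < 1} := by
    have h1 : Measurable fun w : (ℝ × Ω) × ℝ => B w.2.toNNReal w.1.2 :=
      (measurable_path hB).comp (by fun_prop : Measurable fun w : (ℝ × Ω) × ℝ => (w.2, w.1.2))
    have h2 : Measurable fun w : (ℝ × Ω) × ℝ => w.1.1 := by fun_prop
    have h3 : Measurable fun w : (ℝ × Ω) × ℝ => w.2 := by fun_prop
    exact (measurableSet_lt measurable_const h1).inter
      ((measurableSet_lt h2 h3).inter (measurableSet_lt h3 measurable_const))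
  exact measurable_measure_prodMk_left hS

/-- Applies `measure_Ioi_pow_succ` to Lebesgue measure on the set of times in `(s, 1)` at which the
path is positive. -/
theorem posTime_pow_succ (hB : IsSkewBessel α r B κ) (n : ℕ) (s : ℝ) (ω : Ω) :
    posTime B s ω ^ (n + 1) = ((n : ℝ≥0∞) + 1) * ∫⁻ u in Ioo s 1,
      {u : ℝ | 0 < B u.toNNReal ω}.indicator (fun u => posTime B u ω ^ n) u := by
  set S : Set ℝ := {u : ℝ | 0 < B u.toNNReal ω} with hS
  have hSm : MeasurableSet S := measurableSet_path_pos hB ω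
  set μ : Measure ℝ := volume.restrict (S ∩ Ioo s 1) with hμ
  have hfin : IsFiniteMeasure μ :=
    isFiniteMeasure_restrict.2 ((measure_mono inter_subset_right).trans_lt (by simp)).ne
  have e : ∀ u, s ≤ u → μ (Ioi u) = posTime B u ω := by
    intro u hu
    rw [hμ, Measure.restrict_apply measurableSet_Ioi, posTime, ← hS]
    congr 1
    ext x
    simp only [mem_inter_iff, mem_Ioi, mem_Ioo]
    exact ⟨fun h => ⟨h.2.1, h.1, h.2.2.2⟩, fun h => ⟨h.2.1, h.1, hu.trans_lt h.2.1, h.2.2⟩⟩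
  rw [← e s le_rfl, ← measure_Ioi_pow_succ μ n s]
  congr 1
  rw [setLIntegral_indicator hSm, hμ, Measure.restrict_restrict measurableSet_Ioi,
    inter_eq_self_of_subset_right (fun x hx => hx.2.1)]
  refine setLIntegral_congr_fun (hSm.inter measurableSet_Ioo) fun u hu => ?_
  rw [← e u hu.2.1.le]

/-- Induction on `n`. The event `G` is carried along because the inductive hypothesis is used at the
later time `u` on `G ∩ {B u > 0}`, an event of the past of `u`. Thus the one-step Markov property
suffices. -/
theorem setLIntegral_posTime_pow [IsFiniteMeasure κ] (h0 : 0 < α) (h1 : α < 1) (hr0 : 0 < r)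
    (hr1 : r < 1) (hB : IsSkewBessel α r B κ) (n : ℕ) {s : ℝ≥0} (hs : s < 1) {G : Set Ω}
    (hG : MeasurableSet[⨆ u : Iic s, MeasurableSpace.comap (B u) inferInstance] G)
    (hpos : ∀ᵐ ω ∂(κ.restrict G), 0 ≤ B s ω) :
    ∫⁻ ω in G, posTime B s ω ^ n ∂κ = ∫⁻ ω in G, posMoment α r n (1 - s) (B s ω) ∂κ := by
  induction n generalizing s G with
  | zero =>
    refine lintegral_congr_ae ?_
    filter_upwards [hpos] with ω hω
    rw [posMoment_zero h0 h1 hr0 hr1 hω, pow_zero]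
  | succ n ih =>
    have hGm : MeasurableSet G :=
      (iSup_le fun u : Iic s => (hB.measurable u).comap_le) G hG
    have hs' : (s : ℝ) < 1 := by exact_mod_cast hs
    have hn : ((n : ℝ≥0∞) + 1) ≠ ⊤ := by finiteness
    have hBs := hB.measurable s
    have hP : MeasurableSet {w : ℝ × Ω | 0 < B w.1.toNNReal w.2} :=
      measurableSet_lt measurable_const (measurable_path hB)
    -- The inductive hypothesis at time `u` replaces the power of `posTime` by `posMoment` at the
    -- position `B u`, and the Markov property carries this back to time `s`.
    have step : ∀ u ∈ Ioo (s : ℝ) 1, ∫⁻ ω in G,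
        {u : ℝ | 0 < B u.toNNReal ω}.indicator (fun u => posTime B u ω ^ n) u ∂κ =
        ∫⁻ ω in G, (∫⁻ y in Ioi 0, skewKernel α r (u - s) (B s ω) y *
          posMoment α r n (1 - u) y) ∂κ := by
      intro u hu
      have hu0 : 0 ≤ u := s.2.trans hu.1.le
      lift u to ℝ≥0 using hu0
      have hsu : s < u := by exact_mod_cast hu.1
      obtain ⟨t, rfl⟩ := exists_add_of_le hsu.le
      have ht : 0 < t := by simpa using hsu
      have hD : MeasurableSet {ω | 0 < B (s + t) ω} :=
        measurableSet_lt measurable_const (hB.measurable _)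
      have hD' : MeasurableSet[⨆ u : Iic (s + t), MeasurableSpace.comap (B u) inferInstance]
          {ω | 0 < B (s + t) ω} := by
        refine (le_iSup (fun u : Iic (s + t) => MeasurableSpace.comap (B u) inferInstance)
          ⟨s + t, mem_Iic.2 le_rfl⟩) _ ⟨Ioi 0, measurableSet_Ioi, rfl⟩
      have hG' : MeasurableSet[⨆ u : Iic (s + t), MeasurableSpace.comap (B u) inferInstance] G :=
        (iSup_le fun u : Iic s => le_iSup
          (fun u : Iic (s + t) => MeasurableSpace.comap (B u) inferInstance)
          ⟨u, mem_Iic.2 ((mem_Iic.1 u.2).trans (by simp))⟩) G hG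
      have hpos' : ∀ᵐ ω ∂(κ.restrict (G ∩ {ω | 0 < B (s + t) ω})), 0 ≤ B (s + t) ω := by
        filter_upwards [ae_restrict_mem (hGm.inter hD)] with ω hω using le_of_lt hω.2
      have h := ih (by exact_mod_cast hu.2) (MeasurableSet.inter hG' hD') hpos'
      have hmark := setLIntegral_markov h0 hB ht hG hpos
        (g := fun y => posMoment α r n (1 - ((s + t : ℝ≥0) : ℝ)) y)
        (measurable_posMoment h0 h1 hr0 hr1 n measurable_const measurable_id)
      rw [hmark] at h
      have e : ((s + t : ℝ≥0) : ℝ) - s = t := by push_cast; ring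
      rw [e, ← h, inter_comm, ← setLIntegral_indicator hD]
      refine lintegral_congr fun ω => ?_
      by_cases hω : 0 < B (s + t) ω
      · rw [indicator_of_mem (by simpa using hω), indicator_of_mem (by exact hω)]
      · rw [indicator_of_notMem (by simpa using hω), indicator_of_notMem (by exact hω)]
    have hm1 : Measurable fun w : Ω × ℝ =>
        {u : ℝ | 0 < B u.toNNReal w.1}.indicator (fun u => posTime B u w.1 ^ n) w.2 := by
      have := (((measurable_posTime hB).pow_const n).indicator hP).comp measurable_swap
      exact this
    have hm2 : Measurable fun w : Ω × ℝ => ∫⁻ y in Ioi 0, skewKernel α r (w.2 - s) (B s w.1) y *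
        posMoment α r n (1 - w.2) y :=
      Measurable.lintegral_prod_right' (f := fun w : (Ω × ℝ) × ℝ =>
        skewKernel α r (w.1.2 - s) (B s w.1.1) w.2 * posMoment α r n (1 - w.1.2) w.2)
        (Measurable.mul (measurable_skewKernel α r (by fun_prop) (by fun_prop) (by fun_prop))
          (measurable_posMoment h0 h1 hr0 hr1 n (by fun_prop) (by fun_prop)))
    simp_rw [posTime_pow_succ hB]
    rw [lintegral_const_mul' _ _ hn, lintegral_lintegral_swap hm1.aemeasurable,
      setLIntegral_congr_fun measurableSet_Ioo step,
      ← lintegral_lintegral_swap hm2.aemeasurable, ← lintegral_const_mul' _ _ hn]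
    refine lintegral_congr_ae ?_
    filter_upwards [hpos] with ω hω
    rw [← posMoment_step h0 h1 hr0 hr1 n (sub_pos.2 hs') hω, lintegral_Ioo_comp_add]
    simp_rw [add_sub_cancel_left, sub_sub]

theorem lintegral_posTime_pow [IsProbabilityMeasure κ] (h0 : 0 < α) (h1 : α < 1) (hr0 : 0 < r)
    (hr1 : r < 1) (hB : IsSkewBessel α r B κ) (n : ℕ) :
    ∫⁻ ω, posTime B 0 ω ^ n ∂κ = ∫⁻ a, ENNReal.ofReal a ^ n ∂(lampertiLaw α r) := by
  have hpos : ∀ᵐ ω ∂(κ.restrict univ), 0 ≤ B 0 ω := by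
    rw [Measure.restrict_univ]
    exact hB.start.mono fun ω h => h.ge
  have h := setLIntegral_posTime_pow h0 h1 hr0 hr1 hB n zero_lt_one MeasurableSet.univ hpos
  rw [setLIntegral_univ, setLIntegral_univ, NNReal.coe_zero, sub_zero] at h
  rw [h]
  have e : ∀ᵐ ω ∂κ, posMoment α r n 1 (B 0 ω) = occMoment α r n 0 1 := by
    filter_upwards [hB.start] with ω hω
    rw [hω, posMoment, if_pos rfl]
  rw [lintegral_congr_ae e, lintegral_const, measure_univ, mul_one,
    occMoment_zero_left n one_pos]
  simp

theorem timePositive_eq (hB : IsSkewBessel α r B κ) (ω : Ω) :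
    timePositive B ω = (posTime B 0 ω).toReal := by
  have hSm := measurableSet_path_pos hB ω
  have e : ∀ s : ℝ, (if 0 < B s.toNNReal ω then (1 : ℝ) else 0) =
      {u : ℝ | 0 < B u.toNNReal ω}.indicator 1 s := fun s => by
    by_cases h : 0 < B s.toNNReal ω <;> simp [h]
  rw [timePositive, intervalIntegral.integral_of_le zero_le_one, integral_Ioc_eq_integral_Ioo]
  simp_rw [e]
  rw [integral_indicator_one hSm, measureReal_def, Measure.restrict_apply hSm, posTime]

theorem posTime_le_one {Ω : Type*} (B : ℝ≥0 → Ω → ℝ) (ω : Ω) : posTime B 0 ω ≤ 1 :=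
  (measure_mono inter_subset_right).trans (by simp)

theorem measurable_timePositive (hB : IsSkewBessel α r B κ) : Measurable (timePositive B) := by
  have : timePositive B = fun ω => (posTime B 0 ω).toReal := funext (timePositive_eq hB)
  rw [this]
  exact ((measurable_posTime hB).comp
    (by fun_prop : Measurable fun ω : Ω => ((0 : ℝ), ω))).ennreal_toReal

/-- Lamperti's occupation law for a fixed skewness: both laws are carried by `[0, 1]` and have the
same moments. -/
theorem map_timePositive [IsProbabilityMeasure κ] (h0 : 0 < α) (h1 : α < 1) (hr0 : 0 < r)
    (hr1 : r < 1) (hB : IsSkewBessel α r B κ) :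
    κ.map (timePositive B) = lampertiLaw α r := by
  have hp := isProbabilityMeasure_lampertiLaw h0 h1 hr0 hr1
  have hm := measurable_timePositive hB
  have hA : ∀ ω, timePositive B ω ∈ Icc (0 : ℝ) 1 := fun ω => by
    rw [timePositive_eq hB]
    exact ⟨ENNReal.toReal_nonneg, ENNReal.toReal_le_of_le_ofReal zero_le_one
      (by simpa using posTime_le_one B ω)⟩
  have hp' : IsProbabilityMeasure (κ.map (timePositive B)) :=
    Measure.isProbabilityMeasure_map hm.aemeasurable
  refine ext_of_moments ?_ ((ae_lampertiLaw α r).mono fun x hx => Ioo_subset_Icc_self hx)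
    fun n => ?_
  · rw [ae_map_iff hm.aemeasurable (p := fun x => x ∈ Icc (0 : ℝ) 1) measurableSet_Icc]
    exact ae_of_all _ hA
  · rw [integral_map hm.aemeasurable (by fun_prop),
      integral_eq_lintegral_of_nonneg_ae (ae_of_all _ fun ω => pow_nonneg (hA ω).1 n)
        (hm.pow_const n).aestronglyMeasurable,
      integral_eq_lintegral_of_nonneg_ae ((ae_lampertiLaw α r).mono fun a ha =>
        pow_nonneg ha.1.le n) (by fun_prop)]
    congr 1
    have h := lintegral_posTime_pow h0 h1 hr0 hr1 hB n
    rw [lintegral_congr_ae (g := fun a => ENNReal.ofReal a ^ n)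
      ((ae_lampertiLaw α r).mono fun a ha => ENNReal.ofReal_pow ha.1.le n), ← h]
    refine lintegral_congr fun ω => ?_
    rw [ENNReal.ofReal_pow (hA ω).1, timePositive_eq hB,
      ENNReal.ofReal_toReal ((posTime_le_one B ω).trans_lt ENNReal.one_lt_top).ne]

end

/-! ### Randomly skewed Bessel processes -/

/-- The odds of the skewness `p b / (1 - p + p b)` are those of `p` multiplied by `b`. -/
theorem scale_skewness {α p b : ℝ} (hp0 : 0 < p) (hp1 : p < 1) (hb : 0 < b) :
    scale α (p * b / ((1 - p) + p * b)) = scale α p * b ^ (1 / α) := by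
  have hq : 0 < 1 - p := by linarith
  have hz : 0 < 1 - p + p * b := by positivity
  have e : p * b / (1 - p + p * b) / (1 - p * b / (1 - p + p * b)) = p / (1 - p) * b := by
    have e' : 1 - p * b / (1 - p + p * b) = (1 - p) / (1 - p + p * b) := by
      field_simp
      ring
    rw [e']
    field_simp
  rw [scale, e, Real.mul_rpow (by positivity) hb.le, scale]

theorem ae_skewnessLaw {θ p : ℝ} (hp0 : 0 < p) (hp1 : p < 1) :
    ∀ᵐ r ∂(skewnessLaw θ p), r ∈ Ioo (0 : ℝ) 1 := by
  have hq : 0 < 1 - p := by linarith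
  rw [skewnessLaw, ae_map_iff (by fun_prop) (p := fun x => x ∈ Ioo (0 : ℝ) 1) measurableSet_Ioo]
  filter_upwards [ae_betaMeasure θ (1 - θ)] with b hb
  have hb0 : 0 < b := hb.1
  have hz : 0 < 1 - p + p * b := by positivity
  refine ⟨by positivity, ?_⟩
  rw [div_lt_one hz]
  linarith

/-- Lamperti's law with skewness `r` is the image of `X_α` with scale `scale α r`. By
`scale_skewness` the random scale is `scale α p` times `B ^ (1 / α)`, so mixing over `r` is the same
as multiplying `X_α` by an independent `B ^ (1 / α)`. -/
theorem lintegral_lampertiLaw_skewness {α θ p : ℝ} (h0 : 0 < α) (h1 : α < 1) (hθ : 0 < θ)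
    (hθ1 : θ < 1) (hp0 : 0 < p) (hp1 : p < 1) {D : Set ℝ} (hD : MeasurableSet D) :
    ∫⁻ r, lampertiLaw α r D ∂(skewnessLaw θ p) =
      squash (scale α p) (betaRatioLaw α θ) D := by
  have hpr := isProbabilityMeasure_ratioLaw h0 h1
  have hpb := isProbabilityMeasureBeta hθ (by linarith : 0 < 1 - θ)
  have hS : MeasurableSet {w : ℝ × ℝ | scale α w.1 * w.2 / (scale α w.1 * w.2 + 1) ∈ D} := by
    have : Measurable fun w : ℝ × ℝ => scale α w.1 * w.2 / (scale α w.1 * w.2 + 1) := by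
      unfold scale
      fun_prop
    exact this hD
  have e1 : ∀ᵐ r ∂(skewnessLaw θ p), lampertiLaw α r D =
      ratioLaw α {x | scale α r * x / (scale α r * x + 1) ∈ D} := by
    filter_upwards [ae_skewnessLaw hp0 hp1] with r hr
    rw [lampertiLaw_eq h0 h1 hr.1 hr.2, squash, Measure.map_apply (by fun_prop) hD]
    rfl
  rw [lintegral_congr_ae e1, skewnessLaw,
    lintegral_map (f := fun r => ratioLaw α {x | scale α r * x / (scale α r * x + 1) ∈ D})
      (measurable_measure_prodMk_left hS) (by fun_prop), squash,
    Measure.map_apply (by fun_prop) hD, betaRatioLaw, Measure.map_apply (by fun_prop)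
      ((by fun_prop : Measurable fun x => scale α p * x / (scale α p * x + 1)) hD),
    Measure.prod_apply]
  · refine lintegral_congr_ae ?_
    filter_upwards [ae_betaMeasure θ (1 - θ)] with b hb
    rw [scale_skewness hp0 hp1 hb.1]
    congr 1
    ext x
    simp only [Set.mem_ofPred_eq, mem_preimage, mul_assoc]
  · have : Measurable fun w : ℝ × ℝ => w.1 ^ (1 / α) * w.2 := by fun_prop
    exact this ((by fun_prop : Measurable fun x => scale α p * x / (scale α p * x + 1)) hD)

theorem hasLaw_timePositive {α θ p : ℝ} (h0 : 0 < α) (h1 : α < 1) (hθ : 0 < θ) (hθ1 : θ < 1)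
    (hp0 : 0 < p) (hp1 : p < 1) {Ω : Type*} [MeasurableSpace Ω] {μ : Measure Ω}
    {ξ : Ω → ℝ} {B : ℝ≥0 → Ω → ℝ} (hξ : μ.map ξ = skewnessLaw θ p)
    (hB : IsRandomlySkewedBessel α ξ B μ) :
    HasLaw (timePositive B) (squash (scale α p) (betaRatioLaw α θ)) μ := by
  obtain ⟨κ, hκ, hcond, hskew⟩ := hB.conditional
  rw [hξ] at hskew
  have hpb := isProbabilityMeasureBeta hθ (by linarith : 0 < 1 - θ)
  have hps : IsProbabilityMeasure (skewnessLaw θ p) :=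
    Measure.isProbabilityMeasure_map (by fun_prop)
  -- Measurability and path continuity hold for every outcome and do not involve the measure, so one
  -- good value of the skewness yields measurability of the occupation time.
  obtain ⟨r₀, hr₀⟩ := hskew.exists
  have hm : Measurable (timePositive B) := measurable_timePositive hr₀
  refine ⟨hm.aemeasurable, ?_⟩
  ext D hD
  have h := hcond univ MeasurableSet.univ _ (hm hD)
  rw [preimage_univ, univ_inter, Measure.restrict_univ, hξ] at h
  rw [Measure.map_apply hm hD, h, ← lintegral_lampertiLaw_skewness h0 h1 hθ hθ1 hp0 hp1 hD]
  refine lintegral_congr_ae ?_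
  filter_upwards [hskew, ae_skewnessLaw hp0 hp1] with r hr hr'
  rw [← map_timePositive h0 h1 hr'.1 hr'.2 hr, Measure.map_apply hm hD]

end SkewProof

theorem proposition4p6 (α θ p : ℝ) (hα0 : 0 < α) (hα1 : α < 1) (hθ : 0 < θ)
    (hαθ : α * θ < 1) (hp0 : 0 < p) (hp1 : p < 1) :
    -- the case `0 < θ < 1`, with the random skewness
    (θ < 1 →
      skewnessLaw θ p = ((gammaMeasure θ 1).prod (gammaMeasure (1 - θ) 1)).map
        (fun g => p * g.1 / (g.1 + g.2 * (1 - p))) ∧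
      (∀ (Ω : Type*) [MeasurableSpace Ω] (μ : Measure Ω) [IsProbabilityMeasure μ]
          (ξ : Ω → ℝ) (B : ℝ≥0 → Ω → ℝ),
        μ.map ξ = skewnessLaw θ p → IsRandomlySkewedBessel α ξ B μ →
          HasLaw (timePositive B) (squash (scale α p) (betaRatioLaw α θ)) μ) ∧
      squash (scale α p) (betaRatioLaw α θ) =
        squash (scale α p) (dirichletMeanLaw 1 (zeroMixture (α * θ) (ratioLaw α))) ∧
      squash (scale α p) (betaRatioLaw α θ) =
        (volume.restrict (Ioo 0 1)).withDensity
          (fun y => ENNReal.ofReal (occDensity α θ p y))) ∧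
    -- the case `0 < α θ < 1`
    squash (scale α p) (dirichletMeanLaw 1 (zeroMixture (α * θ) (ratioLaw α))) =
      (volume.restrict (Ioo 0 1)).withDensity (fun y => ENNReal.ofReal (occDensity α θ p y)) ∧
    (∀ (E : Type*) [MeasurableSpace E] (ν : Measure E) [IsProbabilityMeasure ν] (C : Set E),
      (∀ x, ν {x} = 0) → MeasurableSet C → ∫ x, x ∂(pdSetLaw α (α * θ) ν C) = p →
        productLaw (betaMeasure (α * θ) (1 - α * θ)) (pdSetLaw α (α * θ) ν C) =
        productLaw (betaMeasure (α * θ) (1 - α * θ))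
          (dirichletMeanLaw (α * θ) (lampertiLaw α p))) ∧
    productLaw (betaMeasure (α * θ) (1 - α * θ)) (dirichletMeanLaw (α * θ) (lampertiLaw α p)) =
      dirichletMeanLaw 1 (zeroMixture (α * θ) (lampertiLaw α p)) ∧
    dirichletMeanLaw 1 (zeroMixture (α * θ) (lampertiLaw α p)) =
      (volume.restrict (Ioo 0 1)).withDensity
        (fun y => ENNReal.ofReal ((1 - y) / (1 - p) ^ θ * occDensity α θ p y)) ∧
    (∀ y ∈ Ioo (0 : ℝ) 1, (1 - y) / (1 - p) ^ θ * occDensity α θ p y =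
      1 / Real.pi * (y ^ (α * θ - 1) * sineFactor α θ p y) / denom α p y ^ (θ / 2)) := by
  refine ⟨fun hθ1 => ⟨SkewProof.skewnessLaw_eq hθ hθ1 hp0 hp1, ?_, ?_, ?_⟩, ?_, ?_,
    SkewProof.productLaw_dirichletMeanLaw hα0 hα1 hθ hαθ hp0 hp1,
    SkewProof.dirichletMeanLaw_mixture_eq hα0 hα1 hθ hαθ hp0 hp1,
    fun y hy => SkewProof.tilted_occDensity hp1 hy⟩
  · intro Ω _ μ _ ξ B hξ hB
    exact SkewProof.hasLaw_timePositive hα0 hα1 hθ hθ1 hp0 hp1 hξ hB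
  · rw [SkewProof.betaRatioLaw_eq hα0 hα1 hθ hθ1,
      SkewProof.dirichletMeanLaw_ratio hα0 hα1 hθ hαθ]
  · rw [SkewProof.betaRatioLaw_eq hα0 hα1 hθ hθ1, SkewProof.squash_tiltedLaw hα0 hα1 hp0 hp1]
  · rw [SkewProof.dirichletMeanLaw_ratio hα0 hα1 hθ hαθ,
      SkewProof.squash_tiltedLaw hα0 hα1 hp0 hp1]
  · intro E _ ν _ C _ hC hν
    exact SkewProof.productLaw_pdSetLaw hα0 hα1 hθ hαθ hp0 hp1 ν hC hν
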